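/- **Setting.** Let $M$ be a smooth manifold of dimension $n\ge 2$ and $\nabla$ a smooth torsion-free affine connection on $M$. Its curvature is $(\nabla_a\nabla_b-\nabla_b\nabla_a)v^c=R_{ab}{}^c{}_d v^d$, and $\mathrm{Ric}_{ab}=R_{ca}{}^c{}_b$. The projective Schouten tensor $P_{ab}$ and $\beta_{ab}=-2P_{[ab]}$ are determined by $(n-1)P_{ab}=\mathrm{Ric}_{ab}+\beta_{ab}$. The projective Weyl tensor $W$ is defined by $R_{ab}{}^c{}_d=W_{ab}{}^c{}_d+2\delta^c_{[a}P_{b]d}+\beta_{ab}\delta^c_d$, and the Cotton tensor is $C_{dab}=2\nabla_{[a}P_{b]d}$. A torsion-free connection $\widehat\nabla$ is projectively equivalent to $\nabla$ if $\widehat\nabla_aY^b=\nabla_aY^b+\Upsilon_aY^b+\Upsilon_cY^c\delta_a^b$ for some smooth 1-form $\Upsilon$. **The tensor $Q$.** Let $N_0+\dots+N_r=N$ with $N_0\ge1$ and $N_1,\dots,N_r\ge 0$, where $2N$ is a multiple of $n$, and let $F:\coprod_{j=0}^r\{1,\dots,2N_j\}\to\{1,\dots,2N/n\}$ be a map all of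 whose fibres have exactly $n$ elements. Put $$(P^k)_{a_1\cdots a_{2k}}{}^s{}_t=W_{a_1a_2}{}^{c_1}{}_tW_{a_3a_4}{}^{c_2}{}_{c_1}\cdots W_{a_{2k-1}a_{2k}}{}^s{}_{c_{k-1}},\qquad (P^0)^s{}_t=\delta^s_t .$$ Let $Q_t{}^s=(Q^{\underline N,F})_t{}^s$, a section of $\mathrm{End}(TM)\otimes(\Lambda^nT^*M)^{2N/n}$, be obtained from $(P^{N_0})_{a^0_1\cdots a^0_{2N_0}}{}^s{}_t\prod_{j=1}^r(P^{N_j})_{a^j_1\cdots a^j_{2N_j}}{}^{c_j}{}_{c_j}$ by skewing, for each $i$, the $n$ indices $a^j_\alpha$ with $F(j,\alpha)=i$, taken in lexicographic order of $(j,\alpha)$; in a frame this means contracting each such group of indices with $\frac1{n!}\varepsilon^{\cdots}$, where $\varepsilon$ is the permutation symbol. Let $(Q')^{b_1b_2}{}_t{}^s$ be given by the same contraction with the last factor $W_{a^0_{2N_0-1}a^0_{2N_0}}{}^s{}_{c_{N_0-1}}$ of $P^{N_0}$ omitted and with the two indices $a^0_{2N_0-1},a^0_{2N_0}$ of the symbols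 $\varepsilon$ left free and called $b_1,b_2$. Thus $(Q')^{b_1b_2}{}_t{}^l\,W_{b_1b_2}{}^s{}_l=Q_t{}^s$. Let $\|Q\|$ be the determinant of $Q$ and $\widetilde Q$ its adjugate, and assume that $\|Q\|$ is nowhere zero. Define $$D_{(Q)}^{b_1b_2}{}_i{}^k=\|Q\|^{-1}\,\widetilde Q_i{}^r\,(Q')^{b_1b_2}{}_r{}^k,$$ and, with $D=D_{(Q)}$, $$G^{(Q)}_{ij}=P_{ij}+\nabla_i(D^{ab}{}_j{}^cC_{cab})+D^{ab}{}_i{}^cC_{cab}\,D^{ef}{}_j{}^gC_{gef},$$ $$E^{(Q)}_{ijk}=\nabla_iG^{(Q)}_{jk}+\bigl(2G^{(Q)}_{jk}D^{ab}{}_i{}^c+G^{(Q)}_{ji}D^{ab}{}_k{}^c+G^{(Q)}_{ik}D^{ab}{}_j{}^c\bigr)C_{cab},$$ and let $\gamma^{(Q)}$ be $G^{(Q)}_{a_1b_1}\cdots G^{(Q)}_{a_nb_n}$ skewed over the $a$'s and over the $b$'s, a section of $(\Lambda^nT^*M)^2$. **Theorem.** Under these hypotheses: 1. $D_{(Q)}$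 is a natural left inverse of $W$: $D_{(Q)}^{ab}{}_i{}^c\,W_{ab}{}^j{}_c=\delta_i{}^j$; the recipe for $D_{(Q)}$ gives the same tensor in every frame. 2. The condition that $\|Q\|$ be nowhere zero and the fields $D_{(Q)}$, $G^{(Q)}$, $E^{(Q)}$, $\gamma^{(Q)}$ are projectively invariant (in fact $\|Q\|$ itself and these fields are the same for every smooth torsion-free connection projectively equivalent to $\nabla$) and natural: if $\varphi:M'\to M$ is a local diffeomorphism and $\nabla'=\varphi^*\nabla$, then $\|Q\|$ of $\nabla'$ is nowhere zero and the fields of $\nabla'$ are the pullbacks by $\varphi$ of those of $\nabla$. 3. $G^{(Q)}=0$ if and only if $\nabla$ is projectively equivalent to a Ricci-flat torsion-free connection. 4. $\gamma^{(Q)}$ is nonzero at a point if and only if $G^{(Q)}$ is nondegenerate there, and the following are equivalent: (a) $\nabla$ is projectively equivalent to the Levi-Civita connection of an Einstein metric $g$ (pseudo-Riemannian of arbitrary signature, $\mathrm{Ric}=\lambda g$ with $\lambda$ constant) with $\lambda\neq0$; (b) $E^{(Q)}_{ijk}=0$ and $G^{(Q)}_{[ij]}=0$ everywhere, and $\gamma^{(Q)}$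 is nowhere zero. -/

import Mathlib

open scoped Manifold ContDiff
open Bundle

namespace ProjEinstein

noncomputable section

/-! ### Pointwise algebra: the tensors built from alternated products of Weyl curvatures -/

/-- The combinatorial inputs `(N, 0, (N_0, …, N_r), F)`.  The `2 N_0 + ⋯ + 2 N_r` covariant index
slots `(j, α)` are distributed by `F` over `B` blocks, each of which receives exactly `n` slots;
hence `2 N = n B` with `N = N_0 + ⋯ + N_r`. -/
structure Input (n : ℕ) where
  /-- number of traced factors -/
  r : ℕ
  /-- the parts `N_0, …, N_r` -/
  N : Fin (r + 1) → ℕ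
  /-- the number of blocks, which is forced to be `2 N / n` -/
  B : ℕ
  /-- the distribution of the slots over the blocks -/
  F : (Σₗ j : Fin (r + 1), Fin (2 * N j)) → Fin B
  /-- the untraced factor contains at least one Weyl tensor -/
  N_zero_pos : 0 < N 0
  card_fiber : ∀ i : Fin B, (Finset.univ.filter fun s => F s = i).card = n

namespace Input

variable {n : ℕ} (q : Input n)

/-- The index slots `(j, α)`, `0 ≤ α < 2 N_j`, ordered lexicographically. -/
abbrev Slot : Type := Σₗ j : Fin (q.r + 1), Fin (2 * q.N j)

/-- The slot `(j, α)`. -/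
def slot (j : Fin (q.r + 1)) (α : Fin (2 * q.N j)) : q.Slot := toLex ⟨j, α⟩

/-- The increasing enumeration of the `n` slots in the `i`-th block. -/
def block (i : Fin q.B) : Fin n → q.Slot :=
  (Finset.univ.filter fun s => q.F s = i).orderEmbOfFin (q.card_fiber i)

/-- The last but one slot of the untraced factor. -/
def lastSlot₁ : q.Slot := q.slot 0 ⟨2 * q.N 0 - 2, by have := q.N_zero_pos; omega⟩

/-- The last slot of the untraced factor. -/
def lastSlot₂ : q.Slot := q.slot 0 ⟨2 * q.N 0 - 1, by have := q.N_zero_pos; omega⟩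

end Input

/-- The Levi-Civita permutation symbol `ε_{v 0, …, v (n-1)}`. -/
def leviCivita {n : ℕ} (v : Fin n → Fin n) : ℝ :=
  Matrix.det (Matrix.of fun i j : Fin n => if v i = j then (1 : ℝ) else 0)

section Algebra

variable {n : ℕ}

/-- From the components `W a b = (W_{ab}{}^c{}_d)_{c d}`, the components
`(P^k)_{a_1 ⋯ a_{2k}}{}^s{}_t =
  W_{a_1 a_2}{}^{c_1}{}_t W_{a_3 a_4}{}^{c_2}{}_{c_1} ⋯ W_{a_{2k-1} a_{2k}}{}^s{}_{c_{k-1}}`,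
a matrix with row index `s` and column index `t`. -/
def weylProd (W : Fin n → Fin n → Matrix (Fin n) (Fin n) ℝ) :
    (k : ℕ) → (Fin (2 * k) → Fin n) → Matrix (Fin n) (Fin n) ℝ
  | 0, _ => 1
  | k + 1, a => W (a ⟨2 * k, by omega⟩) (a ⟨2 * k + 1, by omega⟩) *
      weylProd W k (fun i => a ⟨i, by omega⟩)

/-- The product of the traces `(P^{N_j})_{⋯}{}^c{}_c`, `1 ≤ j ≤ r`, when the slot `s` carries
the index `f s`. -/
def traceProd (q : Input n) (W : Fin n → Fin n → Matrix (Fin n) (Fin n) ℝ)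
    (f : q.Slot → Fin n) : ℝ :=
  ∏ j : Fin q.r, (weylProd W (q.N j.succ) fun α => f (q.slot j.succ α)).trace

/-- The product over the blocks of the permutation symbols of the indices in the block. -/
def blockSign (q : Input n) (f : q.Slot → Fin n) : ℝ :=
  ∏ i : Fin q.B, leviCivita fun k => f (q.block i k)

/-- The components `Q_t{}^s` (row index `s`, column index `t`) of the `End`-valued section with
values in the `B`-th power of the top exterior power of the dual: each of the `B` blocks of `n`
covariant indices is skewed, i.e. paired with `(1 / n!) ε`. -/
def Qmat (q : Input n) (W : Fin n → Fin n → Matrix (Fin n) (Fin n) ℝ) :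
    Matrix (Fin n) (Fin n) ℝ :=
  ((n.factorial : ℝ)⁻¹ ^ q.B) • ∑ f : q.Slot → Fin n,
    (blockSign q f * traceProd q W f) • weylProd W (q.N 0) fun α => f (q.slot 0 α)

/-- The components `(Q')^{b₁ b₂}{}_t{}^s` (row index `s`, column index `t`): the last Weyl factor
of the untraced product is removed and its two slots, which carry `b₁` and `b₂` in the permutation
symbols, are left open.  If these two slots lie in the same block, this is the skewing over the
remaining slots, with the remaining `n - 2` indices of that block turned into two contravariant
ones by the Hodge-star isomorphism, normalised so that `(Q')^{b₁b₂}{}_t{}^l W_{b₁b₂}{}^s{}_l`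
is `Q_t{}^s`. -/
def Qmat' (q : Input n) (W : Fin n → Fin n → Matrix (Fin n) (Fin n) ℝ) (b₁ b₂ : Fin n) :
    Matrix (Fin n) (Fin n) ℝ :=
  ((n.factorial : ℝ)⁻¹ ^ q.B) • ∑ f : q.Slot → Fin n,
    if f q.lastSlot₁ = b₁ ∧ f q.lastSlot₂ = b₂ then
      (blockSign q f * traceProd q W f) • weylProd W (q.N 0 - 1)
        fun α => f (q.slot 0 ⟨α, by omega⟩)
    else 0

/-- The components `D^{b₁ b₂}{}_i{}^k = ‖Q‖⁻¹ adj(Q)_i{}^r (Q')^{b₁ b₂}{}_r{}^k`. -/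
def Dcomp (q : Input n) (W : Fin n → Fin n → Matrix (Fin n) (Fin n) ℝ)
    (b₁ b₂ i k : Fin n) : ℝ :=
  (Qmat q W).det⁻¹ * ∑ r : Fin n, (Qmat q W).adjugate r i * Qmat' q W b₁ b₂ k r

variable {V : Type*} [AddCommGroup V] [Module ℝ V]

/-- The components `W_{ab}{}^c{}_d` in a basis of a tensor `(u, v, w) ↦ W(u, v) w`, i.e.
`u^a v^b W_{ab}{}^c{}_d w^d`. -/
def components (b : Module.Basis (Fin n) ℝ V) (W : V → V → V → V) (i j : Fin n) :
    Matrix (Fin n) (Fin n) ℝ :=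
  Matrix.of fun c d => b.repr (W (b i) (b j) (b d)) c

/-- The determinant `‖Q‖`, a section of a power of the line of top forms, in a frame. -/
def detQ (q : Input n) (b : Module.Basis (Fin n) ℝ V) (W : V → V → V → V) : ℝ :=
  (Qmat q (components b W)).det

/-- The tensor `D^{b₁ b₂}{}_i{}^k`, evaluated on two covectors (slots `b₁`, `b₂`), a vector
(slot `i`) and a covector (slot `k`), by means of a basis. -/
def Dtensor (q : Input n) (b : Module.Basis (Fin n) ℝ V) (W : V → V → V → V)
    (α β : Module.Dual ℝ V) (v : V) (θ : Module.Dual ℝ V) : ℝ :=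
  ∑ b₁ : Fin n, ∑ b₂ : Fin n, ∑ i : Fin n, ∑ k : Fin n,
    Dcomp q (components b W) b₁ b₂ i k * α (b b₁) * β (b b₂) * b.repr v i * θ (b k)

/-- `G_{a₁b₁} ⋯ G_{aₙbₙ}` skewed over the `a`s and over the `b`s, as a form in two `n`-tuples of
vectors. -/
def gammaForm (G : V → V → ℝ) (u v : Fin n → V) : ℝ :=
  ((n.factorial : ℝ)⁻¹) ^ 2 * ∑ σ : Equiv.Perm (Fin n), ∑ τ : Equiv.Perm (Fin n),
    ((Equiv.Perm.sign σ : ℤ) : ℝ) * ((Equiv.Perm.sign τ : ℤ) : ℝ) *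
      ∏ i : Fin n, G (u (σ i)) (v (τ i))

end Algebra

/-! ### Affine connections and their projective curvature -/

section Geometry

variable {n : ℕ} {M : Type*} [TopologicalSpace M] [ChartedSpace (EuclideanSpace ℝ (Fin n)) M]
  [IsManifold (𝓡 n) ∞ M]

variable (n M) in
/-- Affine connections on the `n`-manifold `M`; `∇ Y x v` is the derivative of the vector field
`Y` at `x` in the direction `v`. -/
abbrev AffineConnection : Type _ :=
  CovariantDerivative (𝓡 n) (EuclideanSpace ℝ (Fin n)) (TangentSpace (𝓡 n) : M → Type _)

/-- `∇` is a smooth torsion-free affine connection. -/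
structure IsSmoothTorsionFree (nabla : AffineConnection n M) : Prop where
  smooth : CovariantDerivative.ContMDiffCovariantDerivative nabla ∞
  torsion_eq_zero : nabla.torsion = 0

/-- `∇'` arises from `∇` by the projective change
`∇'_a Y^b = ∇_a Y^b + Υ_a Y^b + Υ_c Y^c δ_a^b` with a smooth 1-form `Υ`. -/
def ProjectivelyEquivalent (nabla nabla' : AffineConnection n M) : Prop :=
  ∃ Υ : (x : M) → TangentSpace (𝓡 n) x →L[ℝ] ℝ,
    ContMDiff (𝓡 n) ((𝓡 n).prod 𝓘(ℝ, EuclideanSpace ℝ (Fin n) →L[ℝ] ℝ)) ∞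
      (fun x => TotalSpace.mk' (EuclideanSpace ℝ (Fin n) →L[ℝ] ℝ)
        (E := fun x : M => TangentSpace (𝓡 n) x →L[ℝ] ℝ) x (Υ x)) ∧
    ∀ (x : M) (Y : (y : M) → TangentSpace (𝓡 n) y),
      MDifferentiableAt (𝓡 n) ((𝓡 n).prod 𝓘(ℝ, EuclideanSpace ℝ (Fin n)))
        (fun y => TotalSpace.mk' (EuclideanSpace ℝ (Fin n))
          (E := fun y : M => TangentSpace (𝓡 n) y) y (Y y)) x →
      ∀ v : TangentSpace (𝓡 n) x,
        nabla' Y x v = nabla Y x v + Υ x v • Y x + Υ x (Y x) • v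

/-- The coordinate basis of the tangent space at `x`, in the preferred chart at `x`. -/
def coordBasis (x : M) : Module.Basis (Fin n) ℝ (TangentSpace (𝓡 n) x) :=
  (EuclideanSpace.basisFun (Fin n) ℝ).toBasis

/-- The vector field near `x` with constant coordinates in the preferred chart at `x` which
extends the tangent vector `v`. -/
def ext {x : M} (v : TangentSpace (𝓡 n) x) (y : M) : TangentSpace (𝓡 n) y :=
  FiberBundle.extend (EuclideanSpace ℝ (Fin n)) v y

/-- `(∇_u θ)(v) = u (θ(V)) - θ(∇_u V)` for a 1-form `θ` and any field `V` extending `v`. -/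
def covDeriv₁ (nabla : AffineConnection n M) (θ : (x : M) → TangentSpace (𝓡 n) x → ℝ)
    (x : M) (u v : TangentSpace (𝓡 n) x) : ℝ :=
  mvfderiv (𝓡 n) (fun y => θ y (ext v y)) x u - θ x (nabla (ext v) x u)

/-- `(∇_u T)(v, w) = u (T(V, W)) - T(∇_u V, w) - T(v, ∇_u W)` for a covariant 2-tensor `T` and any
fields `V`, `W` extending `v`, `w`. -/
def covDeriv₂ (nabla : AffineConnection n M)
    (T : (x : M) → TangentSpace (𝓡 n) x → TangentSpace (𝓡 n) x → ℝ)
    (x : M) (u v w : TangentSpace (𝓡 n) x) : ℝ :=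
  mvfderiv (𝓡 n) (fun y => T y (ext v y) (ext w y)) x u
    - T x (nabla (ext v) x u) w - T x v (nabla (ext w) x u)

/-- The curvature `R(u, v) w = u^a v^b R_{ab}{}^c{}_d w^d = ∇_U ∇_V W - ∇_V ∇_U W - ∇_{[U,V]} W`
at `x`, for any fields `U`, `V`, `W` extending `u`, `v`, `w`. -/
def curvature (nabla : AffineConnection n M) (x : M) (u v w : TangentSpace (𝓡 n) x) :
    TangentSpace (𝓡 n) x :=
  nabla (fun y => nabla (ext w) y (ext v y)) x u
    - nabla (fun y => nabla (ext w) y (ext u y)) x v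
    - nabla (ext w) x (VectorField.mlieBracket (𝓡 n) (ext u) (ext v) x)

/-- The Ricci tensor `Ric_{ab} = R_{ca}{}^c{}_b`. -/
def ricci (nabla : AffineConnection n M) (x : M) (u v : TangentSpace (𝓡 n) x) : ℝ :=
  ∑ c : Fin n, (coordBasis x).repr (curvature nabla x (coordBasis x c) u v) c

/-- The projective Schouten tensor `P_{ab}`: the solution of `(n - 1) P_{ab} = Ric_{ab} + β_{ab}`,
`β_{ab} = P_{ba} - P_{ab}`. -/
def schouten (nabla : AffineConnection n M) (x : M) (u v : TangentSpace (𝓡 n) x) : ℝ :=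
  (n * ricci nabla x u v + ricci nabla x v u) / ((n : ℝ) ^ 2 - 1)

/-- `β_{ab} = -2 P_{[ab]}`. -/
def beta (nabla : AffineConnection n M) (x : M) (u v : TangentSpace (𝓡 n) x) : ℝ :=
  schouten nabla x v u - schouten nabla x u v

theorem schouten_eq (hn : 2 ≤ n) (nabla : AffineConnection n M) (x : M)
    (u v : TangentSpace (𝓡 n) x) :
    ((n : ℝ) - 1) * schouten nabla x u v = ricci nabla x u v + beta nabla x u v := by
  have h : (2 : ℝ) ≤ n := by exact_mod_cast hn
  have h' : (n : ℝ) ^ 2 - 1 ≠ 0 := by nlinarith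
  unfold beta schouten
  field_simp
  ring

/-- The projective Weyl tensor, from
`R_{ab}{}^c{}_d = W_{ab}{}^c{}_d + δ^c_a P_{bd} - δ^c_b P_{ad} + β_{ab} δ^c_d`. -/
def weyl (nabla : AffineConnection n M) (x : M) (u v w : TangentSpace (𝓡 n) x) :
    TangentSpace (𝓡 n) x :=
  curvature nabla x u v w - schouten nabla x v w • u + schouten nabla x u w • v
    - beta nabla x u v • w

/-- The projective Cotton tensor `C_{dab} = ∇_a P_{bd} - ∇_b P_{ad}`, evaluated on `w` (index `d`),
`u` (index `a`) and `v` (index `b`). -/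
def cotton (nabla : AffineConnection n M) (x : M) (w u v : TangentSpace (𝓡 n) x) : ℝ :=
  covDeriv₂ nabla (schouten nabla) x u v w - covDeriv₂ nabla (schouten nabla) x v u w

/-! ### The left inverse and the invariants -/

/-- `‖Q‖` at `x`, in the coordinate frame. -/
def normQ (q : Input n) (nabla : AffineConnection n M) (x : M) : ℝ :=
  detQ q (coordBasis x) (weyl nabla x)

/-- The tensor field `D_{(Q)}^{ab}{}_i{}^c`, as a function of two covectors (`a`, `b`), a vector
(`i`) and a covector (`c`). -/
def DQ (q : Input n) (nabla : AffineConnection n M) (x : M)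
    (α β : Module.Dual ℝ (TangentSpace (𝓡 n) x)) (v : TangentSpace (𝓡 n) x)
    (θ : Module.Dual ℝ (TangentSpace (𝓡 n) x)) : ℝ :=
  Dtensor q (coordBasis x) (weyl nabla x) α β v θ

/-- The 1-form `D^{ab}{}_i{}^c C_{cab}`. -/
def DC (q : Input n) (nabla : AffineConnection n M) (x : M) (v : TangentSpace (𝓡 n) x) : ℝ :=
  ∑ a : Fin n, ∑ b : Fin n, ∑ c : Fin n,
    DQ q nabla x ((coordBasis x).coord a) ((coordBasis x).coord b) v ((coordBasis x).coord c) *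
      cotton nabla x (coordBasis x c) (coordBasis x a) (coordBasis x b)

/-- `G_{ij} = P_{ij} + ∇_i (D^{ab}{}_j{}^c C_{cab}) + D^{ab}{}_i{}^c C_{cab} D^{ef}{}_j{}^g C_{gef}`. -/
def GQ (q : Input n) (nabla : AffineConnection n M) (x : M) (u v : TangentSpace (𝓡 n) x) : ℝ :=
  schouten nabla x u v + covDeriv₁ nabla (DC q nabla) x u v + DC q nabla x u * DC q nabla x v

/-- `E_{ijk} = ∇_i G_{jk}
  + (2 G_{jk} D^{ab}{}_i{}^c + G_{ji} D^{ab}{}_k{}^c + G_{ik} D^{ab}{}_j{}^c) C_{cab}`. -/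
def EQ (q : Input n) (nabla : AffineConnection n M) (x : M) (u v w : TangentSpace (𝓡 n) x) : ℝ :=
  covDeriv₂ nabla (GQ q nabla) x u v w
    + (2 * GQ q nabla x v w * DC q nabla x u + GQ q nabla x v u * DC q nabla x w
      + GQ q nabla x u w * DC q nabla x v)

/-- `γ`, the complete skewing of `G_{a₁b₁} ⋯ G_{aₙbₙ}`, a section of the square of the bundle of
top forms. -/
def gammaQ (q : Input n) (nabla : AffineConnection n M) (x : M)
    (u v : Fin n → TangentSpace (𝓡 n) x) : ℝ :=
  gammaForm (GQ q nabla x) u v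

/-! ### Einstein metrics, Ricci-flat connections, affine maps -/

variable (n M) in
/-- Smooth pseudo-Riemannian metrics (of arbitrary signature). -/
structure PseudoMetric where
  /-- the scalar product on the tangent spaces -/
  inner (x : M) : TangentSpace (𝓡 n) x →L[ℝ] TangentSpace (𝓡 n) x →L[ℝ] ℝ
  symm (x : M) (v w : TangentSpace (𝓡 n) x) : inner x v w = inner x w v
  nondegenerate (x : M) (v : TangentSpace (𝓡 n) x) : (∀ w, inner x v w = 0) → v = 0
  contMDiff : ContMDiff (𝓡 n)
    ((𝓡 n).prod 𝓘(ℝ, EuclideanSpace ℝ (Fin n) →L[ℝ] EuclideanSpace ℝ (Fin n) →L[ℝ] ℝ)) ∞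
    (fun x => TotalSpace.mk' (EuclideanSpace ℝ (Fin n) →L[ℝ] EuclideanSpace ℝ (Fin n) →L[ℝ] ℝ)
      (E := fun x : M => TangentSpace (𝓡 n) x →L[ℝ] TangentSpace (𝓡 n) x →L[ℝ] ℝ) x (inner x))

/-- `∇` is the Levi-Civita connection of `g`: smooth, torsion-free and `∇ g = 0`. -/
def IsLeviCivita (g : PseudoMetric n M) (nabla : AffineConnection n M) : Prop :=
  IsSmoothTorsionFree nabla ∧
    ∀ (x : M) (u v w : TangentSpace (𝓡 n) x),
      covDeriv₂ nabla (fun y a b => g.inner y a b) x u v w = 0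

/-- `∇` is projectively equivalent to the Levi-Civita connection of an Einstein metric with
nonvanishing Einstein constant. -/
def IsEinsteinMetrisable (nabla : AffineConnection n M) : Prop :=
  ∃ (g : PseudoMetric n M) (nabla' : AffineConnection n M) (c : ℝ),
    IsLeviCivita g nabla' ∧ ProjectivelyEquivalent nabla nabla' ∧ c ≠ 0 ∧
      ∀ (x : M) (u v : TangentSpace (𝓡 n) x), ricci nabla' x u v = c * g.inner x u v

/-- `∇` is projectively equivalent to a Ricci-flat torsion-free connection. -/
def IsProjectivelyRicciFlat (nabla : AffineConnection n M) : Prop :=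
  ∃ nabla' : AffineConnection n M,
    IsSmoothTorsionFree nabla' ∧ ProjectivelyEquivalent nabla nabla' ∧
      ∀ (x : M) (u v : TangentSpace (𝓡 n) x), ricci nabla' x u v = 0

/-- `φ` is a local diffeomorphism for which `∇'` on the source is the pullback of `∇`: if `Y'` and
`Y` are `φ`-related near a point, then `dφ (∇'_v Y') = ∇_{dφ v} Y` there. -/
def IsAffineLocalDiffeo {M' : Type*} [TopologicalSpace M']
    [ChartedSpace (EuclideanSpace ℝ (Fin n)) M'] [IsManifold (𝓡 n) ∞ M']
    (nabla' : AffineConnection n M') (nabla : AffineConnection n M) (φ : M' → M) : Prop :=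
  IsLocalDiffeomorph (𝓡 n) (𝓡 n) ∞ φ ∧
    ∀ (x : M') (Y' : (y : M') → TangentSpace (𝓡 n) y) (Y : (y : M) → TangentSpace (𝓡 n) y),
      MDifferentiableAt (𝓡 n) ((𝓡 n).prod 𝓘(ℝ, EuclideanSpace ℝ (Fin n)))
        (fun y => TotalSpace.mk' (EuclideanSpace ℝ (Fin n))
          (E := fun y : M' => TangentSpace (𝓡 n) y) y (Y' y)) x →
      MDifferentiableAt (𝓡 n) ((𝓡 n).prod 𝓘(ℝ, EuclideanSpace ℝ (Fin n)))
        (fun y => TotalSpace.mk' (EuclideanSpace ℝ (Fin n))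
          (E := fun y : M => TangentSpace (𝓡 n) y) y (Y y)) (φ x) →
      (∀ᶠ y in nhds x, mfderiv (𝓡 n) (𝓡 n) φ y (Y' y) = Y (φ y)) →
      ∀ v : TangentSpace (𝓡 n) x,
        mfderiv (𝓡 n) (𝓡 n) φ x (nabla' Y' x v) = nabla Y (φ x) (mfderiv (𝓡 n) (𝓡 n) φ x v)

end Geometry

end

end ProjEinstein

/-!
The whole theorem rests on one transformation law. Let `∇'` arise from `∇` by the projective change
with the 1-form `Υ`, and put `S = ∇Υ - Υ ⊗ Υ`. A computation with vector fields gives the change of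
the curvature, whence `P' = P - S` and `W' = W` for the projective Schouten and Weyl tensors, and
the Ricci identity for `Υ` turns this into `C' = C + Υ ∘ W` for the Cotton tensor
(`IsProjectiveChange.schouten_eq`, `weyl_eq`, `cotton_eq`). The tensor `D` depends on `W` only, and
it is a left inverse of `W` because `adj(Q) Q = ‖Q‖` (`sum_Dtensor_coord_mul_self`). Contracting the
law for `C` with `D` shows that the 1-form `DC = D^{ab}_i^c C_{cab}` satisfies `DC' = DC + Υ`
(`IsProjectiveChange.DC_eq`).

Therefore exactly one projective change leads to `DC' = 0`, namely the one with `Υ = -DC`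
(`exists_isProjectiveChange_DC_eq_zero`). For the resulting connection `∇'` the formulas for `G` and
`E` reduce to `P'` and `∇' P'`, and `G` and `E` are the same for all connections in the class, as the
transformation laws show. A Ricci-flat connection, or the Levi-Civita connection of an Einstein
metric, has vanishing Cotton tensor, and so it must be this `∇'`. For `∇'`, being Ricci-flat amounts
to `G = P' = 0`, and being the Levi-Civita connection of a metric `g` with `Ric = λ g`, `λ ≠ 0`,
amounts to `G = P'` being symmetric, nondegenerate and parallel, with `g` a multiple of `G`. Finally
`γ` is `1 / n!` times the determinant of the values of `G` on `n` vectors, so it detects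
nondegeneracy (`gammaForm_ne_zero_iff`).

Independence of the frame (`Dtensor_basis`) holds because under a change of basis each skewed block
of `n` indices contributes the determinant of the change of basis: `Q` is multiplied by a nonzero
scalar and conjugated, and the same scalar occurs in `Q'`, so that it cancels in `D`. Naturality
follows from this, since a local diffeomorphism pulls smooth vector fields back to smooth vector
fields, covariant derivatives of which are related.

The invariants are defined with the special extensions `ext v` of tangent vectors. To differentiate
them repeatedly it is necessary to know that they are tensors, so that arbitrary smooth extensions
may be used instead (`curvature_field`, `SmoothForm₁.covDeriv_field`, `SmoothForm₂.covDeriv_field`),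
and that they are smooth; this is the content of the sections on tensoriality.
-/

namespace ProjEinstein

noncomputable section

/-! ### Permutation symbols and alternated sums -/

section Symbols

variable {n : ℕ}

/-- The Leibniz formula: the alternated sum of products of entries of a matrix, one from each row,
is the determinant. -/
theorem sum_leviCivita_mul_prod (C : Matrix (Fin n) (Fin n) ℝ) :
    ∑ h : Fin n → Fin n, leviCivita h * ∏ k, C k (h k) = C.det := by
  have hC : C = fun k => ∑ j, C k j • (Pi.single j 1 : Fin n → ℝ) := by
    ext k l
    simp [Finset.sum_apply, Pi.single_apply]
  have h1 : C.det = Matrix.detRowAlternating (R := ℝ) (n := Fin n)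
      (fun k => ∑ j, C k j • (Pi.single j 1 : Fin n → ℝ)) := by
    rw [← hC]; rfl
  rw [h1, ← AlternatingMap.coe_multilinearMap, MultilinearMap.map_sum]
  refine Finset.sum_congr rfl fun h _ => ?_
  rw [MultilinearMap.map_smul_univ, smul_eq_mul, mul_comm]
  congr 1
  change _ = Matrix.det _
  unfold leviCivita
  congr 1
  ext i j
  simp [Pi.single_apply, eq_comm]

theorem leviCivita_eq_det_submatrix (v : Fin n → Fin n) :
    leviCivita v = ((1 : Matrix (Fin n) (Fin n) ℝ).submatrix v id).det := by
  unfold leviCivita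
  congr 1

/-- The permutation symbol is an invariant tensor up to the determinant. -/
theorem sum_leviCivita_change (A : Matrix (Fin n) (Fin n) ℝ) (g : Fin n → Fin n) :
    ∑ h : Fin n → Fin n, leviCivita h * ∏ k, A (g k) (h k) = A.det * leviCivita g := by
  have := sum_leviCivita_mul_prod (A.submatrix g id)
  simp only [Matrix.submatrix_apply, id] at this
  rw [this, leviCivita_eq_det_submatrix, mul_comm, ← Matrix.det_mul]
  congr 1
  ext i j
  simp [Matrix.mul_apply, Matrix.one_apply]

namespace Input

variable (q : Input n)

theorem F_block (i : Fin q.B) (k : Fin n) : q.F (q.block i k) = i := by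
  have := Finset.orderEmbOfFin_mem (Finset.univ.filter fun s => q.F s = i) (q.card_fiber i) k
  exact (Finset.mem_filter.1 this).2

theorem block_bijective :
    Function.Bijective fun p : Fin q.B × Fin n => q.block p.1 p.2 := by
  constructor
  · rintro ⟨i, k⟩ ⟨i', k'⟩ h
    have hi : i = i' := by
      have := congrArg q.F h
      simpa [F_block] using this
    subst hi
    have : k = k' := (Finset.orderEmbOfFin _ (q.card_fiber i)).injective h
    rw [this]
  · intro s
    have hs : s ∈ Set.range (q.block (q.F s)) := by
      unfold block
      rw [Finset.range_orderEmbOfFin]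
      simp
    obtain ⟨k, hk⟩ := hs
    exact ⟨(q.F s, k), hk⟩

/-- The slots, enumerated block by block. -/
def blockEquiv : Fin q.B × Fin n ≃ q.Slot := Equiv.ofBijective _ q.block_bijective

end Input

/-- The product of permutation symbols over the blocks is an invariant tensor up to a power of the
determinant, because the blocks partition the slots. -/
theorem sum_blockSign_change (q : Input n) (A : Matrix (Fin n) (Fin n) ℝ)
    (g : q.Slot → Fin n) :
    ∑ f : q.Slot → Fin n, blockSign q f * ∏ s, A (g s) (f s)
      = A.det ^ q.B * blockSign q g := by
  let e : (q.Slot → Fin n) ≃ (Fin q.B → Fin n → Fin n) :=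
    (Equiv.arrowCongr q.blockEquiv.symm (Equiv.refl _)).trans (Equiv.curry _ _ _)
  have he : ∀ (f : q.Slot → Fin n) i k, e f i k = f (q.block i k) := fun f i k => rfl
  have h1 : ∀ f : q.Slot → Fin n, blockSign q f * ∏ s, A (g s) (f s)
      = ∏ i : Fin q.B, (leviCivita (e f i) * ∏ k, A (g (q.block i k)) (e f i k)) := by
    intro f
    rw [Finset.prod_mul_distrib, ← q.blockEquiv.prod_comp, Fintype.prod_prod_type]
    rfl
  simp only [h1]
  rw [e.sum_comp (fun F => ∏ i : Fin q.B,
    (leviCivita (F i) * ∏ k, A (g (q.block i k)) (F i k)))]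
  have h2 := Finset.prod_univ_sum (fun _ : Fin q.B => (Finset.univ : Finset (Fin n → Fin n)))
    (fun i h => leviCivita h * ∏ k, A (g (q.block i k)) (h k))
  rw [Fintype.piFinset_univ] at h2
  rw [← h2]
  simp only [sum_leviCivita_change A]
  rw [Finset.prod_mul_distrib]
  simp [blockSign]

/-- Alternated sums of the values of a multilinear map of the slots on the vectors of a basis are
multiplied by a power of the determinant of the transition matrix when the basis is changed. -/
theorem sum_blockSign_basis {V X : Type*} [AddCommGroup V] [Module ℝ V] [AddCommGroup X]
    [Module ℝ X] (q : Input n) (T : MultilinearMap ℝ (fun _ : q.Slot => V) X)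
    (b b' : Module.Basis (Fin n) ℝ V) :
    ∑ f : q.Slot → Fin n, blockSign q f • T (fun s => b' (f s))
      = (b.toMatrix b').det ^ q.B • ∑ f : q.Slot → Fin n, blockSign q f • T (fun s => b (f s)) := by
  have h1 : ∀ f : q.Slot → Fin n, T (fun s => b' (f s))
      = ∑ g : q.Slot → Fin n, (∏ s, b.toMatrix b' (g s) (f s)) • T (fun s => b (g s)) := by
    intro f
    have : (fun s => b' (f s)) = fun s => ∑ i, b.toMatrix b' i (f s) • b i := by
      ext s
      rw [b.sum_toMatrix_smul_self]
    rw [this, MultilinearMap.map_sum]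
    refine Finset.sum_congr rfl fun g _ => ?_
    rw [MultilinearMap.map_smul_univ]
  simp only [h1, Finset.smul_sum, smul_smul]
  rw [Finset.sum_comm]
  refine Finset.sum_congr rfl fun g _ => ?_
  rw [← Finset.sum_smul, sum_blockSign_change]

end Symbols

/-! ### Frame independence of the algebraic constructions -/

section Frames

variable {n : ℕ} {V : Type*} [AddCommGroup V] [Module ℝ V]

/-- `f` is linear in each of its three arguments. -/
structure IsTrilinear {X : Type*} [AddCommGroup X] [Module ℝ X] (f : V → V → V → X) : Prop where
  left (v w : V) : IsLinearMap ℝ fun u => f u v w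
  mid (u w : V) : IsLinearMap ℝ fun v => f u v w
  right (u v : V) : IsLinearMap ℝ fun w => f u v w

/-- `f` is linear in each of its two arguments. -/
structure IsBilinear {X : Type*} [AddCommGroup X] [Module ℝ X] (f : V → V → X) : Prop where
  left (v : V) : IsLinearMap ℝ fun u => f u v
  right (u : V) : IsLinearMap ℝ fun v => f u v

variable {W : V → V → V → V}

/-- The endomorphism `w ↦ W(u, v) w`. -/
def IsTrilinear.endo (hW : IsTrilinear W) (u v : V) : V →ₗ[ℝ] V := (hW.right u v).mk'

@[simp]
theorem IsTrilinear.endo_apply (hW : IsTrilinear W) (u v w : V) : hW.endo u v w = W u v w := rfl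

/-- The basis free version of `weylProd`: the composition of the endomorphisms
`W(v_{2k-1}, v_{2k}) ⋯ W(v_1, v_2)`. -/
def IsTrilinear.prodEndo (hW : IsTrilinear W) : (k : ℕ) → (Fin (2 * k) → V) → (V →ₗ[ℝ] V)
  | 0, _ => LinearMap.id
  | k + 1, a => hW.endo (a ⟨2 * k, by omega⟩) (a ⟨2 * k + 1, by omega⟩) ∘ₗ
      hW.prodEndo k (fun i => a ⟨i, by omega⟩)

theorem IsTrilinear.endo_isBilinear (hW : IsTrilinear W) : IsBilinear hW.endo where
  left v :=
    { map_add := fun u u' => LinearMap.ext fun w => (hW.left v w).map_add u u'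
      map_smul := fun c u => LinearMap.ext fun w => (hW.left v w).map_smul c u }
  right u :=
    { map_add := fun v v' => LinearMap.ext fun w => (hW.mid u w).map_add v v'
      map_smul := fun c v => LinearMap.ext fun w => (hW.mid u w).map_smul c v }

theorem toMatrix_prodEndo (hW : IsTrilinear W) (b : Module.Basis (Fin n) ℝ V) (k : ℕ)
    (f : Fin (2 * k) → Fin n) :
    LinearMap.toMatrix b b (hW.prodEndo k fun i => b (f i)) = weylProd (components b W) k f := by
  induction k with
  | zero => simp [IsTrilinear.prodEndo, weylProd]
  | succ k ih =>
    simp only [IsTrilinear.prodEndo, weylProd]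
    rw [LinearMap.toMatrix_comp b b b, ih]
    congr 1
    ext c d
    simp [LinearMap.toMatrix_apply, components]

/-- `T` is linear in each of the arguments indexed by `S`, and does not depend on the others.
In this form, products of functions of disjoint groups of slots can be shown to be multilinear one
factor at a time (`IsMultilinearOn.bilin`). -/
structure IsMultilinearOn {ι X : Type*} [DecidableEq ι] [AddCommGroup X] [Module ℝ X]
    (S : Set ι) (T : (ι → V) → X) : Prop where
  linear : ∀ v, ∀ i ∈ S, IsLinearMap ℝ fun x => T (Function.update v i x)
  const : ∀ v, ∀ i ∉ S, ∀ x, T (Function.update v i x) = T v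

namespace IsMultilinearOn

variable {ι ι' X Y Z : Type*} [DecidableEq ι] [DecidableEq ι'] [AddCommGroup X] [Module ℝ X]
  [AddCommGroup Y] [Module ℝ Y] [AddCommGroup Z] [Module ℝ Z]

theorem eval (i : ι) : IsMultilinearOn {i} fun v : ι → V => v i where
  linear v j hj := by
    obtain rfl : j = i := hj
    simp only [Function.update_self]
    exact LinearMap.isLinear LinearMap.id
  const v j hj x := Function.update_of_ne (fun h => hj h.symm) _ _

theorem comp_linear {S : Set ι} {T : (ι → V) → X} (hT : IsMultilinearOn S T) (f : X →ₗ[ℝ] Y) :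
    IsMultilinearOn S fun v => f (T v) where
  linear v i hi := (f ∘ₗ (hT.linear v i hi).mk').isLinear
  const v i hi x := by rw [hT.const v i hi]

theorem bilin (B : X →ₗ[ℝ] Y →ₗ[ℝ] Z) {S S' : Set ι} (hS : Disjoint S S')
    {T : (ι → V) → X} {T' : (ι → V) → Y} (hT : IsMultilinearOn S T)
    (hT' : IsMultilinearOn S' T') : IsMultilinearOn (S ∪ S') fun v => B (T v) (T' v) where
  linear v i hi := by
    rcases hi with hi | hi
    · simp only [hT'.const v i (Set.disjoint_left.1 hS hi)]
      exact (B.flip (T' v) ∘ₗ (hT.linear v i hi).mk').isLinear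
    · simp only [hT.const v i (Set.disjoint_right.1 hS hi)]
      exact (B (T v) ∘ₗ (hT'.linear v i hi).mk').isLinear
  const v i hi x := by
    rw [hT.const v i fun h => hi (Or.inl h), hT'.const v i fun h => hi (Or.inr h)]

theorem comp_injective {S : Set ι} {T : (ι → V) → X} (hT : IsMultilinearOn S T) (ρ : ι → ι')
    (hρ : Function.Injective ρ) : IsMultilinearOn (ρ '' S) fun v : ι' → V => T fun i => v (ρ i) where
  linear v j hj := by
    obtain ⟨i, hi, rfl⟩ := hj
    have h : ∀ x, (fun k => Function.update v (ρ i) x (ρ k))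
        = Function.update (fun k => v (ρ k)) i x :=
      fun x => Function.update_comp_eq_of_injective v hρ i x
    simp only [h]
    exact hT.linear _ i hi
  const v j hj x := by
    by_cases hj' : j ∈ Set.range ρ
    · obtain ⟨i, rfl⟩ := hj'
      have h : (fun k => Function.update v (ρ i) x (ρ k))
        = Function.update (fun k => v (ρ k)) i x := Function.update_comp_eq_of_injective v hρ i x
      rw [h]
      exact hT.const _ i (fun hi => hj ⟨i, hi, rfl⟩) x
    · congr 1
      ext k
      exact Function.update_of_ne (fun h => hj' ⟨k, h⟩) _ _

theorem prod {J : Type*} (s : Finset J) (S : J → Set ι)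
    (hS : Pairwise fun i j => Disjoint (S i) (S j)) (T : J → (ι → V) → ℝ)
    (hT : ∀ j, IsMultilinearOn (S j) (T j)) :
    IsMultilinearOn (⋃ j ∈ s, S j) fun v => ∏ j ∈ s, T j v := by
  classical
  induction s using Finset.induction_on with
  | empty => simpa using ⟨fun v i hi => absurd hi (by simp), fun v i hi x => rfl⟩
  | insert a s ha ih =>
    simp only [Finset.prod_insert ha, Finset.set_biUnion_insert]
    refine bilin (LinearMap.mul ℝ ℝ) ?_ (hT a) ih
    rw [Set.disjoint_iUnion₂_right]
    intro j hj
    exact hS fun h => ha (h ▸ hj)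

end IsMultilinearOn

/-- A function that is linear in all its arguments, as a multilinear map. -/
def IsMultilinearOn.toMultilinearMap {ι X : Type*} [inst : DecidableEq ι] [AddCommGroup X]
    [Module ℝ X] {S : Set ι} {T : (ι → V) → X}
    (hT : IsMultilinearOn S T) (hS : S = Set.univ) : MultilinearMap ℝ (fun _ : ι => V) X where
  toFun := T
  map_update_add' := by
    intro inst' v i x y
    obtain rfl : inst' = inst := Subsingleton.elim _ _
    exact (hT.linear v i (hS ▸ trivial)).map_add x y
  map_update_smul' := by
    intro inst' v i c x
    obtain rfl : inst' = inst := Subsingleton.elim _ _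
    exact (hT.linear v i (hS ▸ trivial)).map_smul c x

theorem IsBilinear.isMultilinearOn {ι X : Type*} [DecidableEq ι] [AddCommGroup X] [Module ℝ X]
    {B : V → V → X} (hB : IsBilinear B) {i j : ι} (hij : i ≠ j) :
    IsMultilinearOn ({i} ∪ {j}) fun v : ι → V => B (v i) (v j) :=
  IsMultilinearOn.bilin
    (LinearMap.mk₂ ℝ B (fun u u' v => (hB.left v).map_add u u')
      (fun c u v => (hB.left v).map_smul c u) (fun u v v' => (hB.right u).map_add v v')
      (fun c u v => (hB.right u).map_smul c v))
    (Set.disjoint_singleton.2 hij) (IsMultilinearOn.eval i) (IsMultilinearOn.eval j)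

theorem IsTrilinear.prodEndo_isMultilinearOn (hW : IsTrilinear W) (k : ℕ) :
    IsMultilinearOn Set.univ (hW.prodEndo k) := by
  induction k with
  | zero => exact ⟨fun v i => absurd i.2 (by simp), fun v i hi => absurd trivial hi⟩
  | succ k ih =>
    have hρ : Function.Injective fun i : Fin (2 * k) => (⟨i, by omega⟩ : Fin (2 * (k + 1))) :=
      fun i j h => Fin.ext (by simpa using h)
    have h1 := ih.comp_injective _ hρ
    have h2 := hW.endo_isBilinear.isMultilinearOn (ι := Fin (2 * (k + 1)))
      (i := ⟨2 * k, by omega⟩) (j := ⟨2 * k + 1, by omega⟩) (by simp)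
    have h3 := IsMultilinearOn.bilin (LinearMap.mul ℝ (Module.End ℝ V)) (by
      rw [Set.disjoint_left]
      rintro a ha ⟨i, -, rfl⟩
      have := i.2
      rcases ha with ha | ha <;>
      · have := Fin.ext_iff.1 (Set.mem_singleton_iff.1 ha)
        simp at this
        omega) h2 h1
    refine (congrArg (IsMultilinearOn · (hW.prodEndo (k + 1))) ?_).mp h3
    rw [Set.eq_univ_iff_forall]
    intro i
    by_cases hi : (i : ℕ) < 2 * k
    · exact Or.inr ⟨⟨i, hi⟩, trivial, rfl⟩
    · left
      have := i.2
      by_cases hi' : (i : ℕ) = 2 * k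
      · exact Or.inl (Fin.ext hi')
      · exact Or.inr (Fin.ext (show (i : ℕ) = 2 * k + 1 by omega))

/-- The basis free version of `traceProd`. -/
def IsTrilinear.traceEndo (hW : IsTrilinear W) (q : Input n) (v : q.Slot → V) : ℝ :=
  ∏ j : Fin q.r, LinearMap.trace ℝ V (hW.prodEndo (q.N j.succ) fun α => v (q.slot j.succ α))

theorem traceEndo_basis (hW : IsTrilinear W) (q : Input n) (b : Module.Basis (Fin n) ℝ V)
    (f : q.Slot → Fin n) :
    hW.traceEndo q (fun s => b (f s)) = traceProd q (components b W) f := by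
  unfold IsTrilinear.traceEndo traceProd
  refine Finset.prod_congr rfl fun j _ => ?_
  rw [LinearMap.trace_eq_matrix_trace ℝ b, toMatrix_prodEndo]

theorem Input.slot_injective (q : Input n) (j : Fin (q.r + 1)) :
    Function.Injective (q.slot j) := by
  intro α β h
  have h' := toLex.injective h
  exact eq_of_heq (Sigma.mk.inj h').2

theorem IsTrilinear.traceEndo_isMultilinearOn (hW : IsTrilinear W) (q : Input n) :
    IsMultilinearOn {s : q.Slot | (ofLex s).1 ≠ 0} (hW.traceEndo q) := by
  have h := IsMultilinearOn.prod (V := V) Finset.univ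
    (fun j : Fin q.r => Set.range (q.slot j.succ)) (by
      intro i j hij
      rw [Set.disjoint_left]
      rintro _ ⟨α, rfl⟩ ⟨β, hβ⟩
      have := congrArg (fun s : q.Slot => (ofLex s).1) hβ
      exact hij (Fin.succ_injective _ this).symm)
    (fun j v => LinearMap.trace ℝ V (hW.prodEndo (q.N j.succ) fun α => v (q.slot j.succ α)))
    (fun j => by
      have := ((hW.prodEndo_isMultilinearOn (q.N j.succ)).comp_injective _
        (q.slot_injective j.succ)).comp_linear (LinearMap.trace ℝ V)
      rwa [Set.image_univ] at this)
  refine (congrArg (IsMultilinearOn · (hW.traceEndo q)) ?_).mp h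
  ext s
  simp only [Finset.mem_univ, Set.iUnion_true, Set.mem_iUnion, Set.mem_ofPred_eq, Set.mem_range]
  symm
  constructor
  · intro hs
    obtain ⟨j, hj⟩ := Fin.exists_succ_eq.2 hs
    refine ⟨j, ?_⟩
    obtain ⟨j', α⟩ := s
    simp only [ofLex] at hj
    subst hj
    exact ⟨α, rfl⟩
  · rintro ⟨j, α, rfl⟩
    exact Fin.succ_ne_zero j

/-- The basis free form of the summands of `Qmat`. -/
def IsTrilinear.summandQ (hW : IsTrilinear W) (q : Input n) :
    MultilinearMap ℝ (fun _ : q.Slot => V) (Module.End ℝ V) :=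
  IsMultilinearOn.toMultilinearMap
    (IsMultilinearOn.bilin (LinearMap.lsmul ℝ (Module.End ℝ V)) (by
      rw [Set.disjoint_left]
      rintro _ ha ⟨i, -, rfl⟩
      exact ha rfl) (hW.traceEndo_isMultilinearOn q)
      ((hW.prodEndo_isMultilinearOn (q.N 0)).comp_injective _ (q.slot_injective 0)))
    (by
      rw [Set.eq_univ_iff_forall]
      intro s
      by_cases hs : (ofLex s).1 = 0
      · right
        obtain ⟨j', α⟩ := s
        simp only [ofLex] at hs
        subst hs
        exact ⟨α, trivial, rfl⟩
      · exact Or.inl hs)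

theorem IsTrilinear.summandQ_apply (hW : IsTrilinear W) (q : Input n) (v : q.Slot → V) :
    hW.summandQ q v = hW.traceEndo q v • hW.prodEndo (q.N 0) fun α => v (q.slot 0 α) := rfl

/-- The basis free form of the summands of `Qmat'`, contracted with a bilinear form `X` in the two
free indices. -/
def IsTrilinear.summandQ' (hW : IsTrilinear W) (q : Input n) {X : V → V → ℝ} (hX : IsBilinear X) :
    MultilinearMap ℝ (fun _ : q.Slot => V) (Module.End ℝ V) :=
  have h0 := q.N_zero_pos
  have hρ : Function.Injective fun α : Fin (2 * (q.N 0 - 1)) => q.slot 0 ⟨α, by omega⟩ :=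
    fun i j h => Fin.ext (by simpa using q.slot_injective 0 h)
  IsMultilinearOn.toMultilinearMap
    (IsMultilinearOn.bilin (LinearMap.lsmul ℝ (Module.End ℝ V)) (by
      rw [Set.disjoint_left]
      rintro _ ha ⟨i, -, rfl⟩
      have := i.2
      rcases ha with (ha | ha) | ha
      · have := Fin.ext_iff.1 (q.slot_injective 0 ha)
        simp at this
        omega
      · have := Fin.ext_iff.1 (q.slot_injective 0 ha)
        simp at this
        omega
      · exact ha rfl)
      (IsMultilinearOn.bilin (LinearMap.mul ℝ ℝ) (by
        rw [Set.disjoint_left]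
        rintro _ (rfl | rfl) h
        · exact h rfl
        · exact h rfl)
        (hX.isMultilinearOn (i := q.lastSlot₁) (j := q.lastSlot₂) (by
          intro h
          have := Fin.ext_iff.1 (q.slot_injective 0 h)
          simp at this
          omega))
        (hW.traceEndo_isMultilinearOn q))
      ((hW.prodEndo_isMultilinearOn (q.N 0 - 1)).comp_injective _ hρ))
    (by
      rw [Set.eq_univ_iff_forall]
      intro s
      by_cases hs : (ofLex s).1 = 0
      · obtain ⟨j', α⟩ := s
        simp only [ofLex] at hs
        subst hs
        by_cases h1 : (α : ℕ) < 2 * (q.N 0 - 1)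
        · exact Or.inr ⟨⟨α, h1⟩, trivial, rfl⟩
        · refine Or.inl (Or.inl ?_)
          have := α.2
          by_cases h2 : (α : ℕ) = 2 * q.N 0 - 2
          · exact Or.inl (congrArg (q.slot 0) (Fin.ext h2))
          · exact Or.inr (congrArg (q.slot 0)
              (Fin.ext (show (α : ℕ) = 2 * q.N 0 - 1 by omega)))
      · exact Or.inl (Or.inr hs))

theorem IsTrilinear.summandQ'_apply (hW : IsTrilinear W) (q : Input n) {X : V → V → ℝ}
    (hX : IsBilinear X) (v : q.Slot → V) :
    hW.summandQ' q hX v = (X (v q.lastSlot₁) (v q.lastSlot₂) * hW.traceEndo q v) •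
      hW.prodEndo (q.N 0 - 1) fun α => v (q.slot 0 ⟨α, by omega⟩) := rfl

/-- The basis free form of `Qmat`, up to the power of `n!` and the choice of a volume form. -/
def IsTrilinear.endQ (hW : IsTrilinear W) (q : Input n) (b : Module.Basis (Fin n) ℝ V) :
    Module.End ℝ V :=
  ∑ f : q.Slot → Fin n, blockSign q f • hW.summandQ q fun s => b (f s)

/-- The basis free form of `Qmat'` contracted with a bilinear form in the two free indices. -/
def IsTrilinear.endQ' (hW : IsTrilinear W) (q : Input n) {X : V → V → ℝ} (hX : IsBilinear X)
    (b : Module.Basis (Fin n) ℝ V) : Module.End ℝ V :=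
  ∑ f : q.Slot → Fin n, blockSign q f • hW.summandQ' q hX fun s => b (f s)

theorem Qmat_components (hW : IsTrilinear W) (q : Input n) (b : Module.Basis (Fin n) ℝ V) :
    Qmat q (components b W)
      = ((n.factorial : ℝ)⁻¹ ^ q.B) • LinearMap.toMatrix b b (hW.endQ q b) := by
  unfold Qmat IsTrilinear.endQ
  rw [map_sum]
  congr 1
  refine Finset.sum_congr rfl fun f _ => ?_
  rw [map_smul, hW.summandQ_apply, map_smul, smul_smul, traceEndo_basis, toMatrix_prodEndo]

theorem sum_smul_Qmat' (hW : IsTrilinear W) (q : Input n) {X : V → V → ℝ} (hX : IsBilinear X)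
    (b : Module.Basis (Fin n) ℝ V) :
    ∑ b₁, ∑ b₂, X (b b₁) (b b₂) • Qmat' q (components b W) b₁ b₂
      = ((n.factorial : ℝ)⁻¹ ^ q.B) • LinearMap.toMatrix b b (hW.endQ' q hX b) := by
  unfold Qmat' IsTrilinear.endQ'
  simp only [smul_comm (X _ _), Finset.smul_sum]
  rw [← Fintype.sum_prod_type' (f := fun b₁ b₂ => ∑ f : q.Slot → Fin n, _), Finset.sum_comm,
    map_sum, Finset.smul_sum]
  refine Finset.sum_congr rfl fun f _ => ?_
  rw [Finset.sum_eq_single (f q.lastSlot₁, f q.lastSlot₂)]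
  · rw [if_pos ⟨rfl, rfl⟩, map_smul, hW.summandQ'_apply, map_smul, traceEndo_basis,
      toMatrix_prodEndo]
    simp only [smul_smul]
    congr 1
    ring
  · rintro ⟨b₁, b₂⟩ - h
    rw [if_neg, smul_zero, smul_zero]
    rintro ⟨rfl, rfl⟩
    exact h rfl
  · exact fun h => absurd (Finset.mem_univ _) h

theorem endQ_basis (hW : IsTrilinear W) (q : Input n) (b b' : Module.Basis (Fin n) ℝ V) :
    hW.endQ q b' = (b.toMatrix b').det ^ q.B • hW.endQ q b :=
  sum_blockSign_basis q _ b b'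

theorem endQ'_basis (hW : IsTrilinear W) (q : Input n) {X : V → V → ℝ} (hX : IsBilinear X)
    (b b' : Module.Basis (Fin n) ℝ V) :
    hW.endQ' q hX b' = (b.toMatrix b').det ^ q.B • hW.endQ' q hX b :=
  sum_blockSign_basis q _ b b'

theorem det_toMatrix_ne_zero (b b' : Module.Basis (Fin n) ℝ V) : (b.toMatrix b').det ≠ 0 := by
  have h := b.toMatrix_mul_toMatrix_flip b'
  intro h0
  have := congrArg Matrix.det h
  rw [Matrix.det_mul, h0, zero_mul, Matrix.det_one] at this
  exact zero_ne_one this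

theorem detQ_ne_zero_of_basis (hW : IsTrilinear W) (q : Input n) (b b' : Module.Basis (Fin n) ℝ V)
    (h : detQ q b W ≠ 0) : detQ q b' W ≠ 0 := by
  unfold detQ at h ⊢
  rw [Qmat_components hW, Matrix.det_smul, LinearMap.det_toMatrix] at h ⊢
  rw [endQ_basis hW q b b', LinearMap.det_smul]
  have := det_toMatrix_ne_zero b b'
  exact mul_ne_zero (left_ne_zero_of_mul h)
    (mul_ne_zero (pow_ne_zero _ (pow_ne_zero _ this)) (right_ne_zero_of_mul h))

theorem ringInverse_eq_of_mul {A : Type*} [Ring A] {a b : A} (h : a * b = 1) (h' : b * a = 1) :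
    Ring.inverse a = b :=
  Ring.inverse_unit ⟨a, b, h, h'⟩

theorem ringInverse_smul {A : Type*} [Ring A] [Algebra ℝ A] {c : ℝ} (hc : c ≠ 0) (a : A) :
    Ring.inverse (c • a) = c⁻¹ • Ring.inverse a := by
  by_cases ha : IsUnit a
  · apply ringInverse_eq_of_mul
    · rw [smul_mul_smul_comm, mul_inv_cancel₀ hc, one_smul, Ring.mul_inverse_cancel _ ha]
    · rw [smul_mul_smul_comm, inv_mul_cancel₀ hc, one_smul, Ring.inverse_mul_cancel _ ha]
  · rw [Ring.inverse_non_unit _ ha, smul_zero, Ring.inverse_non_unit]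
    intro h
    apply ha
    have := h.smul (Units.mk0 c hc)⁻¹
    simpa [Units.smul_def, smul_smul, inv_mul_cancel₀ hc] using this

/-- Both sides vanish when `f` is not invertible, so no hypothesis is needed. -/
theorem toMatrix_ringInverse (b : Module.Basis (Fin n) ℝ V) (f : Module.End ℝ V) :
    (LinearMap.toMatrix b b f)⁻¹ = LinearMap.toMatrix b b (Ring.inverse f) := by
  rw [Matrix.nonsing_inv_eq_ringInverse]
  by_cases hf : IsUnit f
  · apply ringInverse_eq_of_mul
    · rw [← LinearMap.toMatrix_mul, Ring.mul_inverse_cancel _ hf, LinearMap.toMatrix_one]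
    · rw [← LinearMap.toMatrix_mul, Ring.inverse_mul_cancel _ hf, LinearMap.toMatrix_one]
  · rw [Ring.inverse_non_unit _ hf, map_zero, Ring.inverse_non_unit]
    intro h
    apply hf
    have := h.map (LinearMap.toMatrixAlgEquiv b).symm
    have h2 : (LinearMap.toMatrixAlgEquiv b).symm (LinearMap.toMatrix b b f) = f :=
      (LinearMap.toMatrixAlgEquiv b).symm_apply_apply f
    rwa [h2] at this

theorem Dcomp_eq (q : Input n) (Wc : Fin n → Fin n → Matrix (Fin n) (Fin n) ℝ)
    (b₁ b₂ i k : Fin n) :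
    Dcomp q Wc b₁ b₂ i k = (Qmat' q Wc b₁ b₂ * (Qmat q Wc)⁻¹) k i := by
  rw [Matrix.inv_def, Ring.inverse_eq_inv', Matrix.mul_smul, Matrix.smul_apply, Matrix.mul_apply,
    Dcomp, smul_eq_mul]
  simp only [mul_comm (Qmat' q Wc b₁ b₂ k _)]

theorem sum_mul_Dcomp (q : Input n) (Wc : Fin n → Fin n → Matrix (Fin n) (Fin n) ℝ)
    (X : Fin n → Fin n → ℝ) (i k : Fin n) :
    ∑ b₁, ∑ b₂, X b₁ b₂ * Dcomp q Wc b₁ b₂ i k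
      = ((∑ b₁, ∑ b₂, X b₁ b₂ • Qmat' q Wc b₁ b₂) * (Qmat q Wc)⁻¹) k i := by
  simp only [Dcomp_eq, Matrix.sum_mul, Matrix.sum_apply, Matrix.smul_mul, Matrix.smul_apply,
    smul_eq_mul]

theorem isBilinear_dual (α β : Module.Dual ℝ V) : IsBilinear fun u v => α u * β v where
  left v := ⟨fun u u' => by simp [add_mul], fun c u => by simp [mul_assoc]⟩
  right u := ⟨fun v v' => by simp [mul_add], fun c v => by simp; ring⟩

/-- The basis free form of `Dtensor`: the power of `n!` in the definition of `Qmat` and `Qmat'`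
cancels, and so does the choice of a volume form implicit in `endQ` and `endQ'`
(`Dtensor_basis`). -/
theorem Dtensor_eq (hW : IsTrilinear W) (q : Input n) (b : Module.Basis (Fin n) ℝ V)
    (α β : Module.Dual ℝ V) (v : V) (θ : Module.Dual ℝ V) :
    Dtensor q b W α β v θ
      = θ ((hW.endQ' q (isBilinear_dual α β) b * Ring.inverse (hW.endQ q b)) v) := by
  set c : ℝ := (n.factorial : ℝ)⁻¹ ^ q.B with hc
  have hc0 : c ≠ 0 := pow_ne_zero _ (inv_ne_zero (by exact_mod_cast n.factorial_ne_zero))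
  have h1 : Dtensor q b W α β v θ = ∑ i, ∑ k, ((∑ b₁, ∑ b₂, (α (b b₁) * β (b b₂)) •
      Qmat' q (components b W) b₁ b₂) * (Qmat q (components b W))⁻¹) k i
        * b.repr v i * θ (b k) := by
    simp only [← sum_mul_Dcomp q (components b W) (fun b₁ b₂ => α (b b₁) * β (b b₂)),
      Finset.sum_mul]
    unfold Dtensor
    rw [← Fintype.sum_prod_type' (f := fun b₁ b₂ => ∑ i, ∑ k, Dcomp q (components b W) b₁ b₂ i k *
      α (b b₁) * β (b b₂) * b.repr v i * θ (b k)), Finset.sum_comm]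
    refine Finset.sum_congr rfl fun i _ => ?_
    rw [Finset.sum_comm]
    refine Finset.sum_congr rfl fun k _ => ?_
    rw [Fintype.sum_prod_type]
    refine Finset.sum_congr rfl fun b₁ _ => Finset.sum_congr rfl fun b₂ _ => ?_
    ring
  rw [h1, sum_smul_Qmat' hW q (isBilinear_dual α β), Qmat_components hW, ← map_smul, ← map_smul,
    toMatrix_ringInverse, ← LinearMap.toMatrix_mul, ringInverse_smul hc0, smul_mul_smul_comm,
    mul_inv_cancel₀ hc0, one_smul]
  set g := hW.endQ' q (isBilinear_dual α β) b * Ring.inverse (hW.endQ q b)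
  conv_rhs => rw [← b.sum_repr v]
  simp only [map_sum, map_smul, smul_eq_mul]
  refine Finset.sum_congr rfl fun i _ => ?_
  conv_rhs => rw [← b.sum_repr (g (b i))]
  simp only [map_sum, map_smul, smul_eq_mul, LinearMap.toMatrix_apply, Finset.mul_sum]
  refine Finset.sum_congr rfl fun k _ => ?_
  ring

/-- The recipe for `D` yields the same tensor in all bases. -/
theorem Dtensor_basis (hW : IsTrilinear W) (q : Input n) (b b' : Module.Basis (Fin n) ℝ V) :
    Dtensor q b' W = Dtensor q b W := by
  ext α β v θ
  have := pow_ne_zero q.B (det_toMatrix_ne_zero b b')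
  rw [Dtensor_eq hW, Dtensor_eq hW, endQ_basis hW q b b', endQ'_basis hW q _ b b',
    ringInverse_smul this, smul_mul_smul_comm, mul_inv_cancel₀ this, one_smul]

/-- Contraction of `Qmat'` with the omitted factor gives `Qmat`. -/
theorem sum_mul_Qmat' (q : Input n) (Wc : Fin n → Fin n → Matrix (Fin n) (Fin n) ℝ) :
    ∑ b₁, ∑ b₂, Wc b₁ b₂ * Qmat' q Wc b₁ b₂ = Qmat q Wc := by
  unfold Qmat' Qmat
  simp only [Matrix.mul_smul, Finset.mul_sum, ← Finset.smul_sum]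
  congr 1
  rw [← Fintype.sum_prod_type' (f := fun b₁ b₂ => ∑ f : q.Slot → Fin n, _), Finset.sum_comm]
  refine Finset.sum_congr rfl fun f _ => ?_
  rw [Finset.sum_eq_single (f q.lastSlot₁, f q.lastSlot₂)]
  · rw [if_pos ⟨rfl, rfl⟩, Matrix.mul_smul]
    congr 1
    have key : ∀ (k : ℕ) (hk : 0 < k) (a : Fin (2 * k) → Fin n),
        Wc (a ⟨2 * k - 2, by omega⟩) (a ⟨2 * k - 1, by omega⟩) *
          weylProd Wc (k - 1) (fun α => a ⟨α, by omega⟩) = weylProd Wc k a := by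
      intro k hk a
      obtain _ | k := k
      · exact absurd hk (lt_irrefl 0)
      · rfl
    exact key _ q.N_zero_pos fun α => f (q.slot 0 α)
  · rintro ⟨b₁, b₂⟩ - h
    rw [if_neg, mul_zero]
    rintro ⟨rfl, rfl⟩
    exact h rfl
  · exact fun h => absurd (Finset.mem_univ _) h

/-- `D^{ab}_i^k W_{ab}^j_k = δ_i^j` in components. -/
theorem sum_Dcomp_mul (q : Input n) (Wc : Fin n → Fin n → Matrix (Fin n) (Fin n) ℝ)
    (h : (Qmat q Wc).det ≠ 0) (i j : Fin n) :
    ∑ a, ∑ b, ∑ k, Dcomp q Wc a b i k * Wc a b j k = if i = j then 1 else 0 := by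
  have h1 : Qmat q Wc * (Qmat q Wc)⁻¹ = 1 := Matrix.mul_nonsing_inv _ (isUnit_iff_ne_zero.2 h)
  have h2 : ∑ a, ∑ b, Wc a b * (Qmat' q Wc a b * (Qmat q Wc)⁻¹) = 1 := by
    have h2 := congrArg (· * (Qmat q Wc)⁻¹) (sum_mul_Qmat' q Wc)
    simp only [Matrix.sum_mul, Matrix.mul_assoc, h1] at h2
    exact h2
  have h3 := congrFun (congrFun h2 j) i
  simp only [Matrix.sum_apply, Matrix.one_apply, eq_comm (a := j)] at h3
  rw [← h3]
  refine Finset.sum_congr rfl fun a _ => Finset.sum_congr rfl fun b _ => ?_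
  rw [Matrix.mul_apply]
  refine Finset.sum_congr rfl fun k _ => ?_
  rw [Dcomp_eq, mul_comm]

theorem dual_eq_sum (b : Module.Basis (Fin n) ℝ V) (θ : Module.Dual ℝ V) (v : V) :
    θ v = ∑ i, b.repr v i * θ (b i) := by
  conv_lhs => rw [← b.sum_repr v]
  simp only [map_sum, map_smul, smul_eq_mul]

theorem IsTrilinear.sum_basis {X : Type*} [AddCommGroup X] [Module ℝ X] {Y : V → V → V → X}
    (hY : IsTrilinear Y) (e : Module.Basis (Fin n) ℝ V) (u v w : V) :
    Y u v w = ∑ c, ∑ a, ∑ b, (e.coord c u * e.coord a v * e.coord b w) • Y (e c) (e a) (e b) := by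
  have h1 : Y u v w = ∑ c, e.coord c u • Y (e c) v w := by
    conv_lhs => rw [← e.sum_repr u]
    exact map_sum (hY.left v w).mk' _ _ |>.trans (Finset.sum_congr rfl fun c _ =>
      (hY.left v w).map_smul _ _)
  have h2 : ∀ c, Y (e c) v w = ∑ a, e.coord a v • Y (e c) (e a) w := fun c => by
    conv_lhs => rw [← e.sum_repr v]
    exact map_sum (hY.mid (e c) w).mk' _ _ |>.trans (Finset.sum_congr rfl fun a _ =>
      (hY.mid (e c) w).map_smul _ _)
  have h3 : ∀ c a, Y (e c) (e a) w = ∑ b, e.coord b w • Y (e c) (e a) (e b) := fun c a => by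
    conv_lhs => rw [← e.sum_repr w]
    exact map_sum (hY.right (e c) (e a)).mk' _ _ |>.trans (Finset.sum_congr rfl fun b _ =>
      (hY.right (e c) (e a)).map_smul _ _)
  rw [h1]
  simp only [h2, h3, Finset.smul_sum, smul_smul]
  refine Finset.sum_congr rfl fun c _ => Finset.sum_congr rfl fun a _ =>
    Finset.sum_congr rfl fun b _ => ?_
  congr 1
  ring

/-- The full contraction of `Dtensor` with a covariant 3-tensor, computed in a basis `e`, in terms
of the components in another basis `b`. -/
theorem sum_Dtensor_coord_mul (q : Input n) (b e : Module.Basis (Fin n) ℝ V) (W : V → V → V → V)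
    {Y : V → V → V → ℝ} (hY : IsTrilinear Y) (v : V) :
    ∑ a, ∑ a', ∑ c, Dtensor q b W (e.coord a) (e.coord a') v (e.coord c) * Y (e c) (e a) (e a')
      = ∑ b₁, ∑ b₂, ∑ i, ∑ k, Dcomp q (components b W) b₁ b₂ i k * b.repr v i *
          Y (b k) (b b₁) (b b₂) := by
  simp only [hY.sum_basis e (b _), Finset.mul_sum, Dtensor, Finset.sum_mul]
  -- both sides are sums over seven indices of the same summand
  have comm3 : ∀ g : Fin n → Fin n → Fin n → (Fin n → Fin n → Fin n → Fin n → ℝ),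
      ∑ a, ∑ a', ∑ c, ∑ b₁, ∑ b₂, ∑ i, ∑ k, g a a' c b₁ b₂ i k
        = ∑ b₁, ∑ b₂, ∑ i, ∑ k, ∑ c, ∑ a, ∑ a', g a a' c b₁ b₂ i k := by
    intro g
    have h1 : ∀ F : Fin n → Fin n → Fin n → Fin n → ℝ, ∑ b₁, ∑ b₂, ∑ i, ∑ k, F b₁ b₂ i k
        = ∑ p : Fin n × Fin n × Fin n × Fin n, F p.1 p.2.1 p.2.2.1 p.2.2.2 := by
      intro F; simp only [Fintype.sum_prod_type]
    have h2 : ∀ F : Fin n → Fin n → Fin n → ℝ, ∑ a, ∑ a', ∑ c, F a a' c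
        = ∑ p : Fin n × Fin n × Fin n, F p.1 p.2.1 p.2.2 := by
      intro F; simp only [Fintype.sum_prod_type]
    have h3 : ∀ F : Fin n → Fin n → Fin n → ℝ, ∑ c, ∑ a, ∑ a', F a a' c
        = ∑ a, ∑ a', ∑ c, F a a' c := by
      intro F
      rw [Finset.sum_comm]
      exact Finset.sum_congr rfl fun a _ => Finset.sum_comm
    have h4 : ∀ p : Fin n × Fin n × Fin n, ∑ b₁, ∑ b₂, ∑ i, ∑ k, g p.1 p.2.1 p.2.2 b₁ b₂ i k
        = ∑ r : Fin n × Fin n × Fin n × Fin n, g p.1 p.2.1 p.2.2 r.1 r.2.1 r.2.2.1 r.2.2.2 :=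
      fun p => h1 _
    have h5 : ∀ b₁ b₂ i k, ∑ c, ∑ a, ∑ a', g a a' c b₁ b₂ i k
        = ∑ p : Fin n × Fin n × Fin n, g p.1 p.2.1 p.2.2 b₁ b₂ i k :=
      fun b₁ b₂ i k => (h3 _).trans (h2 _)
    rw [h2 fun a a' c => ∑ b₁, ∑ b₂, ∑ i, ∑ k, g a a' c b₁ b₂ i k]
    rw [Finset.sum_congr rfl fun p _ => h4 p, Finset.sum_comm]
    rw [h1 fun b₁ b₂ i k => ∑ c, ∑ a, ∑ a', g a a' c b₁ b₂ i k]
    exact Finset.sum_congr rfl fun r _ => (h5 _ _ _ _).symm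
  rw [comm3]
  refine Finset.sum_congr rfl fun b₁ _ => Finset.sum_congr rfl fun b₂ _ =>
    Finset.sum_congr rfl fun i _ => Finset.sum_congr rfl fun k _ => Finset.sum_congr rfl fun c _ =>
    Finset.sum_congr rfl fun a _ => Finset.sum_congr rfl fun a' _ => ?_
  rw [smul_eq_mul]
  ring

/-- `D` is a left inverse of `W`. -/
theorem sum_Dtensor_coord_mul_self (hW : IsTrilinear W) (q : Input n)
    (b e : Module.Basis (Fin n) ℝ V) (h : detQ q b W ≠ 0) (v : V) (θ : Module.Dual ℝ V) :
    ∑ i, ∑ j, ∑ k, Dtensor q b W (e.coord i) (e.coord j) v (e.coord k) * θ (W (e i) (e j) (e k))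
      = θ v := by
  have hY : IsTrilinear fun w u v => θ (W u v w) :=
    ⟨fun u v => (θ ∘ₗ (hW.right u v).mk').isLinear, fun w v => (θ ∘ₗ (hW.left v w).mk').isLinear,
      fun w u => (θ ∘ₗ (hW.mid u w).mk').isLinear⟩
  rw [sum_Dtensor_coord_mul q b e W hY v]
  have h1 : ∀ b₁ b₂ k, θ (W (b b₁) (b b₂) (b k))
      = ∑ j, components b W b₁ b₂ j k * θ (b j) := by
    intro b₁ b₂ k
    exact dual_eq_sum b θ _
  have h2 := sum_Dcomp_mul q (components b W) h
  calc _ = ∑ i, ∑ j, b.repr v i * θ (b j) * ∑ b₁, ∑ b₂, ∑ k,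
        Dcomp q (components b W) b₁ b₂ i k * components b W b₁ b₂ j k := by
        simp only [h1, Finset.mul_sum]
        have h3 : ∀ F : Fin n → Fin n → Fin n → Fin n → Fin n → ℝ,
            ∑ b₁, ∑ b₂, ∑ i, ∑ k, ∑ j, F b₁ b₂ i k j = ∑ i, ∑ j, ∑ b₁, ∑ b₂, ∑ k, F b₁ b₂ i k j := by
          intro F
          have e1 : ∀ G : Fin n → Fin n → Fin n → ℝ, ∑ b₁, ∑ b₂, ∑ i, G b₁ b₂ i
              = ∑ i, ∑ b₁, ∑ b₂, G b₁ b₂ i := fun G => by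
            rw [Finset.sum_comm]
            simp only [Finset.sum_comm (s := Finset.univ) (f := fun b₁ i => G b₁ _ i)]
            rw [Finset.sum_comm]
            refine Finset.sum_congr rfl fun i _ => Finset.sum_comm
          rw [e1]
          refine Finset.sum_congr rfl fun i _ => ?_
          rw [← e1 fun b₁ b₂ j => ∑ k, F b₁ b₂ i k j]
          exact Finset.sum_congr rfl fun b₁ _ => Finset.sum_congr rfl fun b₂ _ => Finset.sum_comm
        rw [h3]
        refine Finset.sum_congr rfl fun i _ => Finset.sum_congr rfl fun j _ =>
          Finset.sum_congr rfl fun b₁ _ => Finset.sum_congr rfl fun b₂ _ =>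
          Finset.sum_congr rfl fun k _ => ?_
        ring
    _ = ∑ i, b.repr v i * θ (b i) := by
        simp [h2]
    _ = θ v := by
        exact (dual_eq_sum b θ v).symm

theorem components_map {V' : Type*} [AddCommGroup V'] [Module ℝ V'] (L : V' ≃ₗ[ℝ] V)
    (b : Module.Basis (Fin n) ℝ V) {W : V → V → V → V} {W' : V' → V' → V' → V'}
    (h : ∀ u v w, L (W' u v w) = W (L u) (L v) (L w)) :
    components (b.map L.symm) W' = components b W := by
  ext i j c d
  have := h ((b.map L.symm) i) ((b.map L.symm) j) ((b.map L.symm) d)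
  simp [components, Module.Basis.map_apply] at this ⊢
  rw [this]

/-- Naturality of `Dtensor` under linear isomorphisms. -/
theorem Dtensor_map {V' : Type*} [AddCommGroup V'] [Module ℝ V'] (L : V' ≃ₗ[ℝ] V) (q : Input n)
    (b : Module.Basis (Fin n) ℝ V) {W : V → V → V → V} {W' : V' → V' → V' → V'}
    (h : ∀ u v w, L (W' u v w) = W (L u) (L v) (L w)) (α β : Module.Dual ℝ V) (v : V')
    (θ : Module.Dual ℝ V) :
    Dtensor q (b.map L.symm) W' (α ∘ₗ L.toLinearMap) (β ∘ₗ L.toLinearMap) v (θ ∘ₗ L.toLinearMap)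
      = Dtensor q b W α β (L v) θ := by
  simp [Dtensor, components_map L b h, Module.Basis.map_apply]

end Frames

/-! ### Smooth functions near a point -/

section Smooth

open scoped Topology
open Filter

variable {n : ℕ} {M : Type*} [TopologicalSpace M] [ChartedSpace (EuclideanSpace ℝ (Fin n)) M]

variable (n M) in
/-- Vector fields on `M`, without any regularity. -/
abbrev VField : Type _ := (x : M) → TangentSpace (𝓡 n) x

/-- The function `f` is smooth in a neighbourhood of `x`. Being a property of the germ of `f`, this
is stable under differentiation along vector fields. -/
def SmoothFn (f : M → ℝ) (x : M) : Prop := ∀ᶠ y in 𝓝 x, ContMDiffAt (𝓡 n) 𝓘(ℝ, ℝ) ∞ f y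

variable {f g : M → ℝ} {x : M}

namespace SmoothFn

theorem self (h : SmoothFn (n := n) f x) : ContMDiffAt (𝓡 n) 𝓘(ℝ, ℝ) ∞ f x :=
  Eventually.self_of_nhds h

theorem mdiff (h : SmoothFn (n := n) f x) : MDifferentiableAt (𝓡 n) 𝓘(ℝ, ℝ) f x :=
  h.self.mdifferentiableAt (by simp)

theorem eventually (h : SmoothFn (n := n) f x) : ∀ᶠ y in 𝓝 x, SmoothFn (n := n) f y :=
  eventually_eventually_nhds.2 h

theorem congr (h : SmoothFn (n := n) f x) (hfg : ∀ᶠ y in 𝓝 x, g y = f y) :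
    SmoothFn (n := n) g x := by
  filter_upwards [h, eventually_eventually_nhds.2 hfg] with y hy hy'
  exact hy.congr_of_eventuallyEq hy'

theorem add (hf : SmoothFn (n := n) f x) (hg : SmoothFn (n := n) g x) :
    SmoothFn (n := n) (fun y => f y + g y) x := by
  filter_upwards [hf, hg] with y h1 h2 using h1.add h2

theorem sub (hf : SmoothFn (n := n) f x) (hg : SmoothFn (n := n) g x) :
    SmoothFn (n := n) (fun y => f y - g y) x := by
  filter_upwards [hf, hg] with y h1 h2 using h1.sub h2

theorem mul (hf : SmoothFn (n := n) f x) (hg : SmoothFn (n := n) g x) :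
    SmoothFn (n := n) (fun y => f y * g y) x := by
  filter_upwards [hf, hg] with y h1 h2 using h1.mul h2

theorem const (c : ℝ) : SmoothFn (n := n) (fun _ : M => c) x :=
  Eventually.of_forall fun _ => contMDiffAt_const

theorem neg (hf : SmoothFn (n := n) f x) : SmoothFn (n := n) (fun y => -f y) x := by
  filter_upwards [hf] with y h1 using h1.neg

theorem sum {ι : Type*} (s : Finset ι) {f : ι → M → ℝ} (hf : ∀ i ∈ s, SmoothFn (n := n) (f i) x) :
    SmoothFn (n := n) (fun y => ∑ i ∈ s, f i y) x := by
  classical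
  induction s using Finset.induction_on with
  | empty => simpa using const 0
  | insert a s ha ih =>
    simp only [Finset.sum_insert ha]
    exact (hf a (by simp)).add (ih fun i hi => hf i (by simp [hi]))

theorem prod {ι : Type*} (s : Finset ι) {f : ι → M → ℝ} (hf : ∀ i ∈ s, SmoothFn (n := n) (f i) x) :
    SmoothFn (n := n) (fun y => ∏ i ∈ s, f i y) x := by
  classical
  induction s using Finset.induction_on with
  | empty => simpa using const 1
  | insert a s ha ih =>
    simp only [Finset.prod_insert ha]
    exact (hf a (by simp)).mul (ih fun i hi => hf i (by simp [hi]))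

theorem inv (hf : SmoothFn (n := n) f x) (h0 : f x ≠ 0) : SmoothFn (n := n) (fun y => (f y)⁻¹) x := by
  filter_upwards [hf, hf.self.continuousAt.eventually_ne h0] with y h1 h2
  exact h1.inv₀ h2

end SmoothFn

theorem mvfderiv_congr (h : ∀ᶠ y in 𝓝 x, f y = g y) :
    mvfderiv (𝓡 n) f x = mvfderiv (𝓡 n) g x := by
  have h1 : f =ᶠ[𝓝 x] g := h
  ext v
  exact congrArg (fun L : TangentSpace (𝓡 n) x →L[ℝ] ℝ => L v)
    (h1.mfderiv_eq (I := 𝓡 n) (I' := 𝓘(ℝ, ℝ)))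

theorem mvfderiv_mul_apply (hf : SmoothFn (n := n) f x) (hg : SmoothFn (n := n) g x)
    (u : TangentSpace (𝓡 n) x) :
    mvfderiv (𝓡 n) (fun y => f y * g y) x u
      = f x * mvfderiv (𝓡 n) g x u + g x * mvfderiv (𝓡 n) f x u := by
  rw [mvfderiv_fun_mul hf.mdiff hg.mdiff]
  rfl

theorem mvfderiv_add_apply (hf : SmoothFn (n := n) f x) (hg : SmoothFn (n := n) g x)
    (u : TangentSpace (𝓡 n) x) :
    mvfderiv (𝓡 n) (fun y => f y + g y) x u = mvfderiv (𝓡 n) f x u + mvfderiv (𝓡 n) g x u := by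
  rw [mvfderiv_fun_add hf.mdiff hg.mdiff]
  rfl

theorem mvfderiv_sub_apply (hf : SmoothFn (n := n) f x) (hg : SmoothFn (n := n) g x)
    (u : TangentSpace (𝓡 n) x) :
    mvfderiv (𝓡 n) (fun y => f y - g y) x u = mvfderiv (𝓡 n) f x u - mvfderiv (𝓡 n) g x u := by
  rw [mvfderiv_fun_sub hf.mdiff hg.mdiff]
  rfl

theorem mvfderiv_const_apply (c : ℝ) (u : TangentSpace (𝓡 n) x) :
    mvfderiv (𝓡 n) (fun _ : M => c) x u = 0 := by
  rw [mvfderiv_const]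
  rfl

/-! ### Smooth dependence of the components of `Q` and `D` on those of `W` -/

theorem det_smoothFn {ι : Type*} [DecidableEq ι] [Fintype ι] {A : M → Matrix ι ι ℝ}
    (hA : ∀ i j, SmoothFn (n := n) (fun y => A y i j) x) :
    SmoothFn (n := n) (fun y => (A y).det) x := by
  simp only [Matrix.det_apply']
  exact SmoothFn.sum _ fun σ _ => (SmoothFn.const _).mul (SmoothFn.prod _ fun i _ => hA _ _)

theorem weylProd_smoothFn {Wc : M → Fin n → Fin n → Matrix (Fin n) (Fin n) ℝ}
    (hW : ∀ a b c d, SmoothFn (n := n) (fun y => Wc y a b c d) x) (k : ℕ)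
    (f : Fin (2 * k) → Fin n) (s t : Fin n) :
    SmoothFn (n := n) (fun y => weylProd (Wc y) k f s t) x := by
  induction k generalizing s t with
  | zero => exact SmoothFn.const _
  | succ k ih =>
    simp only [weylProd, Matrix.mul_apply]
    exact SmoothFn.sum _ fun j _ => (hW _ _ _ _).mul (ih _ _ _)

theorem traceProd_smoothFn {Wc : M → Fin n → Fin n → Matrix (Fin n) (Fin n) ℝ}
    (hW : ∀ a b c d, SmoothFn (n := n) (fun y => Wc y a b c d) x) (q : Input n)
    (f : q.Slot → Fin n) : SmoothFn (n := n) (fun y => traceProd q (Wc y) f) x := by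
  unfold traceProd
  exact SmoothFn.prod _ fun j _ => SmoothFn.sum _ fun s _ => weylProd_smoothFn hW _ _ _ _

theorem Qmat_smoothFn {Wc : M → Fin n → Fin n → Matrix (Fin n) (Fin n) ℝ}
    (hW : ∀ a b c d, SmoothFn (n := n) (fun y => Wc y a b c d) x) (q : Input n) (s t : Fin n) :
    SmoothFn (n := n) (fun y => Qmat q (Wc y) s t) x := by
  simp only [Qmat, Matrix.smul_apply, Matrix.sum_apply, smul_eq_mul]
  exact (SmoothFn.const _).mul (SmoothFn.sum _ fun f _ =>
    ((SmoothFn.const _).mul (traceProd_smoothFn hW q f)).mul (weylProd_smoothFn hW _ _ _ _))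

theorem Qmat'_smoothFn {Wc : M → Fin n → Fin n → Matrix (Fin n) (Fin n) ℝ}
    (hW : ∀ a b c d, SmoothFn (n := n) (fun y => Wc y a b c d) x) (q : Input n)
    (b₁ b₂ s t : Fin n) : SmoothFn (n := n) (fun y => Qmat' q (Wc y) b₁ b₂ s t) x := by
  simp only [Qmat', Matrix.smul_apply, Matrix.sum_apply, smul_eq_mul]
  refine (SmoothFn.const _).mul (SmoothFn.sum _ fun f _ => ?_)
  split_ifs
  · simp only [Matrix.smul_apply, smul_eq_mul]
    exact ((SmoothFn.const _).mul (traceProd_smoothFn hW q f)).mul (weylProd_smoothFn hW _ _ _ _)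
  · exact SmoothFn.const _

theorem Dcomp_smoothFn {Wc : M → Fin n → Fin n → Matrix (Fin n) (Fin n) ℝ}
    (hW : ∀ a b c d, SmoothFn (n := n) (fun y => Wc y a b c d) x) (q : Input n)
    (hQ : (Qmat q (Wc x)).det ≠ 0) (b₁ b₂ i k : Fin n) :
    SmoothFn (n := n) (fun y => Dcomp q (Wc y) b₁ b₂ i k) x := by
  unfold Dcomp
  refine ((det_smoothFn (Qmat_smoothFn hW q)).inv hQ).mul (SmoothFn.sum _ fun r _ => ?_)
  refine SmoothFn.mul ?_ (Qmat'_smoothFn hW q _ _ _ _)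
  simp only [Matrix.adjugate_apply]
  refine det_smoothFn fun a b => ?_
  simp only [Matrix.updateRow_apply]
  split_ifs
  · exact SmoothFn.const _
  · exact Qmat_smoothFn hW q _ _

/-! ### Smooth vector fields -/

variable [IsManifold (𝓡 n) ∞ M] {U V W : VField n M}

instance isManifold_minSmoothness_three : IsManifold (𝓡 n) (minSmoothness ℝ 3) M := by
  rw [minSmoothness_of_isRCLikeNormedField]
  infer_instance

/-- The vector field `V` is smooth in a neighbourhood of `x`. -/
def SmoothVF (V : VField n M) (x : M) : Prop :=
  ∀ᶠ y in 𝓝 x, ContMDiffAt (𝓡 n) ((𝓡 n).prod 𝓘(ℝ, EuclideanSpace ℝ (Fin n))) ∞ (T% V) y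

namespace SmoothVF

theorem self (h : SmoothVF V x) :
    ContMDiffAt (𝓡 n) ((𝓡 n).prod 𝓘(ℝ, EuclideanSpace ℝ (Fin n))) ∞ (T% V) x :=
  Eventually.self_of_nhds h

theorem mdiff (h : SmoothVF V x) :
    MDifferentiableAt (𝓡 n) ((𝓡 n).prod 𝓘(ℝ, EuclideanSpace ℝ (Fin n))) (T% V) x :=
  h.self.mdifferentiableAt (by simp)

theorem eventually (h : SmoothVF V x) : ∀ᶠ y in 𝓝 x, SmoothVF V y :=
  eventually_eventually_nhds.2 h

theorem congr (h : SmoothVF V x) (hVW : ∀ᶠ y in 𝓝 x, W y = V y) : SmoothVF W x := by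
  filter_upwards [h, eventually_eventually_nhds.2 hVW] with y hy hy'
  exact hy.congr_of_eventuallyEq (hy'.mono fun z hz => congrArg (TotalSpace.mk z) hz)

theorem add (hV : SmoothVF V x) (hW : SmoothVF W x) : SmoothVF (V + W) x := by
  filter_upwards [hV, hW] with y h1 h2 using h1.add_section h2

theorem sub (hV : SmoothVF V x) (hW : SmoothVF W x) : SmoothVF (V - W) x := by
  filter_upwards [hV, hW] with y h1 h2 using h1.sub_section h2

theorem smul (hf : SmoothFn (n := n) f x) (hV : SmoothVF V x) : SmoothVF (f • V) x := by
  filter_upwards [hf, hV] with y h1 h2 using h1.smul_section h2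

theorem const_smul (c : ℝ) (hV : SmoothVF V x) : SmoothVF (c • V) x := by
  filter_upwards [hV] with y h2 using h2.const_smul_section

theorem sum {ι : Type*} (s : Finset ι) {V : ι → VField n M} (hV : ∀ i ∈ s, SmoothVF (V i) x) :
    SmoothVF (fun y => ∑ i ∈ s, V i y) x := by
  have : ∀ᶠ y in 𝓝 x, ∀ i ∈ s, _ := (Filter.eventually_all_finset s).2 hV
  filter_upwards [this] with y hy using ContMDiffAt.sum_section hy

theorem ext_smooth (v : TangentSpace (𝓡 n) x) : SmoothVF (ext v) x := by
  obtain ⟨s, hs, h⟩ := FiberBundle.exists_contMDiffOn_extend (𝓡 n) (EuclideanSpace ℝ (Fin n))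
    (k := ∞) v
  filter_upwards [eventually_mem_nhds_iff.2 hs] with y hy
  exact h.contMDiffAt hy

theorem bracket (hV : SmoothVF V x) (hW : SmoothVF W x) :
    SmoothVF (VectorField.mlieBracket (𝓡 n) V W) x := by
  have : IsManifold (𝓡 n) (((⊤ : ℕ∞) : ℕ∞ω) + 1) M := ‹IsManifold (𝓡 n) ∞ M›
  filter_upwards [hV, hW] with y h1 h2
  exact ContMDiffAt.mlieBracket_vectorField (m := ⊤) (n := ⊤) h1 h2 (by simp)

end SmoothVF

@[simp]
theorem ext_self (v : TangentSpace (𝓡 n) x) : ext v x = v := FiberBundle.extend_apply_self _ v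

/-- Derivatives of smooth functions along smooth vector fields are smooth. -/
theorem SmoothFn.deriv (hf : SmoothFn (n := n) f x) (hV : SmoothVF V x) :
    SmoothFn (n := n) (fun y => mvfderiv (𝓡 n) f y (V y)) x := by
  filter_upwards [hf, hV] with y h1 h2
  have h3 := h1.mfderiv_const (m := ∞) (by simp)
  have h4 := ContMDiffAt.clm_apply_of_inCoordinates (b₁ := id) (b₂ := f)
    (ϕ := fun y => mfderiv (𝓡 n) 𝓘(ℝ, ℝ) f y) (v := V) h3 h2 h1
  rw [contMDiffAt_totalSpace] at h4
  refine h4.2.congr_of_eventuallyEq (Eventually.of_forall fun z => ?_)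
  simp [mvfderiv]
  rfl

/-- A vector field that is smooth near `x` agrees near `x` with a globally smooth one. -/
theorem SmoothVF.exists_global [T2Space M] (hV : SmoothVF V x) :
    ∃ V' : VField n M, (∀ y, ContMDiffAt (𝓡 n) ((𝓡 n).prod 𝓘(ℝ, EuclideanSpace ℝ (Fin n))) ∞
      (T% V') y) ∧ ∀ᶠ y in 𝓝 x, V' y = V y := by
  obtain ⟨u, hu, huo, hxu⟩ := eventually_nhds_iff.1 hV
  obtain ⟨φ, hφ⟩ := (SmoothBumpFunction.nhds_basis_tsupport (I := 𝓡 n) x).mem_iff.1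
    (huo.mem_nhds hxu)
  refine ⟨(φ : M → ℝ) • V, fun y => ?_, ?_⟩
  · exact ContMDiffOn.smul_section_of_tsupport (u := u) φ.contMDiff.contMDiffOn huo hφ.2
      (fun z hz => (hu z hz).contMDiffWithinAt) y
  · filter_upwards [φ.eventuallyEq_one] with y hy
    simp [hy]

/-- The Lie bracket of vector fields is the commutator of the derivations. This follows from the
Jacobi identity for the fields `U`, `V` and `f W` with `W x ≠ 0`, which exist in positive
dimension. -/
theorem mvfderiv_bracket (hn : n ≠ 0) (hf : SmoothFn (n := n) f x) (hU : SmoothVF U x)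
    (hV : SmoothVF V x) :
    mvfderiv (𝓡 n) f x (VectorField.mlieBracket (𝓡 n) U V x)
      = mvfderiv (𝓡 n) (fun y => mvfderiv (𝓡 n) f y (V y)) x (U x)
        - mvfderiv (𝓡 n) (fun y => mvfderiv (𝓡 n) f y (U y)) x (V x) := by
  set w : TangentSpace (𝓡 n) x := coordBasis x ⟨0, Nat.pos_of_ne_zero hn⟩ with hw
  have hw0 : w ≠ 0 := (coordBasis x).ne_zero _
  set W : VField n M := ext w with hW
  have hWs : SmoothVF W x := SmoothVF.ext_smooth w
  have key : ∀ {A B : VField n M}, SmoothVF A x → SmoothVF B x →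
      VectorField.mlieBracket (𝓡 n) A (VectorField.mlieBracket (𝓡 n) B (f • W)) x
        = mvfderiv (𝓡 n) (fun y => mvfderiv (𝓡 n) f y (B y)) x (A x) • W x
          + mvfderiv (𝓡 n) f x (B x) • VectorField.mlieBracket (𝓡 n) A W x
          + (mvfderiv (𝓡 n) f x (A x) • VectorField.mlieBracket (𝓡 n) B W x
          + f x • VectorField.mlieBracket (𝓡 n) A (VectorField.mlieBracket (𝓡 n) B W) x) := by
    intro A B hA hB
    have h1 : VectorField.mlieBracket (𝓡 n) B (f • W) =ᶠ[𝓝 x]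
        (fun y => mvfderiv (𝓡 n) f y (B y)) • W + f • VectorField.mlieBracket (𝓡 n) B W := by
      filter_upwards [hf.eventually, hWs.eventually] with y h1 h2
      exact VectorField.mlieBracket_smul_right h1.mdiff h2.mdiff
    rw [Filter.EventuallyEq.mlieBracket_vectorField_eq (Filter.EventuallyEq.refl _ A) h1,
      VectorField.mlieBracket_add_right (SmoothVF.smul (hf.deriv hB) hWs).mdiff
        (SmoothVF.smul hf (hB.bracket hWs)).mdiff,
      VectorField.mlieBracket_smul_right (hf.deriv hB).mdiff hWs.mdiff,
      VectorField.mlieBracket_smul_right hf.mdiff (hB.bracket hWs).mdiff]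
  have c2 : ∀ {A : VField n M}, SmoothVF A x → ContMDiffAt (𝓡 n)
      ((𝓡 n).prod 𝓘(ℝ, EuclideanSpace ℝ (Fin n))) (minSmoothness ℝ 2) (T% A) x := by
    intro A hA
    rw [minSmoothness_of_isRCLikeNormedField]
    exact hA.self.of_le (WithTop.coe_le_coe.2 le_top)
  have J1 := VectorField.leibniz_identity_mlieBracket_apply (c2 hU) (c2 hV)
    (c2 (SmoothVF.smul hf hWs))
  have J2 := VectorField.leibniz_identity_mlieBracket_apply (c2 hU) (c2 hV) (c2 hWs)
  rw [key hU hV, key hV hU, VectorField.mlieBracket_smul_right hf.mdiff hWs.mdiff, J2] at J1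
  have hWx : W x = w := ext_self w
  rw [hWx] at J1
  have J3 : (mvfderiv (𝓡 n) f x (VectorField.mlieBracket (𝓡 n) U V x)
      - (mvfderiv (𝓡 n) (fun y => mvfderiv (𝓡 n) f y (V y)) x (U x)
        - mvfderiv (𝓡 n) (fun y => mvfderiv (𝓡 n) f y (U y)) x (V x))) • w = 0 := by
    rw [← sub_eq_zero] at J1
    refine neg_eq_zero.1 (Eq.trans ?_ J1)
    module
  rcases smul_eq_zero.1 J3 with h | h
  · exact sub_eq_zero.1 h
  · exact absurd h hw0

/-! ### Connections acting on smooth fields -/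

variable {nabla : AffineConnection n M}

theorem cov_congr (hV : SmoothVF V x) (h : ∀ᶠ y in 𝓝 x, W y = V y) :
    nabla W x = nabla V x :=
  nabla.isCovariantDerivativeOnUniv.congr_of_eventuallyEq (hV.congr h).mdiff hV.mdiff
    Filter.univ_mem h

theorem cov_add (hV : SmoothVF V x) (hW : SmoothVF W x) (u : TangentSpace (𝓡 n) x) :
    nabla (V + W) x u = nabla V x u + nabla W x u := by
  rw [nabla.isCovariantDerivativeOnUniv.add hV.mdiff hW.mdiff]
  rfl

theorem cov_smul (hf : SmoothFn (n := n) f x) (hV : SmoothVF V x) (u : TangentSpace (𝓡 n) x) :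
    nabla (f • V) x u = f x • nabla V x u + mvfderiv (𝓡 n) f x u • V x := by
  rw [nabla.isCovariantDerivativeOnUniv.leibniz hV.mdiff hf.mdiff]
  rfl

theorem IsSmoothTorsionFree.bracket (h : IsSmoothTorsionFree nabla) (hU : SmoothVF U x)
    (hV : SmoothVF V x) :
    VectorField.mlieBracket (𝓡 n) U V x = nabla V x (U x) - nabla U x (V x) :=
  ((CovariantDerivative.torsion_eq_zero_iff nabla).1 h.torsion_eq_zero hU.mdiff hV.mdiff).symm

/-- `∇_V W` is smooth where `V` and `W` are. Smoothness of a connection is a statement about global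
fields, so `W` is cut off by a bump function; this is where the Hausdorff property is used. -/
theorem IsSmoothTorsionFree.smooth_cov [T2Space M] (h : IsSmoothTorsionFree nabla)
    (hV : SmoothVF V x) (hW : SmoothVF W x) : SmoothVF (fun y => nabla W y (V y)) x := by
  obtain ⟨W', hW', hWW'⟩ := hW.exists_global
  have h1 := h.smooth.contMDiff.contMDiff (σ := W') (by
    intro y _
    exact (hW' y).contMDiffWithinAt)
  have h2 : SmoothVF (fun y => nabla W' y (V y)) x := by
    filter_upwards [hV] with y hy
    exact ContMDiffAt.clm_bundle_apply (h1.contMDiffAt Filter.univ_mem) hy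
  refine h2.congr ?_
  filter_upwards [hW.eventually, eventually_eventually_nhds.2 hWW'] with y h3 h4
  rw [cov_congr h3 h4]

end Smooth

/-! ### Tensoriality -/

section Tensoriality

open scoped Topology
open Filter

variable {n : ℕ} {M : Type*} [TopologicalSpace M] [ChartedSpace (EuclideanSpace ℝ (Fin n)) M]
  [IsManifold (𝓡 n) ∞ M] {x : M} {U V W : VField n M} {nabla : AffineConnection n M}

/-- Around every point there is a smooth frame of the tangent bundle; away from the point it is
continued by arbitrary bases. -/
theorem exists_smooth_frame (x : M) :
    ∃ B : (y : M) → Module.Basis (Fin n) ℝ (TangentSpace (𝓡 n) y),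
      (∀ i, SmoothVF (fun y => B y i) x) ∧
      ∀ V : VField n M, SmoothVF V x → ∀ i, SmoothFn (n := n) (fun y => (B y).repr (V y) i) x := by
  classical
  let t := trivializationAt (EuclideanSpace ℝ (Fin n)) (TangentSpace (𝓡 n) : M → Type _) x
  let b := (EuclideanSpace.basisFun (Fin n) ℝ).toBasis
  have hx : x ∈ t.baseSet := FiberBundle.mem_baseSet_trivializationAt' x
  have ht : ∀ᶠ y in 𝓝 x, y ∈ t.baseSet := t.open_baseSet.mem_nhds hx
  let B : (y : M) → Module.Basis (Fin n) ℝ (TangentSpace (𝓡 n) y) := fun y =>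
    if hy : y ∈ t.baseSet then t.basisAt b hy else coordBasis y
  refine ⟨B, fun i => ?_, fun V hV i => ?_⟩
  · have h1 : SmoothVF (t.localFrame b i) x := by
      filter_upwards [ht] with y hy
      exact contMDiffAt_localFrame_of_mem ∞ t b i hy
    refine h1.congr ?_
    filter_upwards [ht] with y hy
    simp [B, hy]
  · have h1 : SmoothFn (n := n) (fun y => t.localFrameCoeff (𝓡 n) b i y (V y)) x := by
      filter_upwards [ht, hV] with y hy hVy
      exact contMDiffAt_localFrameCoeff b hy hVy i
    refine h1.congr ?_
    filter_upwards [ht] with y hy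
    rw [t.localFrameCoeff_apply_of_mem_baseSet b hy]
    simp [B, hy]

/-- An operation on vector fields is tensorial at `x` if it is additive and linear over the
functions, on fields and functions that are smooth near `x`. In contrast to `TensorialAt`, this
applies to operations involving several derivatives. -/
structure SmoothTensorial {X : Type*} [AddCommGroup X] [Module ℝ X] (Φ : VField n M → X) (x : M) :
    Prop where
  add : ∀ V W, SmoothVF V x → SmoothVF W x → Φ (V + W) = Φ V + Φ W
  smul : ∀ f V, SmoothFn (n := n) f x → SmoothVF V x → Φ (f • V) = f x • Φ V

namespace SmoothTensorial

variable {X : Type*} [AddCommGroup X] [Module ℝ X] {Φ : VField n M → X}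

theorem sum (h : SmoothTensorial Φ x) {ι : Type*} (s : Finset ι) (V : ι → VField n M)
    (hV : ∀ i ∈ s, SmoothVF (V i) x) : Φ (∑ i ∈ s, V i) = ∑ i ∈ s, Φ (V i) := by
  classical
  induction s using Finset.induction_on with
  | empty =>
    have h0 : SmoothVF (0 : VField n M) x := by
      simpa using (SmoothVF.ext_smooth (0 : TangentSpace (𝓡 n) x)).const_smul 0
    simpa using h.smul (fun _ => 0) 0 (SmoothFn.const 0) h0
  | insert a s ha ih =>
    have hs : SmoothVF (∑ i ∈ s, V i) x := by
      have := SmoothVF.sum s (fun i hi => hV i (Finset.mem_insert_of_mem hi))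
      refine this.congr (Eventually.of_forall fun y => ?_)
      simp
    rw [Finset.sum_insert ha, Finset.sum_insert ha,
      h.add _ _ (hV a (Finset.mem_insert_self a s)) hs,
      ih fun i hi => hV i (Finset.mem_insert_of_mem hi)]

theorem exists_linear (h : SmoothTensorial Φ x) :
    ∃ L : TangentSpace (𝓡 n) x →ₗ[ℝ] X, ∀ V, SmoothVF V x → Φ V = L (V x) := by
  obtain ⟨B, hB, hc⟩ := exists_smooth_frame (n := n) x
  refine ⟨(B x).constr ℝ fun i => Φ fun y => B y i, fun V hV => ?_⟩
  have hV' : V = ∑ i, (fun y => (B y).repr (V y) i) • (fun y => B y i : VField n M) := by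
    ext1 y
    conv_lhs => rw [← (B y).sum_repr (V y)]
    simp
  rw [Module.Basis.constr_apply_fintype]
  conv_lhs => rw [hV']
  rw [h.sum _ _ fun i _ => SmoothVF.smul (hc V hV i) (hB i)]
  refine Finset.sum_congr rfl fun i _ => ?_
  rw [h.smul _ _ (hc V hV i) (hB i)]
  simp

/-- A tensorial operation depends only on the value of the field at the point. -/
theorem apply (h : SmoothTensorial Φ x) (hV : SmoothVF V x) : Φ (ext (V x)) = Φ V := by
  obtain ⟨L, hL⟩ := h.exists_linear
  rw [hL _ hV, hL _ (SmoothVF.ext_smooth _), ext_self]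

theorem isLinearMap (h : SmoothTensorial Φ x) :
    IsLinearMap ℝ fun v : TangentSpace (𝓡 n) x => Φ (ext v) := by
  obtain ⟨L, hL⟩ := h.exists_linear
  have : (fun v : TangentSpace (𝓡 n) x => Φ (ext v)) = L := by
    ext v
    rw [hL _ (SmoothVF.ext_smooth _), ext_self]
  rw [this]
  exact L.isLinear

end SmoothTensorial

/-! ### Covariant derivatives of covariant tensors -/

/-- Smooth 1-forms: fibrewise linear, with smooth values on smooth vector fields. -/
structure SmoothForm₁ (θ : (x : M) → TangentSpace (𝓡 n) x → ℝ) : Prop where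
  linear (x : M) : IsLinearMap ℝ (θ x)
  smooth {x : M} {V : VField n M} (hV : SmoothVF V x) : SmoothFn (n := n) (fun y => θ y (V y)) x

/-- Smooth covariant tensors of degree 2. -/
structure SmoothForm₂ (T : (x : M) → TangentSpace (𝓡 n) x → TangentSpace (𝓡 n) x → ℝ) :
    Prop where
  bilinear (x : M) : IsBilinear (T x)
  smooth {x : M} {V W : VField n M} (hV : SmoothVF V x) (hW : SmoothVF W x) :
    SmoothFn (n := n) (fun y => T y (V y) (W y)) x

/-- Smooth covariant tensors of degree 3. -/
structure SmoothForm₃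
    (T : (x : M) → TangentSpace (𝓡 n) x → TangentSpace (𝓡 n) x → TangentSpace (𝓡 n) x → ℝ) :
    Prop where
  trilinear (x : M) : IsTrilinear (T x)
  smooth {x : M} {U V W : VField n M} (hU : SmoothVF U x) (hV : SmoothVF V x)
    (hW : SmoothVF W x) : SmoothFn (n := n) (fun y => T y (U y) (V y) (W y)) x

theorem covDeriv₁_tensorial {θ : (x : M) → TangentSpace (𝓡 n) x → ℝ} (hθ : SmoothForm₁ θ)
    (nabla : AffineConnection n M) (x : M) (u : TangentSpace (𝓡 n) x) :
    SmoothTensorial (fun V : VField n M =>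
      mvfderiv (𝓡 n) (fun y => θ y (V y)) x u - θ x (nabla V x u)) x where
  add V W hV hW := by
    simp only [Pi.add_apply, (hθ.linear _).map_add]
    rw [mvfderiv_add_apply (hθ.smooth hV) (hθ.smooth hW), cov_add hV hW, (hθ.linear x).map_add]
    ring
  smul f V hf hV := by
    simp only [Pi.smul_apply', (hθ.linear _).map_smul, smul_eq_mul]
    rw [mvfderiv_mul_apply hf (hθ.smooth hV), cov_smul hf hV, (hθ.linear x).map_add,
      (hθ.linear x).map_smul, (hθ.linear x).map_smul, smul_eq_mul, smul_eq_mul]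
    ring

/-- The covariant derivative of a 1-form can be computed with any smooth extension of the vector. -/
theorem SmoothForm₁.covDeriv_field {θ : (x : M) → TangentSpace (𝓡 n) x → ℝ} (hθ : SmoothForm₁ θ)
    (nabla : AffineConnection n M) (u : TangentSpace (𝓡 n) x) (hV : SmoothVF V x) :
    covDeriv₁ nabla θ x u (V x) = mvfderiv (𝓡 n) (fun y => θ y (V y)) x u - θ x (nabla V x u) :=
  (covDeriv₁_tensorial hθ nabla x u).apply hV

theorem SmoothForm₁.covDeriv [T2Space M] {θ : (x : M) → TangentSpace (𝓡 n) x → ℝ}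
    (hθ : SmoothForm₁ θ) (hnabla : IsSmoothTorsionFree nabla) :
    SmoothForm₂ (covDeriv₁ nabla θ) where
  bilinear x :=
    { left := fun v => by
        unfold covDeriv₁
        exact ((mvfderiv (𝓡 n) _ x).toLinearMap -
          (hθ.linear x).mk' ∘ₗ (nabla (ext v) x).toLinearMap).isLinear
      right := fun u => (covDeriv₁_tensorial hθ nabla x u).isLinearMap }
  smooth {x V W} hV hW := by
    have h1 := ((hθ.smooth hW).deriv hV).sub (hθ.smooth (hnabla.smooth_cov hV hW))
    refine h1.congr ?_
    filter_upwards [hW.eventually] with y hy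
    exact hθ.covDeriv_field nabla (V y) hy

theorem covDeriv₂_tensorial_left
    {T : (x : M) → TangentSpace (𝓡 n) x → TangentSpace (𝓡 n) x → ℝ} (hT : SmoothForm₂ T)
    (nabla : AffineConnection n M) (u : TangentSpace (𝓡 n) x) (hW : SmoothVF W x) :
    SmoothTensorial (fun V : VField n M => mvfderiv (𝓡 n) (fun y => T y (V y) (W y)) x u
      - T x (nabla V x u) (W x) - T x (V x) (nabla W x u)) x where
  add V V' hV hV' := by
    have hl := fun y w => (hT.bilinear y).left w
    simp only [Pi.add_apply, (hl _ _).map_add]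
    rw [mvfderiv_add_apply (hT.smooth hV hW) (hT.smooth hV' hW), cov_add hV hV', (hl _ _).map_add]
    ring
  smul f V hf hV := by
    have hl := fun y w => (hT.bilinear y).left w
    simp only [Pi.smul_apply', (hl _ _).map_smul, smul_eq_mul]
    rw [mvfderiv_mul_apply hf (hT.smooth hV hW), cov_smul hf hV, (hl _ _).map_add,
      (hl _ _).map_smul, (hl _ _).map_smul, smul_eq_mul, smul_eq_mul]
    ring

theorem covDeriv₂_tensorial_right
    {T : (x : M) → TangentSpace (𝓡 n) x → TangentSpace (𝓡 n) x → ℝ} (hT : SmoothForm₂ T)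
    (nabla : AffineConnection n M) (u : TangentSpace (𝓡 n) x) (hV : SmoothVF V x) :
    SmoothTensorial (fun W : VField n M => mvfderiv (𝓡 n) (fun y => T y (V y) (W y)) x u
      - T x (nabla V x u) (W x) - T x (V x) (nabla W x u)) x where
  add W W' hW hW' := by
    have hl := fun y w => (hT.bilinear y).right w
    simp only [Pi.add_apply, (hl _ _).map_add]
    rw [mvfderiv_add_apply (hT.smooth hV hW) (hT.smooth hV hW'), cov_add hW hW', (hl _ _).map_add]
    ring
  smul f W hf hW := by
    have hl := fun y w => (hT.bilinear y).right w
    simp only [Pi.smul_apply', (hl _ _).map_smul, smul_eq_mul]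
    rw [mvfderiv_mul_apply hf (hT.smooth hV hW), cov_smul hf hW, (hl _ _).map_add,
      (hl _ _).map_smul, (hl _ _).map_smul, smul_eq_mul, smul_eq_mul]
    ring

/-- The covariant derivative of a covariant 2-tensor can be computed with any smooth extensions of
the vectors. -/
theorem SmoothForm₂.covDeriv_field
    {T : (x : M) → TangentSpace (𝓡 n) x → TangentSpace (𝓡 n) x → ℝ} (hT : SmoothForm₂ T)
    (nabla : AffineConnection n M) (u : TangentSpace (𝓡 n) x) (hV : SmoothVF V x)
    (hW : SmoothVF W x) :
    covDeriv₂ nabla T x u (V x) (W x) = mvfderiv (𝓡 n) (fun y => T y (V y) (W y)) x u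
      - T x (nabla V x u) (W x) - T x (V x) (nabla W x u) := by
  have h1 := (covDeriv₂_tensorial_left hT nabla u (SmoothVF.ext_smooth (W x))).apply hV
  have h2 := (covDeriv₂_tensorial_right hT nabla u hV).apply hW
  rw [← h2]
  unfold covDeriv₂
  simp only [ext_self] at h1 ⊢
  exact h1

theorem SmoothForm₂.covDeriv [T2Space M]
    {T : (x : M) → TangentSpace (𝓡 n) x → TangentSpace (𝓡 n) x → ℝ}
    (hT : SmoothForm₂ T) (hnabla : IsSmoothTorsionFree nabla) :
    SmoothForm₃ (covDeriv₂ nabla T) where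
  trilinear x :=
    { left := fun v w => by
        unfold covDeriv₂
        exact ((mvfderiv (𝓡 n) _ x).toLinearMap -
          ((hT.bilinear x).left w).mk' ∘ₗ (nabla (ext v) x).toLinearMap -
          ((hT.bilinear x).right v).mk' ∘ₗ (nabla (ext w) x).toLinearMap).isLinear
      mid := fun u w => by
        unfold covDeriv₂
        have := (covDeriv₂_tensorial_left hT nabla u (SmoothVF.ext_smooth w)).isLinearMap
        simpa only [ext_self] using this
      right := fun u v => by
        unfold covDeriv₂
        have := (covDeriv₂_tensorial_right hT nabla u (SmoothVF.ext_smooth v)).isLinearMap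
        simpa only [ext_self] using this }
  smooth {x U V W} hU hV hW := by
    have h1 := (((hT.smooth hV hW).deriv hU).sub (hT.smooth (hnabla.smooth_cov hU hV) hW)).sub
      (hT.smooth hV (hnabla.smooth_cov hU hW))
    refine h1.congr ?_
    filter_upwards [hV.eventually, hW.eventually] with y hy hy'
    exact hT.covDeriv_field nabla (U y) hy hy'

theorem SmoothForm₂.add {S T : (x : M) → TangentSpace (𝓡 n) x → TangentSpace (𝓡 n) x → ℝ}
    (hS : SmoothForm₂ S) (hT : SmoothForm₂ T) : SmoothForm₂ fun x u v => S x u v + T x u v where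
  bilinear x := ⟨fun v => (((hS.bilinear x).left v).mk' + ((hT.bilinear x).left v).mk').isLinear,
    fun u => (((hS.bilinear x).right u).mk' + ((hT.bilinear x).right u).mk').isLinear⟩
  smooth hV hW := (hS.smooth hV hW).add (hT.smooth hV hW)

theorem SmoothForm₂.const_mul {T : (x : M) → TangentSpace (𝓡 n) x → TangentSpace (𝓡 n) x → ℝ}
    (hT : SmoothForm₂ T) (c : ℝ) : SmoothForm₂ fun x u v => c * T x u v where
  bilinear x := ⟨fun v => (c • ((hT.bilinear x).left v).mk').isLinear,
    fun u => (c • ((hT.bilinear x).right u).mk').isLinear⟩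
  smooth hV hW := (SmoothFn.const c).mul (hT.smooth hV hW)

theorem SmoothForm₂.swap {T : (x : M) → TangentSpace (𝓡 n) x → TangentSpace (𝓡 n) x → ℝ}
    (hT : SmoothForm₂ T) : SmoothForm₂ fun x u v => T x v u where
  bilinear x := ⟨fun v => (hT.bilinear x).right v, fun u => (hT.bilinear x).left u⟩
  smooth hV hW := hT.smooth hW hV

theorem SmoothForm₁.mul {θ η : (x : M) → TangentSpace (𝓡 n) x → ℝ}
    (hθ : SmoothForm₁ θ) (hη : SmoothForm₁ η) : SmoothForm₂ fun x u v => θ x u * η x v where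
  bilinear x := ⟨fun v => (LinearMap.mulRight ℝ (η x v) ∘ₗ (hθ.linear x).mk').isLinear,
    fun u => (LinearMap.mulLeft ℝ (θ x u) ∘ₗ (hη.linear x).mk').isLinear⟩
  smooth hV hW := (hθ.smooth hV).mul (hη.smooth hW)

/-! ### Tensoriality of the curvature -/

/-- `∇_U ∇_V W - ∇_V ∇_U W - ∇_{[U, V]} W` at `x`, for vector fields. -/
def curvField (nabla : AffineConnection n M) (U V W : VField n M) (x : M) :
    TangentSpace (𝓡 n) x :=
  nabla (fun y => nabla W y (V y)) x (U x) - nabla (fun y => nabla W y (U y)) x (V x)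
    - nabla W x (VectorField.mlieBracket (𝓡 n) U V x)

theorem curvature_eq_curvField (nabla : AffineConnection n M) (x : M)
    (u v w : TangentSpace (𝓡 n) x) :
    curvature nabla x u v w = curvField nabla (ext u) (ext v) (ext w) x := by
  simp [curvature, curvField]

theorem curvField_swap (nabla : AffineConnection n M) (U V W : VField n M) (x : M) :
    curvField nabla V U W x = -curvField nabla U V W x := by
  unfold curvField
  rw [VectorField.mlieBracket_swap_apply, map_neg]
  abel

variable [T2Space M]

theorem curvField_tensorial_left (hnabla : IsSmoothTorsionFree nabla)
    (hW : SmoothVF W x) : SmoothTensorial (fun U => curvField nabla U V W x) x where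
  add U U' hU hU' := by
    unfold curvField
    have h1 : (fun y => nabla W y ((U + U') y))
        = (fun y => nabla W y (U y)) + fun y => nabla W y (U' y) := by
      ext1 y; simp
    rw [h1, cov_add (hnabla.smooth_cov hU hW) (hnabla.smooth_cov hU' hW),
      VectorField.mlieBracket_add_left hU.mdiff hU'.mdiff, Pi.add_apply, map_add, map_add]
    abel
  smul f U hf hU := by
    unfold curvField
    have h1 : (fun y => nabla W y ((f • U) y)) = f • fun y => nabla W y (U y) := by
      ext1 y; simp
    rw [h1, cov_smul hf (hnabla.smooth_cov hU hW),
      VectorField.mlieBracket_smul_left hf.mdiff hU.mdiff, Pi.smul_apply', map_add, map_smul,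
      map_smul, map_smul]
    module

theorem curvField_tensorial_mid (hnabla : IsSmoothTorsionFree nabla)
    (hW : SmoothVF W x) : SmoothTensorial (fun V => curvField nabla U V W x) x where
  add V V' hV hV' := by
    have := (curvField_tensorial_left (V := U) hnabla hW).add V V' hV hV'
    simp only [curvField_swap nabla U] at this
    rw [← neg_inj, this, neg_add]
  smul f V hf hV := by
    have := (curvField_tensorial_left (V := U) hnabla hW).smul f V hf hV
    simp only [curvField_swap nabla U] at this
    rw [← neg_inj, this, smul_neg]

/-- This uses that `[U, V]` acts on functions as a commutator (`mvfderiv_bracket`). -/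
theorem curvField_tensorial_right (hn : n ≠ 0) (hnabla : IsSmoothTorsionFree nabla)
    (hU : SmoothVF U x) (hV : SmoothVF V x) :
    SmoothTensorial (fun W => curvField nabla U V W x) x where
  add W W' hW hW' := by
    have h1 : ∀ {A : VField n M}, SmoothVF A x →
        nabla (fun y => nabla (W + W') y (A y)) x
          = nabla ((fun y => nabla W y (A y)) + fun y => nabla W' y (A y)) x := by
      intro A hA
      apply cov_congr ((hnabla.smooth_cov hA hW).add (hnabla.smooth_cov hA hW'))
      filter_upwards [hW.eventually, hW'.eventually] with y h h'
      exact cov_add h h' _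
    unfold curvField
    rw [h1 hU, h1 hV, cov_add (hnabla.smooth_cov hU hW) (hnabla.smooth_cov hU hW'),
      cov_add (hnabla.smooth_cov hV hW) (hnabla.smooth_cov hV hW'), cov_add hW hW']
    abel
  smul f W hf hW := by
    have h1 : ∀ {A : VField n M}, SmoothVF A x →
        nabla (fun y => nabla (f • W) y (A y)) x
          = nabla (f • (fun y => nabla W y (A y)) + (fun y => mvfderiv (𝓡 n) f y (A y)) • W) x := by
      intro A hA
      apply cov_congr ((SmoothVF.smul hf (hnabla.smooth_cov hA hW)).add
        (SmoothVF.smul (hf.deriv hA) hW))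
      filter_upwards [hf.eventually, hW.eventually] with y h h'
      exact cov_smul h h' _
    have h2 : ∀ {A : VField n M}, SmoothVF A x → ∀ u : TangentSpace (𝓡 n) x,
        nabla (fun y => nabla (f • W) y (A y)) x u
          = f x • nabla (fun y => nabla W y (A y)) x u + mvfderiv (𝓡 n) f x u • nabla W x (A x)
            + (mvfderiv (𝓡 n) f x (A x) • nabla W x u
              + mvfderiv (𝓡 n) (fun y => mvfderiv (𝓡 n) f y (A y)) x u • W x) := by
      intro A hA u
      rw [h1 hA, cov_add (SmoothVF.smul hf (hnabla.smooth_cov hA hW))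
        (SmoothVF.smul (hf.deriv hA) hW), cov_smul hf (hnabla.smooth_cov hA hW),
        cov_smul (hf.deriv hA) hW]
    unfold curvField
    rw [h2 hU, h2 hV, cov_smul hf hW, mvfderiv_bracket hn hf hU hV]
    module

/-- The curvature can be computed with any smooth vector fields extending the vectors. -/
theorem curvature_field (hn : n ≠ 0) (hnabla : IsSmoothTorsionFree nabla)
    (hU : SmoothVF U x) (hV : SmoothVF V x) (hW : SmoothVF W x) :
    curvature nabla x (U x) (V x) (W x) = curvField nabla U V W x := by
  rw [curvature_eq_curvField,
    (curvField_tensorial_left hnabla (SmoothVF.ext_smooth _)).apply hU,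
    (curvField_tensorial_mid hnabla (SmoothVF.ext_smooth _)).apply hV,
    (curvField_tensorial_right hn hnabla hU hV).apply hW]

theorem curvature_trilinear (hn : n ≠ 0) (hnabla : IsSmoothTorsionFree nabla) (x : M) :
    IsTrilinear (curvature nabla x) where
  left v w := by
    simp only [curvature_eq_curvField]
    exact (curvField_tensorial_left hnabla (SmoothVF.ext_smooth w)).isLinearMap
  mid u w := by
    simp only [curvature_eq_curvField]
    exact (curvField_tensorial_mid hnabla (SmoothVF.ext_smooth w)).isLinearMap
  right u v := by
    simp only [curvature_eq_curvField]
    exact (curvField_tensorial_right hn hnabla (SmoothVF.ext_smooth u)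
      (SmoothVF.ext_smooth v)).isLinearMap

theorem curvature_smooth (hn : n ≠ 0) (hnabla : IsSmoothTorsionFree nabla)
    (hU : SmoothVF U x) (hV : SmoothVF V x) (hW : SmoothVF W x) :
    SmoothVF (fun y => curvature nabla y (U y) (V y) (W y)) x := by
  have h1 := ((hnabla.smooth_cov hU (hnabla.smooth_cov hV hW)).sub
    (hnabla.smooth_cov hV (hnabla.smooth_cov hU hW))).sub (hnabla.smooth_cov (hU.bracket hV) hW)
  refine h1.congr ?_
  filter_upwards [hU.eventually, hV.eventually, hW.eventually] with y h h' h''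
  exact curvature_field hn hnabla h h' h''

/-- The Ricci tensor can be computed in any basis. -/
theorem ricci_eq_trace (hn : n ≠ 0) (hnabla : IsSmoothTorsionFree nabla) (x : M)
    (B : Module.Basis (Fin n) ℝ (TangentSpace (𝓡 n) x)) (u v : TangentSpace (𝓡 n) x) :
    ricci nabla x u v = ∑ c, B.repr (curvature nabla x (B c) u v) c := by
  -- in every basis, the sum is the trace of the endomorphism `w ↦ R(w, u) v`
  have key : ∀ B' : Module.Basis (Fin n) ℝ (TangentSpace (𝓡 n) x),
      ∑ c, B'.repr (curvature nabla x (B' c) u v) c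
        = LinearMap.trace ℝ _ ((curvature_trilinear hn hnabla x).left u v).mk' := by
    intro B'
    rw [LinearMap.trace_eq_matrix_trace ℝ B', Matrix.trace]
    simp [LinearMap.toMatrix_apply]
  rw [key B, ← key (coordBasis x), ricci]

theorem ricci_smoothForm (hn : n ≠ 0) (hnabla : IsSmoothTorsionFree nabla) :
    SmoothForm₂ (ricci nabla) where
  bilinear x :=
    { left := fun v => by
        unfold ricci
        have h := fun c => (curvature_trilinear hn hnabla x).mid (coordBasis x c) v
        exact ⟨fun u u' => by simp [(h _).map_add, Finset.sum_add_distrib],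
          fun c u => by simp [(h _).map_smul, Finset.mul_sum]⟩
      right := fun u => by
        unfold ricci
        have h := fun c => (curvature_trilinear hn hnabla x).right (coordBasis x c) u
        exact ⟨fun u u' => by simp [(h _).map_add, Finset.sum_add_distrib],
          fun c u => by simp [(h _).map_smul, Finset.mul_sum]⟩ }
  smooth {x V W} hV hW := by
    obtain ⟨B, hB, hc⟩ := exists_smooth_frame (n := n) x
    simp only [fun y => ricci_eq_trace hn hnabla y (B y)]
    exact SmoothFn.sum _ fun c _ => hc _ (curvature_smooth hn hnabla (hB c) hV hW) c

/-! ### The Schouten, Weyl and Cotton tensors and the invariants are smooth tensors -/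

theorem schouten_smoothForm (hn : n ≠ 0) (hnabla : IsSmoothTorsionFree nabla) :
    SmoothForm₂ (schouten nabla) := by
  have h := ricci_smoothForm hn hnabla
  have h1 := ((h.const_mul n).add h.swap).const_mul ((n : ℝ) ^ 2 - 1)⁻¹
  have h2 : schouten nabla = fun (x : M) u v =>
      ((n : ℝ) ^ 2 - 1)⁻¹ * (n * ricci nabla x u v + ricci nabla x v u) := by
    ext x u v
    rw [schouten, div_eq_inv_mul]
  rwa [h2]

theorem beta_smoothForm (hn : n ≠ 0) (hnabla : IsSmoothTorsionFree nabla) :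
    SmoothForm₂ (beta nabla) := by
  have h := schouten_smoothForm hn hnabla
  have h1 := h.swap.add (h.const_mul (-1))
  have h2 : beta nabla = fun (x : M) u v =>
      schouten nabla x v u + -1 * schouten nabla x u v := by
    ext x u v
    rw [beta]
    ring
  rwa [h2]

theorem weyl_trilinear (hn : n ≠ 0) (hnabla : IsSmoothTorsionFree nabla) (x : M) :
    IsTrilinear (weyl nabla x) := by
  have hR := curvature_trilinear hn hnabla x
  have hP := (schouten_smoothForm hn hnabla).bilinear x
  have hb := (beta_smoothForm hn hnabla).bilinear x
  refine ⟨fun v w => ⟨fun u u' => ?_, fun c u => ?_⟩, fun u w => ⟨fun v v' => ?_, fun c v => ?_⟩,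
    fun u v => ⟨fun w w' => ?_, fun c w => ?_⟩⟩ <;> unfold weyl
  · rw [(hR.left v w).map_add, (hP.left w).map_add, (hb.left v).map_add]; module
  · rw [(hR.left v w).map_smul, (hP.left w).map_smul, (hb.left v).map_smul]; module
  · rw [(hR.mid u w).map_add, (hP.left w).map_add, (hb.right u).map_add]; module
  · rw [(hR.mid u w).map_smul, (hP.left w).map_smul, (hb.right u).map_smul]; module
  · rw [(hR.right u v).map_add, (hP.right v).map_add, (hP.right u).map_add]; module
  · rw [(hR.right u v).map_smul, (hP.right v).map_smul, (hP.right u).map_smul]; module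

theorem weyl_smooth (hn : n ≠ 0) (hnabla : IsSmoothTorsionFree nabla)
    (hU : SmoothVF U x) (hV : SmoothVF V x) (hW : SmoothVF W x) :
    SmoothVF (fun y => weyl nabla y (U y) (V y) (W y)) x := by
  have hP := schouten_smoothForm hn hnabla
  exact (((curvature_smooth hn hnabla hU hV hW).sub (SmoothVF.smul (hP.smooth hV hW) hU)).add
    (SmoothVF.smul (hP.smooth hU hW) hV)).sub
    (SmoothVF.smul ((beta_smoothForm hn hnabla).smooth hU hV) hW)

theorem cotton_smoothForm (hn : n ≠ 0) (hnabla : IsSmoothTorsionFree nabla) :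
    SmoothForm₃ (cotton nabla) := by
  have h := (schouten_smoothForm hn hnabla).covDeriv hnabla
  constructor
  · intro x
    have ht := h.trilinear x
    exact ⟨fun u v => ((ht.right u v).mk' - (ht.right v u).mk').isLinear,
      fun w v => ((ht.left v w).mk' - (ht.mid v w).mk').isLinear,
      fun w u => ((ht.mid u w).mk' - (ht.left u w).mk').isLinear⟩
  · intro x W U V hW hU hV
    exact (h.smooth hU hV hW).sub (h.smooth hV hU hW)

/-- The 1-form `D^{ab}_i^c C_{cab}` in any basis. -/
theorem DC_eq (hn : n ≠ 0) (hnabla : IsSmoothTorsionFree nabla) (q : Input n) (x : M)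
    (B : Module.Basis (Fin n) ℝ (TangentSpace (𝓡 n) x)) (v : TangentSpace (𝓡 n) x) :
    DC q nabla x v = ∑ b₁, ∑ b₂, ∑ i, ∑ k, Dcomp q (components B (weyl nabla x)) b₁ b₂ i k *
      B.repr v i * cotton nabla x (B k) (B b₁) (B b₂) := by
  unfold DC DQ
  rw [Dtensor_basis (weyl_trilinear hn hnabla x) q B (coordBasis x)]
  exact sum_Dtensor_coord_mul q B (coordBasis x) _ ((cotton_smoothForm hn hnabla).trilinear x) v

theorem DC_smoothForm (hn : n ≠ 0) (hnabla : IsSmoothTorsionFree nabla) (q : Input n)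
    (hQ : ∀ x, normQ q nabla x ≠ 0) : SmoothForm₁ (DC q nabla) where
  linear x := by
    rw [funext (DC_eq hn hnabla q x (coordBasis x))]
    constructor
    · intro v w
      simp only [map_add, Finsupp.add_apply, ← Finset.sum_add_distrib]
      refine Finset.sum_congr rfl fun _ _ => Finset.sum_congr rfl fun _ _ =>
        Finset.sum_congr rfl fun _ _ => Finset.sum_congr rfl fun _ _ => ?_
      ring
    · intro c v
      simp only [map_smul, Finsupp.smul_apply, smul_eq_mul, Finset.mul_sum]
      refine Finset.sum_congr rfl fun _ _ => Finset.sum_congr rfl fun _ _ =>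
        Finset.sum_congr rfl fun _ _ => Finset.sum_congr rfl fun _ _ => ?_
      ring
  smooth {x V} hV := by
    obtain ⟨B, hB, hc⟩ := exists_smooth_frame (n := n) x
    -- near `x`, the components of `D` in a smooth frame are rational functions of those of `W`
    simp only [fun y => DC_eq hn hnabla q y (B y)]
    refine SmoothFn.sum _ fun b₁ _ => SmoothFn.sum _ fun b₂ _ => SmoothFn.sum _ fun i _ =>
      SmoothFn.sum _ fun k _ => ?_
    refine ((Dcomp_smoothFn (fun a b c d => ?_) q ?_ b₁ b₂ i k).mul (hc V hV i)).mul
      ((cotton_smoothForm hn hnabla).smooth (hB k) (hB b₁) (hB b₂))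
    · exact hc _ (weyl_smooth hn hnabla (hB a) (hB b) (hB d)) c
    · exact detQ_ne_zero_of_basis (weyl_trilinear hn hnabla x) q (coordBasis x) (B x) (hQ x)

theorem GQ_smoothForm (hn : n ≠ 0) (hnabla : IsSmoothTorsionFree nabla) (q : Input n)
    (hQ : ∀ x, normQ q nabla x ≠ 0) : SmoothForm₂ (GQ q nabla) :=
  ((schouten_smoothForm hn hnabla).add ((DC_smoothForm hn hnabla q hQ).covDeriv hnabla)).add
    ((DC_smoothForm hn hnabla q hQ).mul (DC_smoothForm hn hnabla q hQ))

end Tensoriality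

/-! ### Projective changes of connection -/

section ProjectiveChange

open scoped Topology
open Filter

variable {n : ℕ} {M : Type*} [TopologicalSpace M] [ChartedSpace (EuclideanSpace ℝ (Fin n)) M]
  [IsManifold (𝓡 n) ∞ M] {nabla nabla' : AffineConnection n M}
  {Υ : (x : M) → TangentSpace (𝓡 n) x → ℝ}

/-- `∇'` arises from `∇` by the projective change with the smooth 1-form `Υ`. -/
structure IsProjectiveChange (nabla nabla' : AffineConnection n M)
    (Υ : (x : M) → TangentSpace (𝓡 n) x → ℝ) : Prop where
  form : SmoothForm₁ Υ
  cov {x : M} {V : VField n M} (hV : SmoothVF V x) (u : TangentSpace (𝓡 n) x) :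
    nabla' V x u = nabla V x u + Υ x u • V x + Υ x (V x) • u

theorem ProjectivelyEquivalent.exists_isProjectiveChange (h : ProjectivelyEquivalent nabla nabla') :
    ∃ Υ, IsProjectiveChange nabla nabla' Υ := by
  obtain ⟨Υ, hΥ, h⟩ := h
  refine ⟨fun x v => Υ x v, ⟨⟨fun x => (Υ x).toLinearMap.isLinear, fun {x V} hV => ?_⟩,
    fun {x V} hV u => h x V hV.mdiff u⟩⟩
  filter_upwards [hV] with y hy
  have h1 := ContMDiffAt.clm_bundle_apply (F₁ := EuclideanSpace ℝ (Fin n)) (F₂ := ℝ)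
    (E₁ := fun x : M => TangentSpace (𝓡 n) x) (E₂ := fun _ : M => ℝ) (b := fun y : M => y)
    (ϕ := fun y => Υ y) (v := V) (hΥ y) hy
  exact (contMDiffAt_section _).1 h1

/-- The Ricci identity: the alternation of the second covariant derivative of a 1-form is given by
the curvature. -/
theorem SmoothForm₁.covDeriv₂_sub_swap [T2Space M] (hn : n ≠ 0)
    {θ : (x : M) → TangentSpace (𝓡 n) x → ℝ}
    (hθ : SmoothForm₁ θ) (hnabla : IsSmoothTorsionFree nabla) (x : M)
    (u v w : TangentSpace (𝓡 n) x) :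
    covDeriv₂ nabla (covDeriv₁ nabla θ) x u v w - covDeriv₂ nabla (covDeriv₁ nabla θ) x v u w
      = -θ x (curvature nabla x u v w) := by
  have hU := SmoothVF.ext_smooth u
  have hV := SmoothVF.ext_smooth v
  have hW := SmoothVF.ext_smooth w
  -- expand `(∇²θ)(A, B, w)`, the value of `∇θ` at `∇_A W` being computed with the field `∇_A W`
  have key : ∀ {A B : VField n M}, SmoothVF A x → SmoothVF B x →
      covDeriv₂ nabla (covDeriv₁ nabla θ) x (A x) (B x) w =
        mvfderiv (𝓡 n) (fun y => mvfderiv (𝓡 n) (fun z => θ z (ext w z)) y (B y)) x (A x)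
          - mvfderiv (𝓡 n) (fun y => θ y (nabla (ext w) y (B y))) x (A x)
          - covDeriv₁ nabla θ x (nabla B x (A x)) w
          - (mvfderiv (𝓡 n) (fun y => θ y (nabla (ext w) y (A y))) x (B x)
            - θ x (nabla (fun y => nabla (ext w) y (A y)) x (B x))) := by
    intro A B hA hB
    have h1 := (hθ.covDeriv hnabla).covDeriv_field nabla (A x) hB hW
    rw [ext_self] at h1
    have h2 : mvfderiv (𝓡 n) (fun y => covDeriv₁ nabla θ y (B y) (ext w y)) x
        = mvfderiv (𝓡 n) (fun y => mvfderiv (𝓡 n) (fun z => θ z (ext w z)) y (B y)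
          - θ y (nabla (ext w) y (B y))) x := by
      apply mvfderiv_congr
      filter_upwards [hW.eventually] with y hy
      exact hθ.covDeriv_field nabla (B y) hy
    rw [h1, h2, mvfderiv_sub_apply ((hθ.smooth hW).deriv hB)
      (hθ.smooth (hnabla.smooth_cov hB hW)),
      hθ.covDeriv_field nabla (B x) (hnabla.smooth_cov hA hW)]
  have k1 := key hU hV
  have k2 := key hV hU
  have hb := hnabla.bracket hU hV
  have hm := mvfderiv_bracket hn (hθ.smooth hW) hU hV
  have hl := ((hθ.covDeriv hnabla).bilinear x).left w
  have h3 := hl.map_sub (nabla (ext v) x u) (nabla (ext u) x v)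
  simp only [ext_self] at k1 k2 hb hm
  rw [← hb, covDeriv₁, hm] at h3
  rw [k1, k2, curvature, (hθ.linear x).map_sub, (hθ.linear x).map_sub]
  linarith

namespace IsProjectiveChange

theorem covDeriv₁_eq (h : IsProjectiveChange nabla nabla' Υ)
    {θ : (x : M) → TangentSpace (𝓡 n) x → ℝ} (hθ : ∀ x, IsLinearMap ℝ (θ x)) (x : M)
    (u v : TangentSpace (𝓡 n) x) :
    covDeriv₁ nabla' θ x u v = covDeriv₁ nabla θ x u v - Υ x u * θ x v - Υ x v * θ x u := by
  unfold covDeriv₁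
  rw [h.cov (SmoothVF.ext_smooth v), ext_self, (hθ x).map_add, (hθ x).map_add, (hθ x).map_smul,
    (hθ x).map_smul, smul_eq_mul, smul_eq_mul]
  ring

theorem covDeriv₂_eq (h : IsProjectiveChange nabla nabla' Υ)
    {T : (x : M) → TangentSpace (𝓡 n) x → TangentSpace (𝓡 n) x → ℝ}
    (hT : ∀ x, IsBilinear (T x)) (x : M) (u v w : TangentSpace (𝓡 n) x) :
    covDeriv₂ nabla' T x u v w = covDeriv₂ nabla T x u v w - 2 * Υ x u * T x v w
      - Υ x v * T x u w - Υ x w * T x v u := by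
  unfold covDeriv₂
  have hl := fun w => (hT x).left w
  have hr := fun v => (hT x).right v
  rw [h.cov (SmoothVF.ext_smooth v), h.cov (SmoothVF.ext_smooth w), ext_self, ext_self,
    (hl w).map_add, (hl w).map_add, (hl w).map_smul, (hl w).map_smul,
    (hr v).map_add, (hr v).map_add, (hr v).map_smul, (hr v).map_smul]
  simp only [smul_eq_mul]
  ring

/-- The tensor `S = ∇Υ - Υ ⊗ Υ` by which the projective Schouten tensor changes. -/
def schoutenChange (nabla : AffineConnection n M) (Υ : (x : M) → TangentSpace (𝓡 n) x → ℝ)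
    (x : M) (u v : TangentSpace (𝓡 n) x) : ℝ :=
  covDeriv₁ nabla Υ x u v - Υ x u * Υ x v

variable [T2Space M]

theorem schoutenChange_smoothForm (h : IsProjectiveChange nabla nabla' Υ)
    (hnabla : IsSmoothTorsionFree nabla) : SmoothForm₂ (schoutenChange nabla Υ) := by
  have h1 := (h.form.covDeriv hnabla).add ((h.form.mul h.form).const_mul (-1))
  have h2 : schoutenChange nabla Υ = fun x u v => covDeriv₁ nabla Υ x u v + -1 * (Υ x u * Υ x v) := by
    ext x u v
    rw [schoutenChange]
    ring
  rwa [h2]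

/-- The curvature changes by `(S(u, v) - S(v, u)) w + S(u, w) v - S(v, w) u`. -/
theorem curvature_eq (h : IsProjectiveChange nabla nabla' Υ)
    (hnabla : IsSmoothTorsionFree nabla) (x : M) (u v w : TangentSpace (𝓡 n) x) :
    curvature nabla' x u v w = curvature nabla x u v w
      + (schoutenChange nabla Υ x u v - schoutenChange nabla Υ x v u) • w
      + schoutenChange nabla Υ x u w • v - schoutenChange nabla Υ x v w • u := by
  have hU := SmoothVF.ext_smooth u
  have hV := SmoothVF.ext_smooth v
  have hW := SmoothVF.ext_smooth w
  have hl := h.form.linear x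
  -- the iterated covariant derivatives `∇'_a ∇'_B W` in terms of `∇`
  have key : ∀ {B : VField n M}, SmoothVF B x → ∀ a : TangentSpace (𝓡 n) x,
      nabla' (fun y => nabla' (ext w) y (B y)) x a =
        nabla (fun y => nabla (ext w) y (B y)) x a + Υ x (B x) • nabla (ext w) x a
          + mvfderiv (𝓡 n) (fun y => Υ y (B y)) x a • w
          + Υ x w • nabla B x a + mvfderiv (𝓡 n) (fun y => Υ y (ext w y)) x a • B x
          + Υ x a • (nabla (ext w) x (B x) + Υ x (B x) • w + Υ x w • B x)
          + (Υ x (nabla (ext w) x (B x)) + 2 * Υ x (B x) * Υ x w) • a := by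
    intro B hB a
    have s1 : SmoothVF (fun y => nabla (ext w) y (B y)) x := hnabla.smooth_cov hB hW
    have s2 : SmoothVF ((fun y => Υ y (B y)) • ext w) x := SmoothVF.smul (h.form.smooth hB) hW
    have s3 : SmoothVF ((fun y => Υ y (ext w y)) • B) x := SmoothVF.smul (h.form.smooth hW) hB
    have h1 : nabla' (fun y => nabla' (ext w) y (B y)) x = nabla' ((fun y => nabla (ext w) y (B y))
        + ((fun y => Υ y (B y)) • ext w) + (fun y => Υ y (ext w y)) • B) x := by
      apply cov_congr ((s1.add s2).add s3)
      filter_upwards [hW.eventually] with y hy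
      exact h.cov hy (B y)
    rw [h1, h.cov ((s1.add s2).add s3), cov_add (s1.add s2) s3, cov_add s1 s2,
      cov_smul (h.form.smooth hB) hW, cov_smul (h.form.smooth hW) hB]
    simp only [Pi.add_apply, Pi.smul_apply', ext_self, hl.map_add, hl.map_smul, smul_eq_mul]
    module
  have k1 := key hV u
  have k2 := key hU v
  have hb := hnabla.bracket hU hV
  simp only [ext_self] at k1 k2 hb
  unfold curvature schoutenChange covDeriv₁
  rw [k1, k2, h.cov hW, hb, ext_self, hl.map_sub, map_sub]
  module

theorem ricci_eq (h : IsProjectiveChange nabla nabla' Υ)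
    (hnabla : IsSmoothTorsionFree nabla) (x : M) (u v : TangentSpace (𝓡 n) x) :
    ricci nabla' x u v = ricci nabla x u v + schoutenChange nabla Υ x v u
      - n * schoutenChange nabla Υ x u v := by
  have hS := (h.schoutenChange_smoothForm hnabla).bilinear x
  have e1 : ∀ (f : TangentSpace (𝓡 n) x → ℝ), IsLinearMap ℝ f → ∀ v : TangentSpace (𝓡 n) x,
      ∑ c, f (coordBasis x c) * (coordBasis x).repr v c = f v := by
    intro f hf v
    have := congrArg hf.mk' ((coordBasis x).sum_repr v)
    rw [map_sum] at this
    simp only [map_smul, IsLinearMap.mk'_apply, smul_eq_mul] at this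
    rw [← this]
    exact Finset.sum_congr rfl fun c _ => mul_comm _ _
  unfold ricci
  simp only [h.curvature_eq hnabla, map_add, map_sub, map_smul, Finsupp.add_apply,
    Finsupp.sub_apply, Finsupp.smul_apply, smul_eq_mul, Finset.sum_add_distrib,
    Finset.sum_sub_distrib, sub_mul, Module.Basis.repr_self, Finsupp.single_eq_same, mul_one,
    Finset.sum_const, Finset.card_univ, Fintype.card_fin, nsmul_eq_mul]
  rw [e1 _ (hS.left u), e1 _ (hS.right u), e1 _ (hS.left v)]
  ring

/-- The projective Schouten tensor changes by `-S`. -/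
theorem schouten_eq (hn : 2 ≤ n) (h : IsProjectiveChange nabla nabla' Υ)
    (hnabla : IsSmoothTorsionFree nabla) (x : M) (u v : TangentSpace (𝓡 n) x) :
    schouten nabla' x u v = schouten nabla x u v - schoutenChange nabla Υ x u v := by
  have hn' : (2 : ℝ) ≤ n := by exact_mod_cast hn
  have h0 : (n : ℝ) ^ 2 - 1 ≠ 0 := by nlinarith
  unfold schouten
  rw [h.ricci_eq hnabla, h.ricci_eq hnabla]
  field_simp
  ring

/-- The projective Weyl tensor is projectively invariant. -/
theorem weyl_eq (hn : 2 ≤ n) (h : IsProjectiveChange nabla nabla' Υ)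
    (hnabla : IsSmoothTorsionFree nabla) : weyl nabla' = weyl nabla := by
  ext1 x; ext1 u; ext1 v; ext1 w
  unfold weyl beta
  simp only [h.curvature_eq hnabla, h.schouten_eq hn hnabla]
  module

/-- The Cotton tensor changes by `Υ ∘ W`. -/
theorem cotton_eq (hn : 2 ≤ n) (h : IsProjectiveChange nabla nabla' Υ)
    (hnabla : IsSmoothTorsionFree nabla) (x : M) (w u v : TangentSpace (𝓡 n) x) :
    cotton nabla' x w u v = cotton nabla x w u v + Υ x (weyl nabla x u v w) := by
  have hn0 : n ≠ 0 := by omega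
  have hP := schouten_smoothForm hn0 hnabla
  have hS := h.schoutenChange_smoothForm hnabla
  have hl := h.form.linear x
  have hP' : schouten nabla' = fun x u v =>
      schouten nabla x u v + -1 * schoutenChange nabla Υ x u v := by
    ext x u v
    rw [h.schouten_eq hn hnabla]
    ring
  have hT := hP.add (hS.const_mul (-1))
  have dP : ∀ u v w : TangentSpace (𝓡 n) x,
      covDeriv₂ nabla (fun x u v => schouten nabla x u v + -1 * schoutenChange nabla Υ x u v)
        x u v w = covDeriv₂ nabla (schouten nabla) x u v w
          - covDeriv₂ nabla (schoutenChange nabla Υ) x u v w := by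
    intro u v w
    have hV := SmoothVF.ext_smooth v
    have hW := SmoothVF.ext_smooth w
    unfold covDeriv₂
    rw [mvfderiv_add_apply (hP.smooth hV hW) ((SmoothFn.const _).mul (hS.smooth hV hW)),
      mvfderiv_mul_apply (SmoothFn.const _) (hS.smooth hV hW), mvfderiv_const_apply]
    ring
  have dS : ∀ u v w : TangentSpace (𝓡 n) x,
      covDeriv₂ nabla (schoutenChange nabla Υ) x u v w
        = covDeriv₂ nabla (covDeriv₁ nabla Υ) x u v w - covDeriv₁ nabla Υ x u v * Υ x w
          - Υ x v * covDeriv₁ nabla Υ x u w := by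
    intro u v w
    have hV := SmoothVF.ext_smooth v
    have hW := SmoothVF.ext_smooth w
    unfold covDeriv₂ schoutenChange
    rw [mvfderiv_sub_apply ((h.form.covDeriv hnabla).smooth hV hW)
      ((h.form.smooth hV).mul (h.form.smooth hW)),
      mvfderiv_mul_apply (h.form.smooth hV) (h.form.smooth hW)]
    unfold covDeriv₁
    simp only [ext_self]
    ring
  have hR := h.form.covDeriv₂_sub_swap hn0 hnabla x u v w
  have hW : Υ x (weyl nabla x u v w) = Υ x (curvature nabla x u v w)
      - schouten nabla x v w * Υ x u + schouten nabla x u w * Υ x v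
      - (schouten nabla x v u - schouten nabla x u v) * Υ x w := by
    unfold weyl beta
    rw [hl.map_sub, hl.map_add, hl.map_sub, hl.map_smul, hl.map_smul, hl.map_smul]
    simp only [smul_eq_mul]
  unfold cotton
  rw [hP', h.covDeriv₂_eq hT.bilinear, h.covDeriv₂_eq hT.bilinear, dP, dP, dS, dS, hW]
  unfold schoutenChange
  linear_combination (-1) * hR

theorem DQ_eq (hn : 2 ≤ n) (h : IsProjectiveChange nabla nabla' Υ)
    (hnabla : IsSmoothTorsionFree nabla) (q : Input n) : DQ q nabla' = DQ q nabla := by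
  unfold DQ
  rw [h.weyl_eq hn hnabla]

theorem normQ_eq (hn : 2 ≤ n) (h : IsProjectiveChange nabla nabla' Υ)
    (hnabla : IsSmoothTorsionFree nabla) (q : Input n) : normQ q nabla' = normQ q nabla := by
  unfold normQ
  rw [h.weyl_eq hn hnabla]

/-- Since `D` inverts `W`, the 1-form `D^{ab}_i^c C_{cab}` changes by `Υ`. -/
theorem DC_eq (hn : 2 ≤ n) (h : IsProjectiveChange nabla nabla' Υ)
    (hnabla : IsSmoothTorsionFree nabla) (q : Input n) (hQ : ∀ x, normQ q nabla x ≠ 0) (x : M)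
    (v : TangentSpace (𝓡 n) x) : DC q nabla' x v = DC q nabla x v + Υ x v := by
  have h1 := sum_Dtensor_coord_mul_self (weyl_trilinear (by omega) hnabla x) q (coordBasis x)
    (coordBasis x) (hQ x) v (h.form.linear x).mk'
  unfold DC
  rw [h.DQ_eq hn hnabla]
  simp only [h.cotton_eq hn hnabla, mul_add, Finset.sum_add_distrib]
  congr 1

theorem GQ_eq (hn : 2 ≤ n) (h : IsProjectiveChange nabla nabla' Υ)
    (hnabla : IsSmoothTorsionFree nabla) (q : Input n) (hQ : ∀ x, normQ q nabla x ≠ 0) :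
    GQ q nabla' = GQ q nabla := by
  ext x u v
  have hD := DC_smoothForm (by omega) hnabla q hQ
  have hD' : DC q nabla' = fun x v => DC q nabla x v + Υ x v := by
    ext x v
    exact h.DC_eq hn hnabla q hQ x v
  have hV := SmoothVF.ext_smooth v
  have hl : ∀ x, IsLinearMap ℝ fun v => DC q nabla x v + Υ x v := fun x =>
    ((hD.linear x).mk' + (h.form.linear x).mk').isLinear
  have h1 : covDeriv₁ nabla (fun x v => DC q nabla x v + Υ x v) x u v
      = covDeriv₁ nabla (DC q nabla) x u v + covDeriv₁ nabla Υ x u v := by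
    unfold covDeriv₁
    rw [mvfderiv_add_apply (hD.smooth hV) (h.form.smooth hV)]
    ring
  unfold GQ
  rw [hD', h.covDeriv₁_eq hl, h1, h.schouten_eq hn hnabla]
  unfold schoutenChange
  ring

theorem EQ_eq (hn : 2 ≤ n) (h : IsProjectiveChange nabla nabla' Υ)
    (hnabla : IsSmoothTorsionFree nabla) (q : Input n) (hQ : ∀ x, normQ q nabla x ≠ 0) :
    EQ q nabla' = EQ q nabla := by
  ext x u v w
  unfold EQ
  rw [h.GQ_eq hn hnabla q hQ,
    h.covDeriv₂_eq (GQ_smoothForm (by omega) hnabla q hQ).bilinear]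
  simp only [h.DC_eq hn hnabla q hQ]
  ring

theorem gammaQ_eq (hn : 2 ≤ n) (h : IsProjectiveChange nabla nabla' Υ)
    (hnabla : IsSmoothTorsionFree nabla) (q : Input n) (hQ : ∀ x, normQ q nabla x ≠ 0) :
    gammaQ q nabla' = gammaQ q nabla := by
  unfold gammaQ
  rw [h.GQ_eq hn hnabla q hQ]

end IsProjectiveChange

end ProjectiveChange

/-! ### Naturality under local diffeomorphisms -/

section Naturality

open scoped Topology
open Filter

variable {n : ℕ} {M : Type*} [TopologicalSpace M] [ChartedSpace (EuclideanSpace ℝ (Fin n)) M]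
  [IsManifold (𝓡 n) ∞ M] {M' : Type*} [TopologicalSpace M']
  [ChartedSpace (EuclideanSpace ℝ (Fin n)) M'] [IsManifold (𝓡 n) ∞ M']
  {φ : M' → M} {nabla : AffineConnection n M} {nabla' : AffineConnection n M'}

namespace IsAffineLocalDiffeo

/-- The differential of a local diffeomorphism as a linear equivalence. -/
def tangentEquiv (h : IsAffineLocalDiffeo nabla' nabla φ) (x : M') :
    TangentSpace (𝓡 n) x ≃ₗ[ℝ] TangentSpace (𝓡 n) (φ x) :=
  (h.1.mfderivToContinuousLinearEquiv (by simp) x).toLinearEquiv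

theorem tangentEquiv_apply (h : IsAffineLocalDiffeo nabla' nabla φ) (x : M')
    (v : TangentSpace (𝓡 n) x) : h.tangentEquiv x v = mfderiv (𝓡 n) (𝓡 n) φ x v := by
  rw [← h.1.mfderivToContinuousLinearEquiv_coe (by simp) x]
  rfl

theorem tangentEquiv_toLinearMap (h : IsAffineLocalDiffeo nabla' nabla φ) (x : M') :
    (h.tangentEquiv x).toLinearMap = (mfderiv (𝓡 n) (𝓡 n) φ x).toLinearMap :=
  LinearMap.ext fun v => h.tangentEquiv_apply x v

theorem mfderiv_injective (h : IsAffineLocalDiffeo nabla' nabla φ) (x : M') :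
    Function.Injective (mfderiv (𝓡 n) (𝓡 n) φ x) := by
  intro u v huv
  rw [← h.tangentEquiv_apply, ← h.tangentEquiv_apply] at huv
  exact (h.tangentEquiv x).injective huv

theorem continuousAt (h : IsAffineLocalDiffeo nabla' nabla φ) (x : M') : ContinuousAt φ x :=
  h.1.contMDiff.continuous.continuousAt

/-- Smooth vector fields can be pulled back. -/
theorem exists_related (h : IsAffineLocalDiffeo nabla' nabla φ) {x : M'} {V : VField n M}
    (hV : SmoothVF V (φ x)) :
    ∃ V' : VField n M', SmoothVF V' x ∧ ∀ y, mfderiv (𝓡 n) (𝓡 n) φ y (V' y) = V (φ y) := by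
  have hinv : ∀ y, (mfderiv (𝓡 n) (𝓡 n) φ y).IsInvertible := fun y =>
    ⟨h.1.mfderivToContinuousLinearEquiv (by simp) y,
      h.1.mfderivToContinuousLinearEquiv_coe (by simp) y⟩
  refine ⟨VectorField.mpullback (𝓡 n) (𝓡 n) φ V, ?_, fun y => ?_⟩
  · filter_upwards [(h.continuousAt x).eventually hV] with y hy
    exact ContMDiffAt.mpullback_vectorField_preimage hy (h.1.contMDiff y) (hinv y) (by simp)
  · obtain ⟨e, he⟩ := hinv y
    rw [VectorField.mpullback_apply, ← he]
    simp

/-- Covariant derivatives of related fields are related. -/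
theorem cov_related (h : IsAffineLocalDiffeo nabla' nabla φ) {x : M'} {V : VField n M}
    {V' : VField n M'} (hV : SmoothVF V (φ x)) (hV' : SmoothVF V' x)
    (hr : ∀ᶠ y in 𝓝 x, mfderiv (𝓡 n) (𝓡 n) φ y (V' y) = V (φ y)) (u : TangentSpace (𝓡 n) x) :
    mfderiv (𝓡 n) (𝓡 n) φ x (nabla' V' x u) = nabla V (φ x) (mfderiv (𝓡 n) (𝓡 n) φ x u) :=
  h.2 x V' V hV'.mdiff hV.mdiff hr u

theorem mvfderiv_comp (h : IsAffineLocalDiffeo nabla' nabla φ) {x : M'} {f : M → ℝ}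
    (hf : SmoothFn (n := n) f (φ x)) (u : TangentSpace (𝓡 n) x) :
    mvfderiv (𝓡 n) (fun y => f (φ y)) x u
      = mvfderiv (𝓡 n) f (φ x) (mfderiv (𝓡 n) (𝓡 n) φ x u) :=
  mvfderiv_comp_apply x hf.mdiff ((h.1.contMDiff x).mdifferentiableAt (by simp)) u

theorem covDeriv₁_eq (h : IsAffineLocalDiffeo nabla' nabla φ)
    {θ : (x : M) → TangentSpace (𝓡 n) x → ℝ} {θ' : (x : M') → TangentSpace (𝓡 n) x → ℝ}
    (hθ : SmoothForm₁ θ) (hθ' : SmoothForm₁ θ')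
    (hr : ∀ x v, θ' x v = θ (φ x) (mfderiv (𝓡 n) (𝓡 n) φ x v)) (x : M')
    (u v : TangentSpace (𝓡 n) x) :
    covDeriv₁ nabla' θ' x u v = covDeriv₁ nabla θ (φ x) (mfderiv (𝓡 n) (𝓡 n) φ x u)
      (mfderiv (𝓡 n) (𝓡 n) φ x v) := by
  have hV := SmoothVF.ext_smooth (mfderiv (𝓡 n) (𝓡 n) φ x v)
  obtain ⟨V', hV', hVV⟩ := h.exists_related hV
  have hv : V' x = v := h.mfderiv_injective x (by rw [hVV, ext_self])
  have h1 := hθ'.covDeriv_field nabla' u hV'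
  simp only [hr, hVV] at h1
  rw [hv] at h1
  rw [h1, h.mvfderiv_comp (hθ.smooth hV), h.cov_related hV hV' (Eventually.of_forall hVV)]
  rfl

theorem covDeriv₂_eq (h : IsAffineLocalDiffeo nabla' nabla φ)
    {T : (x : M) → TangentSpace (𝓡 n) x → TangentSpace (𝓡 n) x → ℝ}
    {T' : (x : M') → TangentSpace (𝓡 n) x → TangentSpace (𝓡 n) x → ℝ}
    (hT : SmoothForm₂ T) (hT' : SmoothForm₂ T')
    (hr : ∀ x v w, T' x v w = T (φ x) (mfderiv (𝓡 n) (𝓡 n) φ x v) (mfderiv (𝓡 n) (𝓡 n) φ x w))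
    (x : M') (u v w : TangentSpace (𝓡 n) x) :
    covDeriv₂ nabla' T' x u v w = covDeriv₂ nabla T (φ x) (mfderiv (𝓡 n) (𝓡 n) φ x u)
      (mfderiv (𝓡 n) (𝓡 n) φ x v) (mfderiv (𝓡 n) (𝓡 n) φ x w) := by
  have hV := SmoothVF.ext_smooth (mfderiv (𝓡 n) (𝓡 n) φ x v)
  have hW := SmoothVF.ext_smooth (mfderiv (𝓡 n) (𝓡 n) φ x w)
  obtain ⟨V', hV', hVV⟩ := h.exists_related hV
  obtain ⟨W', hW', hWW⟩ := h.exists_related hW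
  have hv : V' x = v := h.mfderiv_injective x (by rw [hVV, ext_self])
  have hw : W' x = w := h.mfderiv_injective x (by rw [hWW, ext_self])
  have h1 := hT'.covDeriv_field nabla' u hV' hW'
  simp only [hr, hVV, hWW] at h1
  rw [hv, hw] at h1
  rw [h1, h.mvfderiv_comp (hT.smooth hV hW), h.cov_related hV hV' (Eventually.of_forall hVV),
    h.cov_related hW hW' (Eventually.of_forall hWW), ext_self, ext_self]
  rfl

variable [T2Space M] [T2Space M']

theorem curvature_eq (hn : n ≠ 0) (h : IsAffineLocalDiffeo nabla' nabla φ)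
    (hnabla : IsSmoothTorsionFree nabla) (hnabla' : IsSmoothTorsionFree nabla') (x : M')
    (u v w : TangentSpace (𝓡 n) x) :
    mfderiv (𝓡 n) (𝓡 n) φ x (curvature nabla' x u v w)
      = curvature nabla (φ x) (mfderiv (𝓡 n) (𝓡 n) φ x u) (mfderiv (𝓡 n) (𝓡 n) φ x v)
        (mfderiv (𝓡 n) (𝓡 n) φ x w) := by
  have hU := SmoothVF.ext_smooth (mfderiv (𝓡 n) (𝓡 n) φ x u)
  have hV := SmoothVF.ext_smooth (mfderiv (𝓡 n) (𝓡 n) φ x v)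
  have hW := SmoothVF.ext_smooth (mfderiv (𝓡 n) (𝓡 n) φ x w)
  obtain ⟨U', hU', hUU⟩ := h.exists_related hU
  obtain ⟨V', hV', hVV⟩ := h.exists_related hV
  obtain ⟨W', hW', hWW⟩ := h.exists_related hW
  have hu : U' x = u := h.mfderiv_injective x (by rw [hUU, ext_self])
  have hv : V' x = v := h.mfderiv_injective x (by rw [hVV, ext_self])
  have hw : W' x = w := h.mfderiv_injective x (by rw [hWW, ext_self])
  -- iterated covariant derivatives of related fields are related
  have key : ∀ {A : VField n M} {A' : VField n M'}, SmoothVF A (φ x) → SmoothVF A' x →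
      (∀ y, mfderiv (𝓡 n) (𝓡 n) φ y (A' y) = A (φ y)) → ∀ a : TangentSpace (𝓡 n) x,
      mfderiv (𝓡 n) (𝓡 n) φ x (nabla' (fun y => nabla' W' y (A' y)) x a)
        = nabla (fun y => nabla (ext (mfderiv (𝓡 n) (𝓡 n) φ x w)) y (A y)) (φ x)
          (mfderiv (𝓡 n) (𝓡 n) φ x a) := by
    intro A A' hA hA' hAA a
    refine h.cov_related (hnabla.smooth_cov hA hW) (hnabla'.smooth_cov hA' hW') ?_ a
    filter_upwards [hW'.eventually, (h.continuousAt x).eventually hW.eventually] with y hy hy'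
    rw [h.cov_related hy' hy (Eventually.of_forall hWW), hAA]
  have hb : mfderiv (𝓡 n) (𝓡 n) φ x (VectorField.mlieBracket (𝓡 n) U' V' x)
      = VectorField.mlieBracket (𝓡 n) (ext (mfderiv (𝓡 n) (𝓡 n) φ x u))
        (ext (mfderiv (𝓡 n) (𝓡 n) φ x v)) (φ x) := by
    rw [hnabla'.bracket hU' hV', hnabla.bracket hU hV, map_sub,
      h.cov_related hV hV' (Eventually.of_forall hVV),
      h.cov_related hU hU' (Eventually.of_forall hUU), hUU, hVV]
  have h1 := curvature_field hn hnabla' hU' hV' hW'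
  rw [hu, hv, hw] at h1
  rw [h1, curvature_eq_curvField]
  unfold curvField
  rw [map_sub, map_sub, key hV hV' hVV, key hU hU' hUU,
    h.cov_related hW hW' (Eventually.of_forall hWW), hb, hu, hv, ext_self, ext_self]

theorem ricci_eq (hn : n ≠ 0) (h : IsAffineLocalDiffeo nabla' nabla φ)
    (hnabla : IsSmoothTorsionFree nabla) (hnabla' : IsSmoothTorsionFree nabla') (x : M')
    (u v : TangentSpace (𝓡 n) x) :
    ricci nabla' x u v
      = ricci nabla (φ x) (mfderiv (𝓡 n) (𝓡 n) φ x u) (mfderiv (𝓡 n) (𝓡 n) φ x v) := by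
  rw [ricci_eq_trace hn hnabla' x ((coordBasis (φ x)).map (h.tangentEquiv x).symm), ricci]
  refine Finset.sum_congr rfl fun c _ => ?_
  rw [Module.Basis.map_repr, LinearEquiv.trans_apply, LinearEquiv.symm_symm,
    h.tangentEquiv_apply, h.curvature_eq hn hnabla hnabla', Module.Basis.map_apply,
    ← h.tangentEquiv_apply x ((h.tangentEquiv x).symm _), LinearEquiv.apply_symm_apply]

theorem schouten_eq (hn : n ≠ 0) (h : IsAffineLocalDiffeo nabla' nabla φ)
    (hnabla : IsSmoothTorsionFree nabla) (hnabla' : IsSmoothTorsionFree nabla') (x : M')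
    (u v : TangentSpace (𝓡 n) x) :
    schouten nabla' x u v
      = schouten nabla (φ x) (mfderiv (𝓡 n) (𝓡 n) φ x u) (mfderiv (𝓡 n) (𝓡 n) φ x v) := by
  simp only [schouten, h.ricci_eq hn hnabla hnabla']

theorem weyl_eq (hn : n ≠ 0) (h : IsAffineLocalDiffeo nabla' nabla φ)
    (hnabla : IsSmoothTorsionFree nabla) (hnabla' : IsSmoothTorsionFree nabla') (x : M')
    (u v w : TangentSpace (𝓡 n) x) :
    h.tangentEquiv x (weyl nabla' x u v w)
      = weyl nabla (φ x) (h.tangentEquiv x u) (h.tangentEquiv x v) (h.tangentEquiv x w) := by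
  simp only [h.tangentEquiv_apply, weyl, beta, map_add, map_sub, map_smul,
    h.curvature_eq hn hnabla hnabla', h.schouten_eq hn hnabla hnabla']

theorem cotton_eq (hn : n ≠ 0) (h : IsAffineLocalDiffeo nabla' nabla φ)
    (hnabla : IsSmoothTorsionFree nabla) (hnabla' : IsSmoothTorsionFree nabla') (x : M')
    (w u v : TangentSpace (𝓡 n) x) :
    cotton nabla' x w u v = cotton nabla (φ x) (mfderiv (𝓡 n) (𝓡 n) φ x w)
      (mfderiv (𝓡 n) (𝓡 n) φ x u) (mfderiv (𝓡 n) (𝓡 n) φ x v) := by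
  have h1 := h.covDeriv₂_eq (schouten_smoothForm hn hnabla) (schouten_smoothForm hn hnabla')
    (h.schouten_eq hn hnabla hnabla') x
  rw [cotton, cotton, h1, h1]

theorem normQ_ne_zero (hn : n ≠ 0) (h : IsAffineLocalDiffeo nabla' nabla φ)
    (hnabla : IsSmoothTorsionFree nabla) (hnabla' : IsSmoothTorsionFree nabla') (q : Input n)
    (x : M') (hQ : normQ q nabla (φ x) ≠ 0) : normQ q nabla' x ≠ 0 := by
  refine detQ_ne_zero_of_basis (weyl_trilinear hn hnabla' x) q
    ((coordBasis (φ x)).map (h.tangentEquiv x).symm) (coordBasis x) ?_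
  rwa [detQ, components_map _ _ (h.weyl_eq hn hnabla hnabla' x)]

theorem DQ_eq (hn : n ≠ 0) (h : IsAffineLocalDiffeo nabla' nabla φ)
    (hnabla : IsSmoothTorsionFree nabla) (hnabla' : IsSmoothTorsionFree nabla') (q : Input n)
    (x : M') (α β : Module.Dual ℝ (TangentSpace (𝓡 n) (φ x))) (v : TangentSpace (𝓡 n) x)
    (θ : Module.Dual ℝ (TangentSpace (𝓡 n) (φ x))) :
    DQ q nabla' x (α ∘ₗ (mfderiv (𝓡 n) (𝓡 n) φ x).toLinearMap)
        (β ∘ₗ (mfderiv (𝓡 n) (𝓡 n) φ x).toLinearMap) v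
        (θ ∘ₗ (mfderiv (𝓡 n) (𝓡 n) φ x).toLinearMap) =
      DQ q nabla (φ x) α β (mfderiv (𝓡 n) (𝓡 n) φ x v) θ := by
  have h1 := Dtensor_map (h.tangentEquiv x) q (coordBasis (φ x))
    (h.weyl_eq hn hnabla hnabla' x) α β v θ
  rw [h.tangentEquiv_toLinearMap, h.tangentEquiv_apply] at h1
  rw [DQ, DQ, ← h1, Dtensor_basis (weyl_trilinear hn hnabla' x) q
    ((coordBasis (φ x)).map (h.tangentEquiv x).symm) (coordBasis x)]

theorem DC_eq (hn : n ≠ 0) (h : IsAffineLocalDiffeo nabla' nabla φ)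
    (hnabla : IsSmoothTorsionFree nabla) (hnabla' : IsSmoothTorsionFree nabla') (q : Input n)
    (x : M') (v : TangentSpace (𝓡 n) x) :
    DC q nabla' x v = DC q nabla (φ x) (mfderiv (𝓡 n) (𝓡 n) φ x v) := by
  rw [ProjEinstein.DC_eq hn hnabla q (φ x) (coordBasis (φ x)),
    ProjEinstein.DC_eq hn hnabla' q x ((coordBasis (φ x)).map (h.tangentEquiv x).symm),
    components_map _ _ (h.weyl_eq hn hnabla hnabla' x)]
  have hb : ∀ i, mfderiv (𝓡 n) (𝓡 n) φ x ((coordBasis (φ x)).map (h.tangentEquiv x).symm i)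
      = coordBasis (φ x) i := by
    intro i
    rw [← h.tangentEquiv_apply, Module.Basis.map_apply, LinearEquiv.apply_symm_apply]
  simp only [h.cotton_eq hn hnabla hnabla', hb, Module.Basis.map_repr, LinearEquiv.trans_apply,
    LinearEquiv.symm_symm, h.tangentEquiv_apply]

theorem GQ_eq (hn : n ≠ 0) (h : IsAffineLocalDiffeo nabla' nabla φ)
    (hnabla : IsSmoothTorsionFree nabla) (hnabla' : IsSmoothTorsionFree nabla') (q : Input n)
    (hQ : ∀ x, normQ q nabla x ≠ 0) (x : M') (u v : TangentSpace (𝓡 n) x) :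
    GQ q nabla' x u v
      = GQ q nabla (φ x) (mfderiv (𝓡 n) (𝓡 n) φ x u) (mfderiv (𝓡 n) (𝓡 n) φ x v) := by
  have hQ' := fun x => h.normQ_ne_zero hn hnabla hnabla' q x (hQ (φ x))
  have h1 := h.covDeriv₁_eq (DC_smoothForm hn hnabla q hQ) (DC_smoothForm hn hnabla' q hQ')
    (h.DC_eq hn hnabla hnabla' q) x
  rw [GQ, GQ, h1, h.schouten_eq hn hnabla hnabla', h.DC_eq hn hnabla hnabla',
    h.DC_eq hn hnabla hnabla']

theorem EQ_eq (hn : n ≠ 0) (h : IsAffineLocalDiffeo nabla' nabla φ)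
    (hnabla : IsSmoothTorsionFree nabla) (hnabla' : IsSmoothTorsionFree nabla') (q : Input n)
    (hQ : ∀ x, normQ q nabla x ≠ 0) (x : M') (u v w : TangentSpace (𝓡 n) x) :
    EQ q nabla' x u v w = EQ q nabla (φ x) (mfderiv (𝓡 n) (𝓡 n) φ x u)
      (mfderiv (𝓡 n) (𝓡 n) φ x v) (mfderiv (𝓡 n) (𝓡 n) φ x w) := by
  have hQ' := fun x => h.normQ_ne_zero hn hnabla hnabla' q x (hQ (φ x))
  have hG := h.GQ_eq hn hnabla hnabla' q hQ
  have h1 := h.covDeriv₂_eq (GQ_smoothForm hn hnabla q hQ) (GQ_smoothForm hn hnabla' q hQ') hG x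
  simp only [EQ, h1, hG, h.DC_eq hn hnabla hnabla']

theorem gammaQ_eq (hn : n ≠ 0) (h : IsAffineLocalDiffeo nabla' nabla φ)
    (hnabla : IsSmoothTorsionFree nabla) (hnabla' : IsSmoothTorsionFree nabla') (q : Input n)
    (hQ : ∀ x, normQ q nabla x ≠ 0) (x : M') (u v : Fin n → TangentSpace (𝓡 n) x) :
    gammaQ q nabla' x u v = gammaQ q nabla (φ x) (fun i => mfderiv (𝓡 n) (𝓡 n) φ x (u i))
      (fun i => mfderiv (𝓡 n) (𝓡 n) φ x (v i)) := by
  simp only [gammaQ, gammaForm, h.GQ_eq hn hnabla hnabla' q hQ]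

end IsAffineLocalDiffeo

end Naturality

/-! ### Smooth sections of bundles of homomorphisms -/

section SmoothSections

open scoped Topology
open Filter

variable {n : ℕ} {M : Type*} [TopologicalSpace M] [ChartedSpace (EuclideanSpace ℝ (Fin n)) M]
  [IsManifold (𝓡 n) ∞ M]

/-- A section of a bundle of homomorphisms out of the tangent bundle is smooth as soon as its
values on smooth vector fields are. -/
theorem contMDiffAt_hom_of_fields {F : Type*} [NormedAddCommGroup F] [NormedSpace ℝ F]
    {E : M → Type*} [∀ x, AddCommGroup (E x)] [∀ x, Module ℝ (E x)]
    [TopologicalSpace (TotalSpace F E)] [∀ x, TopologicalSpace (E x)]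
    [FiberBundle F E] [VectorBundle ℝ F E] [∀ x, IsTopologicalAddGroup (E x)]
    [∀ x, ContinuousSMul ℝ (E x)] {x : M} (ϕ : (y : M) → TangentSpace (𝓡 n) y →L[ℝ] E y)
    (h : ∀ V : VField n M, SmoothVF V x →
      ContMDiffAt (𝓡 n) ((𝓡 n).prod 𝓘(ℝ, F)) ∞ (fun y => TotalSpace.mk' F y (ϕ y (V y))) x) :
    ContMDiffAt (𝓡 n) ((𝓡 n).prod 𝓘(ℝ, EuclideanSpace ℝ (Fin n) →L[ℝ] F)) ∞
      (fun y => TotalSpace.mk' (EuclideanSpace ℝ (Fin n) →L[ℝ] F)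
        (E := fun y : M => TangentSpace (𝓡 n) y →L[ℝ] E y) y (ϕ y)) x := by
  rw [contMDiffAt_hom_bundle]
  refine ⟨contMDiffAt_id, ?_⟩
  let b := (EuclideanSpace.basisFun (Fin n) ℝ).toBasis
  let t := trivializationAt (EuclideanSpace ℝ (Fin n)) (TangentSpace (𝓡 n) : M → Type _) x
  have ht : ∀ᶠ y in 𝓝 x, y ∈ t.baseSet :=
    t.open_baseSet.mem_nhds (FiberBundle.mem_baseSet_trivializationAt' x)
  have ht' : ∀ᶠ y in 𝓝 x, y ∈ (trivializationAt F E x).baseSet :=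
    (trivializationAt F E x).open_baseSet.mem_nhds (FiberBundle.mem_baseSet_trivializationAt' x)
  have h1 : ∀ i, ContMDiffAt (𝓡 n) 𝓘(ℝ, F) ∞
      (fun y => (trivializationAt F E x ⟨y, ϕ y (t.localFrame b i y)⟩).2) x := by
    intro i
    refine (contMDiffAt_section x).1 (h _ ?_)
    filter_upwards [ht] with y hy
    exact contMDiffAt_localFrame_of_mem ∞ t b i hy
  -- a linear map is the sum of its values on a basis times the dual basis
  let S : Fin n → F →L[ℝ] (EuclideanSpace ℝ (Fin n) →L[ℝ] F) := fun i =>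
    ContinuousLinearMap.smulRightL ℝ (EuclideanSpace ℝ (Fin n)) F
      (LinearMap.toContinuousLinearMap (b.coord i))
  have h2 : ContMDiffAt (𝓡 n) 𝓘(ℝ, EuclideanSpace ℝ (Fin n) →L[ℝ] F) ∞
      (fun y => ∑ i, S i (trivializationAt F E x ⟨y, ϕ y (t.localFrame b i y)⟩).2) x :=
    ContMDiffAt.sum fun i _ => (S i).contMDiff.contMDiffAt.comp x (h1 i)
  refine h2.congr_of_eventuallyEq ?_
  filter_upwards [ht, ht'] with y hy hy'
  refine ContinuousLinearMap.coe_injective (b.ext fun i => ?_)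
  have h3 : ∀ j, S j (trivializationAt F E x ⟨y, ϕ y (t.localFrame b j y)⟩).2 (b i)
      = if i = j then (trivializationAt F E x ⟨y, ϕ y (t.localFrame b j y)⟩).2 else 0 := by
    intro j
    simp only [S, ContinuousLinearMap.smulRightL_apply_apply, ContinuousLinearMap.smulRight_apply,
      LinearMap.coe_toContinuousLinearMap', Module.Basis.coord_apply, Module.Basis.repr_self,
      Finsupp.single_apply, ite_smul, one_smul, zero_smul]
  rw [ContinuousLinearMap.coe_coe, ContinuousLinearMap.coe_coe, _root_.sum_apply,
    Finset.sum_congr rfl fun j _ => h3 j, Finset.sum_ite_eq, if_pos (Finset.mem_univ i),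
    ContinuousLinearMap.inCoordinates_eq hy hy', t.localFrame_apply_of_mem_baseSet b hy]
  rfl

/-- Linear maps out of the tangent spaces are continuous. -/
def tangentCLM {x : M} {X : Type*} [AddCommGroup X] [Module ℝ X] [TopologicalSpace X]
    [IsTopologicalAddGroup X] [ContinuousSMul ℝ X] (L : TangentSpace (𝓡 n) x →ₗ[ℝ] X) :
    TangentSpace (𝓡 n) x →L[ℝ] X :=
  haveI : FiniteDimensional ℝ (TangentSpace (𝓡 n) x) :=
    inferInstanceAs (FiniteDimensional ℝ (EuclideanSpace ℝ (Fin n)))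
  haveI : T2Space (TangentSpace (𝓡 n) x) :=
    inferInstanceAs (T2Space (EuclideanSpace ℝ (Fin n)))
  LinearMap.toContinuousLinearMap L

/-- A linear form on a tangent space as a continuous linear map. -/
def toCovector {x : M} {θ : TangentSpace (𝓡 n) x → ℝ} (hθ : IsLinearMap ℝ θ) :
    TangentSpace (𝓡 n) x →L[ℝ] ℝ :=
  tangentCLM hθ.mk'

/-- A bilinear form on a tangent space as a continuous linear map. -/
def toCoBilin {x : M} {T : TangentSpace (𝓡 n) x → TangentSpace (𝓡 n) x → ℝ}
    (hT : IsBilinear T) : TangentSpace (𝓡 n) x →L[ℝ] TangentSpace (𝓡 n) x →L[ℝ] ℝ :=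
  tangentCLM
    { toFun := fun v => toCovector (hT.right v)
      map_add' := fun v w => ContinuousLinearMap.ext fun u => (hT.left u).map_add v w
      map_smul' := fun c v => ContinuousLinearMap.ext fun u => (hT.left u).map_smul c v }

theorem SmoothForm₁.contMDiff {θ : (x : M) → TangentSpace (𝓡 n) x → ℝ} (hθ : SmoothForm₁ θ) :
    ContMDiff (𝓡 n) ((𝓡 n).prod 𝓘(ℝ, EuclideanSpace ℝ (Fin n) →L[ℝ] ℝ)) ∞
      (fun x => TotalSpace.mk' (EuclideanSpace ℝ (Fin n) →L[ℝ] ℝ)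
        (E := fun x : M => TangentSpace (𝓡 n) x →L[ℝ] ℝ) x (toCovector (hθ.linear x))) := by
  intro x
  refine contMDiffAt_hom_of_fields (E := fun _ : M => ℝ) _ fun V hV => ?_
  exact (contMDiffAt_section _).2 (hθ.smooth hV).self

theorem SmoothForm₂.contMDiff {T : (x : M) → TangentSpace (𝓡 n) x → TangentSpace (𝓡 n) x → ℝ}
    (hT : SmoothForm₂ T) : ContMDiff (𝓡 n)
    ((𝓡 n).prod 𝓘(ℝ, EuclideanSpace ℝ (Fin n) →L[ℝ] EuclideanSpace ℝ (Fin n) →L[ℝ] ℝ)) ∞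
    (fun x => TotalSpace.mk' (EuclideanSpace ℝ (Fin n) →L[ℝ] EuclideanSpace ℝ (Fin n) →L[ℝ] ℝ)
      (E := fun x : M => TangentSpace (𝓡 n) x →L[ℝ] TangentSpace (𝓡 n) x →L[ℝ] ℝ) x
      (toCoBilin (hT.bilinear x))) := by
  intro x
  refine contMDiffAt_hom_of_fields (E := fun x : M => TangentSpace (𝓡 n) x →L[ℝ] ℝ) _
    fun V hV => ?_
  refine contMDiffAt_hom_of_fields (E := fun _ : M => ℝ) _ fun W hW => ?_
  exact (contMDiffAt_section _).2 (hT.smooth hV hW).self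

theorem PseudoMetric.smoothForm (g : PseudoMetric n M) :
    SmoothForm₂ fun (x : M) u v => g.inner x u v where
  bilinear x := ⟨fun v => ⟨fun u u' => by simp, fun c u => by simp⟩,
    fun u => (g.inner x u).toLinearMap.isLinear⟩
  smooth {x V W} hV hW := by
    filter_upwards [hV, hW] with y hy hy'
    have h1 := ContMDiffAt.clm_bundle_apply₂ (F₁ := EuclideanSpace ℝ (Fin n))
      (F₂ := EuclideanSpace ℝ (Fin n)) (F₃ := ℝ)
      (E₁ := fun x : M => TangentSpace (𝓡 n) x) (E₂ := fun x : M => TangentSpace (𝓡 n) x)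
      (E₃ := fun _ : M => ℝ) (b := fun y : M => y)
      (ψ := fun y => g.inner y) (v := V) (w := W) (g.contMDiff y) hy hy'
    exact (contMDiffAt_section _).1 h1

/-! ### Existence of projective changes -/

/-- The endomorphism-valued 1-form by which a projective change with the covector `Υ` acts,
`Y ↦ (v ↦ Υ(v) Y + Υ(Y) v)`. -/
def changeForm {x : M} (Υ : TangentSpace (𝓡 n) x →L[ℝ] ℝ) :
    TangentSpace (𝓡 n) x →L[ℝ] TangentSpace (𝓡 n) x →L[ℝ] TangentSpace (𝓡 n) x :=
  tangentCLM
    { toFun := fun Y => Υ.smulRight Y + Υ Y • ContinuousLinearMap.id ℝ _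
      map_add' := fun Y Z => by ext1 v; simp; module
      map_smul' := fun c Y => by ext1 v; simp; module }

/-- Every smooth 1-form defines a projective change, and the result is again smooth and
torsion-free. -/
theorem exists_isProjectiveChange [T2Space M] {nabla : AffineConnection n M}
    (hnabla : IsSmoothTorsionFree nabla) {θ : (x : M) → TangentSpace (𝓡 n) x → ℝ}
    (hθ : SmoothForm₁ θ) :
    ∃ nabla' : AffineConnection n M, IsSmoothTorsionFree nabla' ∧
      ProjectivelyEquivalent nabla nabla' ∧ IsProjectiveChange nabla nabla' θ := by
  let nabla' : AffineConnection n M :=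
    nabla.addOneForm fun x => changeForm (toCovector (hθ.linear x))
  have hval : ∀ (x : M) (Y : VField n M) (v : TangentSpace (𝓡 n) x),
      nabla' Y x v = nabla Y x v + θ x v • Y x + θ x (Y x) • v := by
    intro x Y v
    have : nabla' Y x v = nabla Y x v + (θ x v • Y x + θ x (Y x) • v) := rfl
    rw [this, add_assoc]
  refine ⟨nabla', ⟨⟨⟨fun {σ} hσ => ?_⟩⟩, ?_⟩,
    ⟨fun x => toCovector (hθ.linear x), hθ.contMDiff, fun x Y _ v => hval x Y v⟩,
    ⟨hθ, fun {x V} _ u => hval x V u⟩⟩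
  · intro x _
    refine (contMDiffAt_hom_of_fields (E := fun x : M => TangentSpace (𝓡 n) x) _
      fun V hV => ?_).contMDiffWithinAt
    have hs : SmoothVF σ x := Eventually.of_forall fun y =>
      hσ.contMDiffAt Filter.univ_mem
    refine SmoothVF.self (SmoothVF.congr (((hnabla.smooth_cov hV hs).add
      (SmoothVF.smul (hθ.smooth hV) hs)).add (SmoothVF.smul (hθ.smooth hs) hV)) ?_)
    exact Eventually.of_forall fun y => hval y σ (V y)
  · rw [CovariantDerivative.torsion_eq_zero_iff]
    intro X Y x hX hY
    rw [hval, hval,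
      ← (CovariantDerivative.torsion_eq_zero_iff nabla).1 hnabla.torsion_eq_zero hX hY]
    module

end SmoothSections

/-! ### Nondegeneracy -/

section Nondegeneracy

variable {n : ℕ} {V : Type*}

/-- The double alternation of a product is `n!` times a determinant. -/
theorem gammaForm_eq_det (G : V → V → ℝ) (u v : Fin n → V) :
    gammaForm G u v = (n.factorial : ℝ)⁻¹ * (Matrix.of fun i j => G (u i) (v j)).det := by
  have h1 : ∀ τ : Equiv.Perm (Fin n), ∑ σ : Equiv.Perm (Fin n),
      ((Equiv.Perm.sign σ : ℤ) : ℝ) * ∏ i, G (u (σ i)) (v (τ i))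
        = ((Equiv.Perm.sign τ : ℤ) : ℝ) * (Matrix.of fun i j => G (u i) (v j)).det := by
    intro τ
    rw [← Matrix.det_permute' τ, Matrix.det_apply']
    rfl
  have h2 : ∀ τ : Equiv.Perm (Fin n),
      ((Equiv.Perm.sign τ : ℤ) : ℝ) * ((Equiv.Perm.sign τ : ℤ) : ℝ) = 1 := by
    intro τ
    rw [← Int.cast_mul, Int.units_coe_mul_self, Int.cast_one]
  have h3 : (n.factorial : ℝ) ≠ 0 := by exact_mod_cast n.factorial_ne_zero
  unfold gammaForm
  rw [Finset.sum_comm]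
  have h4 : ∀ τ : Equiv.Perm (Fin n), ∑ σ : Equiv.Perm (Fin n),
      ((Equiv.Perm.sign σ : ℤ) : ℝ) * ((Equiv.Perm.sign τ : ℤ) : ℝ) *
        ∏ i, G (u (σ i)) (v (τ i)) = (Matrix.of fun i j => G (u i) (v j)).det := by
    intro τ
    rw [← one_mul (Matrix.det _), ← h2 τ, mul_assoc, ← h1 τ, Finset.mul_sum]
    exact Finset.sum_congr rfl fun σ _ => by ring
  rw [Finset.sum_congr rfl fun τ _ => h4 τ, Finset.sum_const, Finset.card_univ,
    Fintype.card_perm, Fintype.card_fin, nsmul_eq_mul]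
  field_simp

variable [AddCommGroup V] [Module ℝ V] {G : V → V → ℝ}

theorem IsBilinear.eq_sum (hG : IsBilinear G) (b : Module.Basis (Fin n) ℝ V) (v w : V) :
    G v w = ∑ i, ∑ j, b.repr v i * G (b i) (b j) * b.repr w j := by
  have h1 : ∀ w, G v w = ∑ i, b.repr v i * G (b i) w := by
    intro w
    have := congrArg (hG.left w).mk' (b.sum_repr v)
    rw [map_sum] at this
    simpa using this.symm
  have h2 : ∀ i, G (b i) w = ∑ j, b.repr w j * G (b i) (b j) := by
    intro i
    have := congrArg (hG.right (b i)).mk' (b.sum_repr w)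
    rw [map_sum] at this
    simpa using this.symm
  rw [h1]
  refine Finset.sum_congr rfl fun i _ => ?_
  rw [h2, Finset.mul_sum]
  exact Finset.sum_congr rfl fun j _ => by ring

/-- The complete skewing of a power of `G` does not vanish if and only if `G` is nondegenerate. -/
theorem gammaForm_ne_zero_iff (b : Module.Basis (Fin n) ℝ V) (hG : IsBilinear G) :
    (gammaForm G : (Fin n → V) → (Fin n → V) → ℝ) ≠ 0 ↔ ∀ v, (∀ w, G v w = 0) → v = 0 := by
  have h3 : (n.factorial : ℝ) ≠ 0 := by exact_mod_cast n.factorial_ne_zero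
  have h1 : (gammaForm G : (Fin n → V) → (Fin n → V) → ℝ) = 0 ↔
      (Matrix.of fun i j => G (b i) (b j)).det = 0 := by
    constructor
    · intro h
      have h4 := congrFun (congrFun h b) b
      rw [gammaForm_eq_det] at h4
      exact (mul_eq_zero.1 h4).resolve_left (inv_ne_zero h3)
    · intro h
      ext u v
      -- the Gram matrix in `u`, `v` is the product of that in `b` with the coordinate matrices
      have h4 : (Matrix.of fun i j => G (u i) (v j)) = (Matrix.of fun i j => b.repr (u i) j) *
          (Matrix.of fun i j => G (b i) (b j)) * (Matrix.of fun i j => b.repr (v j) i) := by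
        ext i j
        simp only [Matrix.mul_apply, Matrix.of_apply, hG.eq_sum b (u i) (v j), Finset.sum_mul]
        rw [Finset.sum_comm]
      rw [gammaForm_eq_det, h4, Matrix.det_mul, Matrix.det_mul, h]
      simp
  rw [ne_eq, h1, ← Matrix.exists_vecMul_eq_zero_iff]
  push Not
  constructor
  · intro h v hv
    by_contra hv0
    refine h (fun i => b.repr v i) (fun h0 => hv0 ?_) ?_
    · exact b.ext_elem fun i => by simpa using congrFun h0 i
    · ext j
      have := hG.eq_sum b v (b j)
      rw [hv] at this
      simpa [Matrix.vecMul, dotProduct, Finsupp.single_apply] using this.symm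
  · intro h c hc h0
    refine hc ?_
    have h4 : ∑ i, c i • b i = 0 := by
      refine h _ fun w => ?_
      rw [hG.eq_sum b, Finset.sum_comm]
      refine Finset.sum_eq_zero fun j _ => ?_
      have := congrFun h0 j
      simp only [Matrix.vecMul, dotProduct, Matrix.of_apply, Pi.zero_apply] at this
      rw [← Finset.sum_mul]
      simp only [Module.Basis.repr_sum_self]
      rw [this, zero_mul]
    ext i
    have := congrArg (fun v => b.repr v i) h4
    simpa [-map_sum, Module.Basis.repr_sum_self] using this

end Nondegeneracy

/-! ### Ricci-flat and Einstein representatives -/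

section Representatives

variable {n : ℕ} {M : Type*} [TopologicalSpace M] [ChartedSpace (EuclideanSpace ℝ (Fin n)) M]
  [IsManifold (𝓡 n) ∞ M] {nabla : AffineConnection n M}

theorem covDeriv₁_eq_zero {θ : (x : M) → TangentSpace (𝓡 n) x → ℝ} (hθ : ∀ x v, θ x v = 0)
    (x : M) (u v : TangentSpace (𝓡 n) x) : covDeriv₁ nabla θ x u v = 0 := by
  simp [covDeriv₁, hθ, mvfderiv_const_apply]

theorem covDeriv₂_const_mul {T : (x : M) → TangentSpace (𝓡 n) x → TangentSpace (𝓡 n) x → ℝ}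
    (hT : SmoothForm₂ T) (c : ℝ) (x : M) (u v w : TangentSpace (𝓡 n) x) :
    covDeriv₂ nabla (fun x u v => c * T x u v) x u v w = c * covDeriv₂ nabla T x u v w := by
  unfold covDeriv₂
  rw [mvfderiv_mul_apply (SmoothFn.const c)
    (hT.smooth (SmoothVF.ext_smooth v) (SmoothVF.ext_smooth w)), mvfderiv_const_apply]
  ring

theorem DC_eq_zero (q : Input n) (hC : ∀ x w u v, cotton nabla x w u v = 0) (x : M)
    (v : TangentSpace (𝓡 n) x) : DC q nabla x v = 0 := by
  simp [DC, hC]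

/-- In the gauge in which `D^{ab}_i^c C_{cab} = 0`, the invariant `G` is the projective Schouten
tensor. -/
theorem GQ_eq_schouten {q : Input n} (hD : ∀ x v, DC q nabla x v = 0) :
    GQ q nabla = schouten nabla := by
  ext x u v
  rw [GQ, covDeriv₁_eq_zero hD, hD]
  ring

theorem EQ_eq_covDeriv₂ {q : Input n} (hD : ∀ x v, DC q nabla x v = 0) (x : M)
    (u v w : TangentSpace (𝓡 n) x) :
    EQ q nabla x u v w = covDeriv₂ nabla (GQ q nabla) x u v w := by
  rw [EQ, hD, hD, hD]
  ring

/-- If the projective Schouten tensor is symmetric, then `Ric = (n - 1) P`. -/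
theorem ricci_eq_of_schouten_symm (hn : 2 ≤ n) {x : M} {u v : TangentSpace (𝓡 n) x}
    (h : schouten nabla x u v = schouten nabla x v u) :
    ricci nabla x u v = ((n : ℝ) - 1) * schouten nabla x u v := by
  rw [schouten_eq hn, beta, h]
  ring

/-- For an Einstein connection, `P` is a constant multiple of the metric. -/
theorem schouten_of_einstein (hn : 2 ≤ n) {g : PseudoMetric n M} {c : ℝ}
    (hg : ∀ (x : M) (u v : TangentSpace (𝓡 n) x), ricci nabla x u v = c * g.inner x u v) :
    schouten nabla = fun (x : M) u v => c / ((n : ℝ) - 1) * g.inner x u v := by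
  ext x u v
  have h : (2 : ℝ) ≤ n := by exact_mod_cast hn
  have h1 : (n : ℝ) - 1 ≠ 0 := by linarith
  have h2 : (n : ℝ) ^ 2 - 1 ≠ 0 := by nlinarith
  rw [schouten, hg, hg, g.symm x v u]
  field_simp
  ring

variable [T2Space M]

/-- When `Q` is nondegenerate, the projective class contains a connection for which the 1-form
`D^{ab}_i^c C_{cab}` vanishes: this form changes by `Υ`, hence `Υ = -D^{ab}_i^c C_{cab}` works. -/
theorem exists_isProjectiveChange_DC_eq_zero (hn : 2 ≤ n) (hnabla : IsSmoothTorsionFree nabla)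
    (q : Input n) (hQ : ∀ x, normQ q nabla x ≠ 0) :
    ∃ (nabla' : AffineConnection n M) (Υ : (x : M) → TangentSpace (𝓡 n) x → ℝ),
      IsSmoothTorsionFree nabla' ∧ ProjectivelyEquivalent nabla nabla' ∧
      IsProjectiveChange nabla nabla' Υ ∧ ∀ x v, DC q nabla' x v = 0 := by
  have hD := DC_smoothForm (by omega) hnabla q hQ
  have hΥ : SmoothForm₁ fun x v => -DC q nabla x v :=
    ⟨fun x => (-(hD.linear x).mk').isLinear, fun hV => (hD.smooth hV).neg⟩
  obtain ⟨nabla', h1, h2, h3⟩ := exists_isProjectiveChange hnabla hΥ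
  refine ⟨nabla', _, h1, h2, h3, fun x v => ?_⟩
  rw [h3.DC_eq hn hnabla q hQ, add_neg_cancel]

theorem GQ_eq_zero_iff (hn : 2 ≤ n) (hnabla : IsSmoothTorsionFree nabla) (q : Input n)
    (hQ : ∀ x, normQ q nabla x ≠ 0) :
    (∀ (x : M) (u v : TangentSpace (𝓡 n) x), GQ q nabla x u v = 0) ↔
      IsProjectivelyRicciFlat nabla := by
  constructor
  · intro hG
    obtain ⟨nabla', Υ, h1, h2, h3, h4⟩ :=
      exists_isProjectiveChange_DC_eq_zero hn hnabla q hQ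
    have hP : ∀ x u v, schouten nabla' x u v = 0 := by
      intro x u v
      rw [← GQ_eq_schouten h4, h3.GQ_eq hn hnabla q hQ, hG]
    refine ⟨nabla', h1, h2, fun x u v => ?_⟩
    rw [ricci_eq_of_schouten_symm hn (by rw [hP, hP]), hP, mul_zero]
  · rintro ⟨nabla', -, h2, hric⟩ x u v
    obtain ⟨Υ, h3⟩ := h2.exists_isProjectiveChange
    have hP : ∀ x u v, schouten nabla' x u v = 0 := by
      intro x u v
      simp [schouten, hric]
    have hC : ∀ x w u v, cotton nabla' x w u v = 0 := by
      intro x w u v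
      simp [cotton, covDeriv₂, hP, mvfderiv_const_apply]
    rw [← h3.GQ_eq hn hnabla q hQ, GQ_eq_schouten (DC_eq_zero q hC), hP]

theorem gammaQ_ne_zero_iff (hn : n ≠ 0) (hnabla : IsSmoothTorsionFree nabla) (q : Input n)
    (hQ : ∀ x, normQ q nabla x ≠ 0) (x : M) :
    gammaQ q nabla x ≠ 0 ↔
      ∀ v : TangentSpace (𝓡 n) x, (∀ w, GQ q nabla x v w = 0) → v = 0 :=
  gammaForm_ne_zero_iff (coordBasis x) ((GQ_smoothForm hn hnabla q hQ).bilinear x)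

theorem isEinsteinMetrisable_iff (hn : 2 ≤ n) (hnabla : IsSmoothTorsionFree nabla) (q : Input n)
    (hQ : ∀ x, normQ q nabla x ≠ 0) :
    IsEinsteinMetrisable nabla ↔
      (∀ (x : M) (u v w : TangentSpace (𝓡 n) x), EQ q nabla x u v w = 0) ∧
      (∀ (x : M) (u v : TangentSpace (𝓡 n) x), GQ q nabla x u v = GQ q nabla x v u) ∧
      (∀ x : M, gammaQ q nabla x ≠ 0) := by
  have hn1 : (n : ℝ) - 1 ≠ 0 := by
    have h : (2 : ℝ) ≤ n := by exact_mod_cast hn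
    linarith
  simp only [gammaQ_ne_zero_iff (by omega) hnabla q hQ]
  constructor
  · rintro ⟨g, nabla', c, hg, h2, hc, hric⟩
    obtain ⟨Υ, h3⟩ := h2.exists_isProjectiveChange
    have hP := schouten_of_einstein hn hric
    -- `P` is parallel, so the Cotton tensor vanishes and `∇'` is in the gauge in which `G = P`
    have hdP : ∀ x u v w, covDeriv₂ nabla' (schouten nabla') x u v w = 0 := by
      intro x u v w
      rw [hP, covDeriv₂_const_mul g.smoothForm, hg.2, mul_zero]
    have hC : ∀ x w u v, cotton nabla' x w u v = 0 := by
      intro x w u v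
      rw [cotton, hdP, hdP, sub_zero]
    have hD := DC_eq_zero q hC
    have hG : GQ q nabla = schouten nabla' := by
      rw [← h3.GQ_eq hn hnabla q hQ, GQ_eq_schouten hD]
    refine ⟨fun x u v w => ?_, fun x u v => ?_, fun x v hv => ?_⟩
    · rw [← h3.EQ_eq hn hnabla q hQ, EQ_eq_covDeriv₂ hD, GQ_eq_schouten hD, hdP]
    · simp only [hG, hP, g.symm x u v]
    · refine g.nondegenerate x v fun w => ?_
      have := hv w
      simp only [hG, hP] at this
      exact (mul_eq_zero.1 this).resolve_left (div_ne_zero hc hn1)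
  · rintro ⟨hE, hsymm, hnd⟩
    obtain ⟨nabla', Υ, h1, h2, h3, h4⟩ :=
      exists_isProjectiveChange_DC_eq_zero hn hnabla q hQ
    have hG' := GQ_smoothForm (by omega) hnabla q hQ
    have hP : schouten nabla' = GQ q nabla := by
      rw [← GQ_eq_schouten h4, h3.GQ_eq hn hnabla q hQ]
    refine ⟨⟨fun x => toCoBilin (hG'.bilinear x), hsymm, hnd, hG'.contMDiff⟩, nabla',
      (n : ℝ) - 1, ⟨h1, fun x u v w => ?_⟩, h2, hn1, fun x u v => ?_⟩
    · have h5 := EQ_eq_covDeriv₂ h4 x u v w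
      rw [h3.EQ_eq hn hnabla q hQ, h3.GQ_eq hn hnabla q hQ, hE] at h5
      exact h5.symm
    · rw [ricci_eq_of_schouten_symm hn (by rw [hP, hsymm]), hP]
      rfl

end Representatives

end

end ProjEinstein

theorem theorem5p6 {n : ℕ} (hn : 2 ≤ n) {M : Type*} [TopologicalSpace M] [T2Space M]
    [ChartedSpace (EuclideanSpace ℝ (Fin n)) M] [IsManifold (𝓡 n) ∞ M]
    (q : ProjEinstein.Input n) (nabla : ProjEinstein.AffineConnection n M)
    (hnabla : ProjEinstein.IsSmoothTorsionFree nabla)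
    (hQ : ∀ x : M, ProjEinstein.normQ q nabla x ≠ 0) :
    -- `D_(Q)` is a left inverse of `W`: `D^{ab}_i^c W_{ab}^j_c = δ_i^j`
    (∀ (x : M) (b : Module.Basis (Fin n) ℝ (TangentSpace (𝓡 n) x))
        (v : TangentSpace (𝓡 n) x) (θ : Module.Dual ℝ (TangentSpace (𝓡 n) x)),
      ∑ i : Fin n, ∑ j : Fin n, ∑ k : Fin n,
        ProjEinstein.DQ q nabla x (b.coord i) (b.coord j) v (b.coord k) *
          θ (ProjEinstein.weyl nabla x (b i) (b j) (b k)) = θ v) ∧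
    -- the recipe for `D_(Q)` yields the same tensor in every frame
    (∀ (x : M) (b : Module.Basis (Fin n) ℝ (TangentSpace (𝓡 n) x)),
      ProjEinstein.Dtensor q b (ProjEinstein.weyl nabla x) = ProjEinstein.DQ q nabla x) ∧
    -- the genericity condition and the fields `D`, `G`, `E`, `γ` are projectively invariant
    (∀ nabla' : ProjEinstein.AffineConnection n M, ProjEinstein.IsSmoothTorsionFree nabla' →
      ProjEinstein.ProjectivelyEquivalent nabla nabla' →
        (∀ x : M, ProjEinstein.normQ q nabla' x = ProjEinstein.normQ q nabla x) ∧
        ProjEinstein.DQ q nabla' = ProjEinstein.DQ q nabla ∧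
        ProjEinstein.GQ q nabla' = ProjEinstein.GQ q nabla ∧
        ProjEinstein.EQ q nabla' = ProjEinstein.EQ q nabla ∧
        ProjEinstein.gammaQ q nabla' = ProjEinstein.gammaQ q nabla) ∧
    -- they are natural, i.e. compatible with pullback by local diffeomorphisms
    (∀ (M' : Type*) [TopologicalSpace M'] [T2Space M']
        [ChartedSpace (EuclideanSpace ℝ (Fin n)) M'] [IsManifold (𝓡 n) ∞ M']
        (nabla' : ProjEinstein.AffineConnection n M') (φ : M' → M),
      ProjEinstein.IsSmoothTorsionFree nabla' →
      ProjEinstein.IsAffineLocalDiffeo nabla' nabla φ →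
      ∀ x : M',
        (ProjEinstein.normQ q nabla' x ≠ 0) ∧
        (∀ (α β : Module.Dual ℝ (TangentSpace (𝓡 n) (φ x))) (v : TangentSpace (𝓡 n) x)
            (θ : Module.Dual ℝ (TangentSpace (𝓡 n) (φ x))),
          ProjEinstein.DQ q nabla' x
              (α ∘ₗ (mfderiv (𝓡 n) (𝓡 n) φ x).toLinearMap)
              (β ∘ₗ (mfderiv (𝓡 n) (𝓡 n) φ x).toLinearMap) v
              (θ ∘ₗ (mfderiv (𝓡 n) (𝓡 n) φ x).toLinearMap) =
            ProjEinstein.DQ q nabla (φ x) α β (mfderiv (𝓡 n) (𝓡 n) φ x v) θ) ∧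
        (∀ u v : TangentSpace (𝓡 n) x,
          ProjEinstein.GQ q nabla' x u v =
            ProjEinstein.GQ q nabla (φ x) (mfderiv (𝓡 n) (𝓡 n) φ x u)
              (mfderiv (𝓡 n) (𝓡 n) φ x v)) ∧
        (∀ u v w : TangentSpace (𝓡 n) x,
          ProjEinstein.EQ q nabla' x u v w =
            ProjEinstein.EQ q nabla (φ x) (mfderiv (𝓡 n) (𝓡 n) φ x u)
              (mfderiv (𝓡 n) (𝓡 n) φ x v) (mfderiv (𝓡 n) (𝓡 n) φ x w)) ∧
        (∀ u v : Fin n → TangentSpace (𝓡 n) x,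
          ProjEinstein.gammaQ q nabla' x u v =
            ProjEinstein.gammaQ q nabla (φ x) (fun i => mfderiv (𝓡 n) (𝓡 n) φ x (u i))
              (fun i => mfderiv (𝓡 n) (𝓡 n) φ x (v i)))) ∧
    -- `G = 0` if and only if the class contains a Ricci-flat connection
    ((∀ (x : M) (u v : TangentSpace (𝓡 n) x), ProjEinstein.GQ q nabla x u v = 0) ↔
      ProjEinstein.IsProjectivelyRicciFlat nabla) ∧
    -- `γ` vanishes at a point if and only if `G` is degenerate there
    (∀ x : M, ProjEinstein.gammaQ q nabla x ≠ 0 ↔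
      ∀ v : TangentSpace (𝓡 n) x, (∀ w, ProjEinstein.GQ q nabla x v w = 0) → v = 0) ∧
    -- Einstein metrisability with nonvanishing Einstein constant
    (ProjEinstein.IsEinsteinMetrisable nabla ↔
      (∀ (x : M) (u v w : TangentSpace (𝓡 n) x), ProjEinstein.EQ q nabla x u v w = 0) ∧
      (∀ (x : M) (u v : TangentSpace (𝓡 n) x),
        ProjEinstein.GQ q nabla x u v = ProjEinstein.GQ q nabla x v u) ∧
      (∀ x : M, ProjEinstein.gammaQ q nabla x ≠ 0)) := by
  have hn0 : n ≠ 0 := by omega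
  refine ⟨fun x b v θ => ?_, fun x b => ?_, fun nabla' _ hp => ?_, ?_, ?_, ?_, ?_⟩
  · exact ProjEinstein.sum_Dtensor_coord_mul_self (ProjEinstein.weyl_trilinear hn0 hnabla x) q
      (ProjEinstein.coordBasis x) b (hQ x) v θ
  · exact ProjEinstein.Dtensor_basis (ProjEinstein.weyl_trilinear hn0 hnabla x) q
      (ProjEinstein.coordBasis x) b
  · obtain ⟨Υ, h⟩ := hp.exists_isProjectiveChange
    exact ⟨congrFun (h.normQ_eq hn hnabla q), h.DQ_eq hn hnabla q, h.GQ_eq hn hnabla q hQ,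
      h.EQ_eq hn hnabla q hQ, h.gammaQ_eq hn hnabla q hQ⟩
  · intro M' _ _ _ _ nabla' φ hnabla' h x
    exact ⟨h.normQ_ne_zero hn0 hnabla hnabla' q x (hQ (φ x)), h.DQ_eq hn0 hnabla hnabla' q x,
      h.GQ_eq hn0 hnabla hnabla' q hQ x, h.EQ_eq hn0 hnabla hnabla' q hQ x,
      h.gammaQ_eq hn0 hnabla hnabla' q hQ x⟩
  · exact ProjEinstein.GQ_eq_zero_iff hn hnabla q hQ
  · exact ProjEinstein.gammaQ_ne_zero_iff hn0 hnabla q hQ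
  · exact ProjEinstein.isEinsteinMetrisable_iff hn hnabla q hQ
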